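/- Let $T=\mathbb R^2/\mathbb Z^2$ be the oriented two-torus. A dimer model $G=(B,W,E)$ consists of finite sets $B,W\subset T$ of black and white nodes and a finite non-empty set $E$ of edges, each an embedded closed interval joining a black node to a white node, such that two edges meet only at end points, every node lies on an edge, and the edges divide $T$ into simply-connected polygons (dimer models are considered up to orientation-preserving homeomorphism, i.e. through the cyclic orders of the edges around the nodes together with the pull-back of the graph to $\mathbb R^2$). Assume moreover that every node of $G$ has valence at least two. A zig-zag path on the universal cover $\widetilde G\subset\mathbb R^2$ is a sequence $(e_i)_{i\in\mathbb Z}$ of edges, up to translation of $i$, forming a path which makes a maximal turn to the right at every white node and a maximal turn to the left at every black node. It is homologically trivial if $i\mapsto e_i$ is periodic. Let $z=(e_i)$ and $w=(f_i)$ be two zig-zag paths with $e_i=f_j$. Let $u\ge 0\ge v$ be the ends of the maximal interval of integers $t$, containing $0$, on which $e_{i+t}=f_{j-t}$. If $u-v$ is even, then the sequence $(e_{i+v}=f_{j-v},\dots,e_{i+u}=f_{j-u})$ counts as one intersection of $z$ and $w$. The path $z$ has a self-intersection if there are $i\neq j$ with $e_i=e_j$ such that $z$ has opposite directions at $e_i$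 and $e_j$ and $u-v$ is even, with $u,v$ defined in the same way with $w=z$. The dimer model $G$ is consistent if 1. there is no homologically trivial zig-zag path; 2. no zig-zag path has a self-intersection on the universal cover; 3. no pair of distinct zig-zag paths on the universal cover intersects more than once in the same direction, i.e. there are no two intersections $a,b$ of distinct zig-zag paths $z,w$ on the universal cover such that both $z$ and $w$ point from $a$ to $b$. A perfect matching is a set $D\subset E$ such that every node is an end point of exactly one edge in $D$; $G$ is non-degenerate if every edge belongs to some perfect matching. **Proposition.** Every consistent dimer model all of whose nodes have valence at least two is non-degenerate. -/

import Mathlib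

/-- A finite bicolored graph drawn on an oriented surface, recorded by its rotation system.
`B`, `W`, `E` are the black nodes, the white nodes and the edges. An edge `e` joins `white e` to
`black e`. `rotB e` is the next edge after `e` in the counterclockwise cyclic order of the edges
around `black e`, and `rotW e` is the next edge after `e` in the counterclockwise cyclic order of the
edges around `white e`. Every node lies on an edge; multiple edges are allowed. -/
structure BicoloredRibbonGraph (B W E : Type*) where
  finite_edges : Finite E
  black : E → B
  white : E → W
  black_surjective : Function.Surjective black
  white_surjective : Function.Surjective white
  rotB : Equiv.Perm E
  rotW : Equiv.Perm E
  rotB_sameCycle_iff : ∀ e f, rotB.SameCycle e f ↔ black e = black f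
  rotW_sameCycle_iff : ∀ e f, rotW.SameCycle e f ↔ white e = white f

namespace BicoloredRibbonGraph

variable {B W E : Type*} (G : BicoloredRibbonGraph B W E)

/-- Walk along an edge from its white to its black node, turn maximally left there, walk along the
next edge from its black to its white node, and turn maximally left again. This goes once around the
boundary of the face on the left, and every face is met in this way, so the orbits of `facePerm` are
the faces of the drawing: a face which is a `2m`-gon is an orbit with `m` elements. -/
def facePerm : Equiv.Perm E := G.rotW⁻¹ * G.rotB⁻¹

/-- The set of faces: the orbits of `facePerm`. -/
def Face : Type _ := Quotient (Equiv.Perm.SameCycle.setoid G.facePerm)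

/-! The pull-back of a graph on `ℝ² / ℤ²` to `ℝ²`. Choose a lift to `ℝ²` of every node. Then the
nodes of the pull-back are labelled by `W × ℤ²` and `B × ℤ²`, and the lift of an edge `e` that starts at the
white node `(white e, x)` ends at the black node `(black e, x + d e)` for some `d : E → ℤ²`. This
lift is labelled by `(e, x)`. -/

/-- The black end of a lifted edge. -/
def coverBlack (d : E → ℤ × ℤ) (p : E × (ℤ × ℤ)) : B × (ℤ × ℤ) := (G.black p.1, p.2 + d p.1)

/-- The white end of a lifted edge. -/
def coverWhite (p : E × (ℤ × ℤ)) : W × (ℤ × ℤ) := (G.white p.1, p.2)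

/-- The counterclockwise rotation of the lifted edges around their black ends. -/
def coverRotB (d : E → ℤ × ℤ) : Equiv.Perm (E × (ℤ × ℤ)) where
  toFun p := (G.rotB p.1, p.2 + d p.1 - d (G.rotB p.1))
  invFun p := (G.rotB⁻¹ p.1, p.2 + d p.1 - d (G.rotB⁻¹ p.1))
  left_inv p := by simp
  right_inv p := by simp

/-- The counterclockwise rotation of the lifted edges around their white ends. -/
def coverRotW : Equiv.Perm (E × (ℤ × ℤ)) where
  toFun p := (G.rotW p.1, p.2)
  invFun p := (G.rotW⁻¹ p.1, p.2)
  left_inv p := by simp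
  right_inv p := by simp

/-- Walking around a face of the pull-back, as in `facePerm`. -/
def coverFacePerm (d : E → ℤ × ℤ) : Equiv.Perm (E × (ℤ × ℤ)) :=
  G.coverRotW⁻¹ * (G.coverRotB d)⁻¹

end BicoloredRibbonGraph

/-- A dimer model: a bicolored graph on the oriented torus `T = ℝ² / ℤ²` whose edges divide `T` into
simply-connected polygons, up to orientation-preserving homeomorphism.
The surface obtained by gluing in one disk for every face of the rotation system is the torus
(`cover_connected` and `euler_characteristic`), and `shift` describes the pull-back of the graph to
`ℝ²`: this pull-back is connected, and the boundary of each face lifts to a closed curve, because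
the faces are simply-connected. Hence the pull-back is the graph on the universal cover, and `ℤ²` is
its group of deck transformations. -/
structure DimerModel (B W E : Type*) extends BicoloredRibbonGraph B W E where
  nonempty_edges : Nonempty E
  shift : E → ℤ × ℤ
  /-- Any two lifted edges are joined by a chain of lifted edges with common nodes. -/
  cover_connected : ∀ p q : E × (ℤ × ℤ), Relation.ReflTransGen
    (fun a b ↦ toBicoloredRibbonGraph.coverWhite a = toBicoloredRibbonGraph.coverWhite b ∨
      toBicoloredRibbonGraph.coverBlack shift a = toBicoloredRibbonGraph.coverBlack shift b) p q
  /-- Going once around a face, one comes back to the same lifted edge. -/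
  face_closed : ∀ (n : ℕ) (e : E) (x : ℤ × ℤ), (toBicoloredRibbonGraph.facePerm ^ n) e = e →
    (toBicoloredRibbonGraph.coverFacePerm shift ^ n) (e, x) = (e, x)
  /-- The Euler characteristic of the torus is zero. -/
  euler_characteristic :
    Nat.card B + Nat.card W + Nat.card toBicoloredRibbonGraph.Face = Nat.card E

namespace DimerModel

variable {B W E : Type*} (G : DimerModel B W E)

/-- Every node has valence at least two. -/
def NoUnivalentNode : Prop :=
  (∀ e, ∃ f, f ≠ e ∧ G.black f = G.black e) ∧ (∀ e, ∃ f, f ≠ e ∧ G.white f = G.white e)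

/-- A perfect matching: a set of edges such that every node lies on exactly one of them. -/
def IsPerfectMatching (D : Set E) : Prop :=
  (∀ b : B, ∃! e, e ∈ D ∧ G.black e = b) ∧ (∀ w : W, ∃! e, e ∈ D ∧ G.white e = w)

/-- Every edge lies in some perfect matching. -/
def NonDegenerate : Prop := ∀ e : E, ∃ D : Set E, G.IsPerfectMatching D ∧ e ∈ D

/-- A zig-zag path on the universal cover, with a parametrization by `ℤ`. It walks along `edge i`
from white to black if `toBlack i = true`, and from black to white otherwise. It makes a maximal turn
to the left at black nodes (a clockwise step of the rotation) and to the right at white nodes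
(a counterclockwise step). -/
structure ZigzagPath where
  edge : ℤ → E × (ℤ × ℤ)
  toBlack : ℤ → Bool
  toBlack_succ : ∀ i, toBlack (i + 1) = !toBlack i
  turn_black : ∀ i, toBlack i = true → edge (i + 1) = (G.coverRotB G.shift)⁻¹ (edge i)
  turn_white : ∀ i, toBlack i = false → edge (i + 1) = G.coverRotW (edge i)

namespace ZigzagPath

variable {G}

/-- Two parametrized zig-zag paths are the same zig-zag path if they differ by a translation of the
parameter. -/
def Same (z w : G.ZigzagPath) : Prop :=
  ∃ k : ℤ, ∀ i, w.edge i = z.edge (i + k) ∧ w.toBlack i = z.toBlack (i + k)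

/-- `z` is homologically trivial: the map `i ↦ z.edge i` is periodic. -/
def HomologicallyTrivial (z : G.ZigzagPath) : Prop :=
  ∃ p : ℤ, p ≠ 0 ∧ ∀ i, z.edge (i + p) = z.edge i

/-- The maximal sequence `z.edge i = w.edge j, z.edge (i + 1) = w.edge (j - 1), …,
z.edge (i + n) = w.edge (j - n)` of common edges is one intersection of `z` and `w`: its number of
steps `n` is even. -/
def IntersectAt (z w : G.ZigzagPath) (i j : ℤ) (n : ℕ) : Prop :=
  (∀ t : ℕ, t ≤ n → z.edge (i + t) = w.edge (j - t)) ∧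
    z.edge (i - 1) ≠ w.edge (j + 1) ∧ z.edge (i + n + 1) ≠ w.edge (j - n - 1) ∧ Even n

/-- `z` passes through the same edge twice, in opposite directions, and the maximal sequence of
common edges has an even number of steps. -/
def HasSelfIntersection (z : G.ZigzagPath) : Prop :=
  ∃ (i j : ℤ) (n : ℕ), i ≠ j ∧ z.toBlack i ≠ z.toBlack j ∧ z.IntersectAt z i j n

/-- `z` and `w` have two intersections `a`, `b` such that both `z` and `w` point from `a` to `b`. -/
def IntersectTwiceInSameDirection (z w : G.ZigzagPath) : Prop :=
  ∃ (i j i' j' : ℤ) (n n' : ℕ), z.IntersectAt w i j n ∧ z.IntersectAt w i' j' n' ∧ i < i' ∧ j < j'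

end ZigzagPath

/-- Consistency of a dimer model. The zig-zag paths live on the universal cover; in the third
condition, `z` and `w` may be different lifts of the same zig-zag path on the torus. -/
structure Consistent : Prop where
  not_homologicallyTrivial : ∀ z : G.ZigzagPath, ¬ z.HomologicallyTrivial
  not_hasSelfIntersection : ∀ z : G.ZigzagPath, ¬ z.HasSelfIntersection
  not_intersectTwice : ∀ z w : G.ZigzagPath, ¬ z.Same w → ¬ z.IntersectTwiceInSameDirection w

end DimerModel

/-!
The perfect matchings come from the directions of the plane. Two zig-zag paths walk along an edge
`e` of the universal cover, one in each direction, and their forward halves bound a sector. The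
sectors of the edges at a node tile the plane. So if `u` is a generic direction, exactly one of the
edges at each node should have `u` in its sector near infinity, and these edges should form a
perfect matching.

The sector of `e` is encoded by its cochain on the corners of the cover (`sectorCochain`): the
intersection number of a corner with the boundary of the sector. It is closed, and closed cochains
have potentials, because the first homology of the cover vanishes (`mem_range_boundaryTwo`). This is
deduced from Euler's formula by a count of ranks over the group ring of `ℤ²`. The potentials
generalize the indicator functions of the sectors, and they add up to one at each node
(`sum_sectorB`, `sum_sectorW`). In a generic direction `u`, the potential of the sector of `e` is
eventually constant; this value is `edgeLimit e u`. If `u` turns, then `edgeLimit e u` changes only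
where `u` passes one of the two rays (`edgeLimit_sub`), and the change is, up to sign, the same
number `jump` for all edges (`jump_eq`). This number is not zero, by Stokes' theorem on the cylinder
on which a zig-zag path closes up (`jump_ne_zero`).

If there are no bivalent nodes, then consistency says that the two rays of a sector do not meet
again, and `edgeLimit e u` is zero or one. In general, consider the chains of edges through bivalent
nodes. The two zig-zag paths at `e` follow the chain of `e` in opposite directions, and if this
chain has an odd number of edges, it is an intersection of them; then `e` is called crossing. For
crossing edges, consistency implies that the potential takes only the values zero and one
(`sectorB_eq`), although the rays may touch again along chains with an even number of edges.
Moreover, the two rays have different directions (`smul_dir_ne`), so the limit is not constant, and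
`jump` is `1` or `-1`. Each edge which is not crossing has a partner next to it in its chain, and
the limits of the two add up to one (`edgeLimit_partner`). The same relation on the whole graph
excludes that there is no crossing edge (`exists_isCrossing`).

As `jump` is `1` or `-1`, the limits of any edge `e` take at most two values, which are consecutive.
Let `minLimit e` be the smaller one. The differences `edgeLimit e u - minLimit e` are zero or one,
and it remains to see that the minima at each node add up to zero, and that each edge has limits of
both kinds. Both follow from a count over all nodes (`sum_fiber_eq_zero`, `sum_minLimit`). So for
each generic `u` the edges with `edgeLimit e u = minLimit e + 1` form a perfect matching, and every
edge lies in one of these matchings. -/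

/-! ### The universal cover -/

namespace DimerModel

variable {B W E : Type*} (G : DimerModel B W E)

/-- The counterclockwise rotation of the lifted edges around their black ends. -/
abbrev rB : Equiv.Perm (E × (ℤ × ℤ)) := G.coverRotB G.shift

/-- The counterclockwise rotation of the lifted edges around their white ends. -/
abbrev rW : Equiv.Perm (E × (ℤ × ℤ)) := G.coverRotW

lemma rB_apply (p : E × (ℤ × ℤ)) :
    G.rB p = (G.rotB p.1, p.2 + G.shift p.1 - G.shift (G.rotB p.1)) := rfl

lemma rB_inv_apply (p : E × (ℤ × ℤ)) :
    G.rB⁻¹ p = (G.rotB⁻¹ p.1, p.2 + G.shift p.1 - G.shift (G.rotB⁻¹ p.1)) := rfl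

lemma rW_apply (p : E × (ℤ × ℤ)) : G.rW p = (G.rotW p.1, p.2) := rfl

lemma rW_inv_apply (p : E × (ℤ × ℤ)) : G.rW⁻¹ p = (G.rotW⁻¹ p.1, p.2) := rfl

@[simp] lemma rB_rB_inv (p : E × (ℤ × ℤ)) : G.rB (G.rB⁻¹ p) = p :=
  Equiv.apply_symm_apply _ _

@[simp] lemma rB_inv_rB (p : E × (ℤ × ℤ)) : G.rB⁻¹ (G.rB p) = p :=
  Equiv.symm_apply_apply _ _

@[simp] lemma rW_rW_inv (p : E × (ℤ × ℤ)) : G.rW (G.rW⁻¹ p) = p :=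
  Equiv.apply_symm_apply _ _

@[simp] lemma rW_inv_rW (p : E × (ℤ × ℤ)) : G.rW⁻¹ (G.rW p) = p :=
  Equiv.symm_apply_apply _ _

lemma rB_zpow_apply (k : ℤ) (p : E × (ℤ × ℤ)) :
    (G.rB ^ k) p = ((G.rotB ^ k) p.1, p.2 + G.shift p.1 - G.shift ((G.rotB ^ k) p.1)) := by
  induction k with
  | zero => simp
  | succ n ih => rw [add_comm, zpow_add, zpow_add, Equiv.Perm.mul_apply, ih]; simp [rB_apply]
  | pred n ih =>
    rw [sub_eq_add_neg, add_comm, zpow_add, zpow_add, Equiv.Perm.mul_apply, ih, zpow_neg_one]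
    simp [rB_inv_apply]

lemma rW_zpow_apply (k : ℤ) (p : E × (ℤ × ℤ)) : (G.rW ^ k) p = ((G.rotW ^ k) p.1, p.2) := by
  induction k with
  | zero => simp
  | succ n ih => rw [add_comm, zpow_add, zpow_add, Equiv.Perm.mul_apply, ih]; simp [rW_apply]
  | pred n ih =>
    rw [sub_eq_add_neg, add_comm, zpow_add, zpow_add, Equiv.Perm.mul_apply, ih, zpow_neg_one]
    simp [rW_inv_apply]

lemma apply_zpow_eq_of_invariant {α β : Type*} {σ : Equiv.Perm α} {f : α → β}
    (h : ∀ p, f (σ p) = f p) (k : ℤ) (p : α) : f ((σ ^ k) p) = f p := by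
  induction k with
  | zero => simp
  | succ n ih => rw [add_comm, zpow_add, Equiv.Perm.mul_apply, zpow_one, h, ih]
  | pred n ih =>
    rw [← h, ← Equiv.Perm.mul_apply, ← zpow_one_add, add_sub_cancel, ih]

/-- The connectedness of the cover, in the form in which it is used: a function of the lifted edges
which does not change under the rotations around the nodes is constant. -/
theorem eq_of_invariant {α : Type*} {f : E × (ℤ × ℤ) → α} (hB : ∀ p, f (G.rB p) = f p)
    (hW : ∀ p, f (G.rW p) = f p) (p q : E × (ℤ × ℤ)) : f p = f q := by
  have h := G.cover_connected p q
  induction h with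
  | refl => rfl
  | @tail a b _ hab ih =>
    rw [ih]
    rcases hab with h | h
    · simp only [BicoloredRibbonGraph.coverWhite, Prod.mk.injEq] at h
      obtain ⟨k, hk⟩ := (G.rotW_sameCycle_iff _ _).2 h.1
      have : b = (G.rW ^ k) a := by
        rw [rW_zpow_apply]; exact Prod.ext hk.symm h.2.symm
      rw [this, apply_zpow_eq_of_invariant hW]
    · simp only [BicoloredRibbonGraph.coverBlack, Prod.mk.injEq] at h
      obtain ⟨k, hk⟩ := (G.rotB_sameCycle_iff _ _).2 h.1
      have : b = (G.rB ^ k) a := by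
        rw [rB_zpow_apply]
        refine Prod.ext hk.symm ?_
        simp only [hk, h.2, add_sub_cancel_right]
      rw [this, apply_zpow_eq_of_invariant hB]

/-- A function of the edges on the torus which does not change under the rotations around the nodes
is constant. -/
theorem eq_of_invariant_edge {α : Type*} {f : E → α} (hB : ∀ e, f (G.rotB e) = f e)
    (hW : ∀ e, f (G.rotW e) = f e) (e e' : E) : f e = f e' :=
  G.eq_of_invariant (f := fun p ↦ f p.1) (fun p ↦ hB p.1) (fun p ↦ hW p.1) (e, 0) (e', 0)

/-- The face on the left of the walk of `facePerm` along an edge. -/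
def face (e : E) : G.Face := Quotient.mk (Equiv.Perm.SameCycle.setoid G.facePerm) e

lemma face_facePerm (e : E) : G.face (G.facePerm e) = G.face e :=
  Quotient.sound (s := Equiv.Perm.SameCycle.setoid G.facePerm)
    (Equiv.Perm.sameCycle_apply_left.2 (Equiv.Perm.SameCycle.refl _ _))

lemma face_surjective : Function.Surjective G.face := Quotient.exists_rep

lemma coverFacePerm_apply (p : E × (ℤ × ℤ)) : G.coverFacePerm G.shift p =
    (G.facePerm p.1, p.2 + (G.shift p.1 - G.shift (G.rotB⁻¹ p.1))) := by
  simp only [BicoloredRibbonGraph.coverFacePerm, BicoloredRibbonGraph.facePerm,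
    Equiv.Perm.mul_apply, rB_inv_apply, rW_inv_apply]
  exact Prod.ext rfl (add_sub_assoc _ _ _)

lemma coverFacePerm_pow_fst (n : ℕ) (p : E × (ℤ × ℤ)) :
    ((G.coverFacePerm G.shift ^ n) p).1 = (G.facePerm ^ n) p.1 := by
  induction n with
  | zero => rfl
  | succ n ih => rw [pow_succ', pow_succ', Equiv.Perm.mul_apply, coverFacePerm_apply, ih]; rfl

/-- Because the faces are simply connected, the lifts of the edges around a face can be chosen along
one lift of this face. -/
lemma exists_faceOffset : ∃ o : E → ℤ × ℤ,
    ∀ e, o (G.facePerm e) = o e + (G.shift e - G.shift (G.rotB⁻¹ e)) := by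
  have := G.finite_edges
  have key : ∀ (m n : ℕ) (r : E), m ≤ n → (G.facePerm ^ m) r = (G.facePerm ^ n) r →
      (G.coverFacePerm G.shift ^ m) (r, 0) = (G.coverFacePerm G.shift ^ n) (r, 0) := by
    intro m n r hmn h
    obtain ⟨k, rfl⟩ := Nat.exists_eq_add_of_le hmn
    rw [add_comm, pow_add, Equiv.Perm.mul_apply] at h ⊢
    set q := (G.coverFacePerm G.shift ^ m) (r, 0) with hq
    have hq1 : q.1 = (G.facePerm ^ m) r := G.coverFacePerm_pow_fst m (r, 0)
    have := G.face_closed k q.1 q.2 (by rw [hq1]; exact h.symm)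
    exact this.symm
  have key' : ∀ (m n : ℕ) (r : E), (G.facePerm ^ m) r = (G.facePerm ^ n) r →
      (G.coverFacePerm G.shift ^ m) (r, 0) = (G.coverFacePerm G.shift ^ n) (r, 0) := by
    intro m n r h
    rcases le_total m n with hmn | hmn
    · exact key m n r hmn h
    · exact (key n m r hmn h.symm).symm
  have hex : ∀ e, ∃ n : ℕ, (G.facePerm ^ n) (G.face e).out = e := fun e ↦
    (Quotient.exact (s := Equiv.Perm.SameCycle.setoid G.facePerm)
      (Quotient.out_eq (G.face e))).exists_nat_pow_eq
  choose N hN using hex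
  refine ⟨fun e ↦ ((G.coverFacePerm G.shift ^ N e) ((G.face e).out, 0)).2, fun e ↦ ?_⟩
  have h1 : (G.facePerm ^ N (G.facePerm e)) (G.face e).out =
      (G.facePerm ^ (N e + 1)) (G.face e).out := by
    rw [pow_succ', Equiv.Perm.mul_apply, hN e, ← G.face_facePerm e, hN]
  have h2 := key' _ _ _ h1
  simp only [G.face_facePerm e, h2]
  rw [pow_succ', Equiv.Perm.mul_apply, coverFacePerm_apply, coverFacePerm_pow_fst, hN e]

/-- A choice of lifts of the faces: the face on the left of the lifted edge `(e, x)` is the lift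
`x - faceOffset e` of the face on the left of `e`. -/
noncomputable def faceOffset : E → ℤ × ℤ := G.exists_faceOffset.choose

lemma faceOffset_facePerm (e : E) : G.faceOffset (G.facePerm e) =
    G.faceOffset e + (G.shift e - G.shift (G.rotB⁻¹ e)) := G.exists_faceOffset.choose_spec e

lemma finite_black (G : DimerModel B W E) : Finite B :=
  have := G.finite_edges
  Finite.of_surjective _ G.black_surjective

lemma finite_white (G : DimerModel B W E) : Finite W :=
  have := G.finite_edges
  Finite.of_surjective _ G.white_surjective

lemma finite_face : Finite G.Face :=
  have := G.finite_edges
  Finite.of_surjective _ G.face_surjective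

/-- As there is at least one face, Euler's formula shows that the nodes are fewer than the edges. -/
lemma card_nodes_lt (G : DimerModel B W E) : Nat.card B + Nat.card W < Nat.card E := by
  have := G.finite_face
  have : Nonempty G.Face := G.nonempty_edges.map G.face
  have h := G.euler_characteristic
  have : 0 < Nat.card G.Face := Nat.card_pos
  change _ + Nat.card G.Face = _ at h
  omega

end DimerModel

/-! ### Laurent polynomials in two variables -/

open AddMonoidAlgebra

/-- The group ring of `ℤ²`, acting on the chains of the cover by deck transformations. -/
abbrev Laurent : Type := AddMonoidAlgebra ℤ (ℤ × ℤ)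

namespace Laurent

/-- The monomial with exponent `x`. -/
noncomputable def mon (x : ℤ × ℤ) : Laurent := single x 1

lemma mon_mul (x y : ℤ × ℤ) : mon x * mon y = mon (x + y) := by
  simp [mon, single_mul_single]

lemma mon_zero : mon 0 = 1 := rfl

lemma mon_ne_one {x : ℤ × ℤ} (hx : x ≠ 0) : mon x ≠ 1 := by
  intro h
  have := congrArg (fun f : Laurent ↦ f.coeff x) h
  simp [mon, ← mon_zero, hx.symm] at this

lemma dvd_mon_sub_mon (i j : ℤ) : mon (1, 0) - 1 ∣ mon (i, j) - mon (0, j) := by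
  have h : ∀ i : ℤ, mon (1, 0) - 1 ∣ mon (i, 0) - 1 := by
    intro i
    induction i with
    | zero => exact ⟨0, by rw [show ((0 : ℤ), (0 : ℤ)) = 0 from rfl, mon_zero]; simp⟩
    | succ n ih =>
      have : mon ((n : ℤ) + 1, 0) - 1 = mon (1, 0) * (mon ((n : ℤ), 0) - 1) + (mon (1, 0) - 1) := by
        rw [mul_sub, mon_mul, mul_one]
        simp [add_comm]
      rw [this]
      exact dvd_add (ih.mul_left _) dvd_rfl
    | pred n ih =>
      have : mon (-(n : ℤ) - 1, 0) - 1 =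
          mon (-1, 0) * ((mon (-(n : ℤ), 0) - 1) - (mon (1, 0) - 1)) := by
        rw [mul_sub, mul_sub, mul_sub, mon_mul, mul_one, mon_mul]
        simp only [Prod.mk_add_mk, add_zero]
        rw [show (-1 + 1 : ℤ) = 0 by norm_num, show ((0 : ℤ), (0 : ℤ)) = 0 from rfl, mon_zero,
          show -1 + -(n : ℤ) = -n - 1 by ring]
        ring
      rw [this]
      exact (dvd_sub ih dvd_rfl).mul_left _
  have : mon (i, j) - mon (0, j) = mon (0, j) * (mon (i, 0) - 1) := by
    rw [mul_sub, mon_mul, mul_one]; simp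
  rw [this]
  exact (h i).mul_left _

/-- The two elements `X - 1` and `Y - 1` of the group ring are coprime in the following sense. -/
lemma dvd_of_dvd_mul {p g : Laurent} (hX : p ∣ (mon (1, 0) - 1) * g)
    (hY : p ∣ (mon (0, 1) - 1) * g) : p ∣ g := by
  obtain ⟨a, ha⟩ := hX
  obtain ⟨b, hb⟩ := hY
  have hX0 : mon (1, 0) - 1 ≠ 0 := sub_ne_zero.2 (mon_ne_one (by simp))
  have hY0 : mon (0, 1) - 1 ≠ 0 := sub_ne_zero.2 (mon_ne_one (by simp))
  by_cases hp : p = 0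
  · subst hp
    rw [zero_mul] at ha
    rw [(mul_eq_zero.1 ha).resolve_left hX0]
  have hab : a * (mon (0, 1) - 1) = (mon (1, 0) - 1) * b := by
    apply mul_left_cancel₀ hp
    linear_combination (-(mon (0, 1) - 1)) * ha + (mon (1, 0) - 1) * hb
  -- `π` sets the first variable to `1`
  let π : Laurent →+* Laurent :=
    mapDomainRingHom ℤ ((AddMonoidHom.inr ℤ ℤ).comp (AddMonoidHom.snd ℤ ℤ))
  have hπ : ∀ i j, π (mon (i, j)) = mon (0, j) := by
    intro i j
    change mapDomain _ (single _ _) = _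
    rw [mapDomain_single]
    rfl
  have hπa : π a = 0 := by
    have h := congrArg π hab
    rw [map_mul, map_mul, map_sub, map_sub, hπ, hπ, map_one] at h
    rw [show mon ((0 : ℤ), (0 : ℤ)) = 1 from rfl, sub_self, zero_mul] at h
    exact (mul_eq_zero.1 h).resolve_right hY0
  have hdvd : ∀ c : Laurent, mon (1, 0) - 1 ∣ c - π c := by
    intro c
    induction c using AddMonoidAlgebra.induction_linear with
    | zero => simp
    | add x y hx hy =>
      rw [map_add, add_sub_add_comm]
      exact dvd_add hx hy
    | single m r =>
      have : (single m r : Laurent) = (r : Laurent) * mon m := by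
        rw [← zsmul_eq_mul, mon, AddMonoidAlgebra.smul_single, smul_eq_mul, mul_one]
      rw [this, map_mul, map_intCast, ← mul_sub, ← Prod.mk.eta (p := m), hπ]
      exact (dvd_mon_sub_mon _ _).mul_left _
  obtain ⟨a', ha'⟩ := hdvd a
  rw [hπa, sub_zero] at ha'
  refine ⟨a', mul_left_cancel₀ hX0 ?_⟩
  rw [ha, ha']
  ring

end Laurent

/-! ### The homology of the cover -/

namespace DimerModel

variable {B W E : Type*} (G : DimerModel B W E)

section Exactness

open Laurent
open scoped Classical

/-- The lift of a black node at the black end of a lifted edge, as a chain. -/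
noncomputable def cellB (p : E × (ℤ × ℤ)) : B ⊕ W ⊕ G.Face → Laurent :=
  Pi.single (Sum.inl (G.black p.1)) (mon (p.2 + G.shift p.1))

/-- The lift of a white node at the white end of a lifted edge, as a chain. -/
noncomputable def cellW (p : E × (ℤ × ℤ)) : B ⊕ W ⊕ G.Face → Laurent :=
  Pi.single (Sum.inr (Sum.inl (G.white p.1))) (mon p.2)

/-- The lift of a face on the left of a lifted edge, as a chain. -/
noncomputable def cellF (p : E × (ℤ × ℤ)) : B ⊕ W ⊕ G.Face → Laurent :=
  Pi.single (Sum.inr (Sum.inr (G.face p.1))) (mon (p.2 - G.faceOffset p.1))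

lemma cellB_rB (p : E × (ℤ × ℤ)) : G.cellB (G.rB p) = G.cellB p := by
  have h : G.black (G.rotB p.1) = G.black p.1 :=
    ((G.rotB_sameCycle_iff _ _).1 (Equiv.Perm.sameCycle_apply_right.2 (.refl _ _))).symm
  simp only [cellB, rB_apply, h, sub_add_cancel]

lemma cellW_rW (p : E × (ℤ × ℤ)) : G.cellW (G.rW p) = G.cellW p := by
  have h : G.white (G.rotW p.1) = G.white p.1 :=
    ((G.rotW_sameCycle_iff _ _).1 (Equiv.Perm.sameCycle_apply_right.2 (.refl _ _))).symm
  simp only [cellW, rW_apply, h]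

lemma cellF_rW_inv_rB_inv (p : E × (ℤ × ℤ)) :
    G.cellF (G.rW⁻¹ (G.rB⁻¹ p)) = G.cellF p := by
  have h1 := G.face_facePerm p.1
  have h2 := G.faceOffset_facePerm p.1
  simp only [BicoloredRibbonGraph.facePerm, Equiv.Perm.mul_apply] at h1 h2
  simp only [cellF, rB_inv_apply, rW_inv_apply, h1, h2]
  congr 2
  abel

lemma mon_smul_cellB (t : ℤ × ℤ) (p : E × (ℤ × ℤ)) :
    mon t • G.cellB p = G.cellB (p.1, p.2 + t) := by
  rw [cellB, ← Pi.single_smul, smul_eq_mul, mon_mul, cellB]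
  congr 2
  simp only
  abel

lemma mon_smul_cellW (t : ℤ × ℤ) (p : E × (ℤ × ℤ)) :
    mon t • G.cellW p = G.cellW (p.1, p.2 + t) := by
  rw [cellW, ← Pi.single_smul, smul_eq_mul, mon_mul, cellW, add_comm]

lemma mon_smul_cellF (t : ℤ × ℤ) (p : E × (ℤ × ℤ)) :
    mon t • G.cellF p = G.cellF (p.1, p.2 + t) := by
  rw [cellF, ← Pi.single_smul, smul_eq_mul, mon_mul, cellF]
  congr 2
  simp only
  abel

/-- The boundary of a corner: a corner `(p, true)` leads from the black end of `p` to the face on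
the left of `p`, and `(p, false)` leads from this face to the white end of `p`. -/
noncomputable def cornerBoundary (s : (E × (ℤ × ℤ)) × Bool) : B ⊕ W ⊕ G.Face → Laurent :=
  if s.2 then G.cellF s.1 - G.cellB s.1 else G.cellW s.1 - G.cellF s.1

lemma mon_smul_cornerBoundary (t : ℤ × ℤ) (p : E × (ℤ × ℤ)) (δ : Bool) :
    mon t • G.cornerBoundary (p, δ) = G.cornerBoundary ((p.1, p.2 + t), δ) := by
  cases δ <;> simp [cornerBoundary, smul_sub, mon_smul_cellB, mon_smul_cellW, mon_smul_cellF]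

/-- A corner of the cover, as a chain. -/
noncomputable def corner (s : (E × (ℤ × ℤ)) × Bool) : E × Bool → Laurent :=
  Pi.single (s.1.1, s.2) (mon s.1.2)

lemma mon_smul_corner (t : ℤ × ℤ) (p : E × (ℤ × ℤ)) (δ : Bool) :
    mon t • corner (p, δ) = corner ((p.1, p.2 + t), δ) := by
  rw [corner, ← Pi.single_smul, smul_eq_mul, mon_mul, corner, add_comm]

/-- The closed path of four corners around the midpoint of a lifted edge. -/
noncomputable def quad (p : E × (ℤ × ℤ)) : E × Bool → Laurent :=
  corner (p, true) + corner (p, false) - corner (G.rB p, true) - corner (G.rW⁻¹ p, false)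

lemma mon_smul_quad (t : ℤ × ℤ) (p : E × (ℤ × ℤ)) :
    mon t • G.quad p = G.quad (p.1, p.2 + t) := by
  simp only [quad, smul_sub, smul_add, mon_smul_corner, rB_apply, rW_inv_apply]
  congr 4
  abel_nf

variable [Fintype E]

/-- The boundary map from the chains of corners to the chains of nodes and faces. -/
noncomputable def boundaryOne :
    (E × Bool → Laurent) →ₗ[Laurent] (B ⊕ W ⊕ G.Face → Laurent) :=
  Fintype.linearCombination Laurent fun i : E × Bool ↦ G.cornerBoundary ((i.1, 0), i.2)

/-- The boundary map from the chains of edges, where an edge stands for the quadrangle around its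
midpoint, to the chains of corners. -/
noncomputable def boundaryTwo : (E → Laurent) →ₗ[Laurent] (E × Bool → Laurent) :=
  Fintype.linearCombination Laurent fun e : E ↦ G.quad (e, 0)

lemma boundaryOne_corner (s : (E × (ℤ × ℤ)) × Bool) :
    G.boundaryOne (corner s) = G.cornerBoundary s := by
  classical
  rw [boundaryOne, corner, Fintype.linearCombination_apply_single, mon_smul_cornerBoundary]
  simp

lemma boundaryOne_quad (p : E × (ℤ × ℤ)) : G.boundaryOne (G.quad p) = 0 := by
  have h : G.cellF (G.rW⁻¹ p) = G.cellF (G.rB p) := by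
    simpa using G.cellF_rW_inv_rB_inv (G.rB p)
  have h' : G.cellW (G.rW⁻¹ p) = G.cellW p := by
    simpa using (G.cellW_rW (G.rW⁻¹ p)).symm
  simp only [quad, map_sub, map_add, boundaryOne_corner, cornerBoundary, if_true,
    Bool.false_eq_true, if_false, h, h', cellB_rB]
  abel

lemma boundaryOne_boundaryTwo (D : E → Laurent) : G.boundaryOne (G.boundaryTwo D) = 0 := by
  rw [boundaryTwo, Fintype.linearCombination_apply, map_sum]
  exact Finset.sum_eq_zero fun e _ ↦ by rw [map_smul, boundaryOne_quad, smul_zero]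

lemma boundaryTwo_apply_true (D : E → Laurent) (e : E) : G.boundaryTwo D (e, true) =
    D e - mon (G.shift (G.rotB⁻¹ e) - G.shift e) * D (G.rotB⁻¹ e) := by
  classical
  have h : ∀ x, (e = G.rotB x) = (G.rotB⁻¹ e = x) := fun x ↦
    propext ⟨fun h ↦ by simp [h], fun h ↦ by simp [← h]⟩
  simp only [boundaryTwo, Fintype.linearCombination_apply, Finset.sum_apply, Pi.smul_apply, quad,
    Pi.sub_apply, Pi.add_apply, corner, Pi.single_apply, Prod.mk.injEq, smul_eq_mul, rB_apply,
    Bool.true_eq_false, and_false, and_true, if_false, h]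
  simp only [mul_sub, Finset.sum_sub_distrib, add_zero, sub_zero, mul_ite, mul_zero,
    Finset.sum_ite_eq, Finset.mem_univ, if_true]
  rw [show mon ((0 : ℤ × ℤ)) = 1 from rfl, mul_one, mul_comm]
  simp

lemma boundaryTwo_apply_false (D : E → Laurent) (e : E) : G.boundaryTwo D (e, false) =
    D e - D (G.rotW e) := by
  classical
  have h : ∀ x, (e = G.rotW⁻¹ x) = (G.rotW e = x) := fun x ↦
    propext ⟨fun h ↦ by simp [h], fun h ↦ by simp [← h]⟩
  simp only [boundaryTwo, Fintype.linearCombination_apply, Finset.sum_apply, Pi.smul_apply, quad,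
    Pi.sub_apply, Pi.add_apply, corner, Pi.single_apply, Prod.mk.injEq, smul_eq_mul, rW_inv_apply,
    Bool.false_eq_true, and_false, and_true, if_false, h]
  simp only [mul_sub, Finset.sum_sub_distrib, zero_add, sub_zero, mul_ite, mul_zero,
    Finset.sum_ite_eq, Finset.mem_univ, if_true]
  rw [show mon ((0 : ℤ × ℤ)) = 1 from rfl, mul_one, mul_one]

/-- A chain of edges whose boundary is divisible by `c` is divisible by `c`: modulo `c` it is
constant on the cover, so it is annihilated by `X - 1` and `Y - 1` modulo `c`. For `c = 0` this is
the injectivity of `boundaryTwo`: the plane has no compact connected component. -/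
lemma dvd_of_dvd_boundaryTwo {c : Laurent} {D : E → Laurent} (h : ∀ i, c ∣ G.boundaryTwo D i)
    (e : E) : c ∣ D e := by
  let f : E × (ℤ × ℤ) → Laurent ⧸ Ideal.span {c} :=
    fun p ↦ Ideal.Quotient.mk _ (mon (-p.2) * D p.1)
  have hB' : ∀ p, f (G.rB⁻¹ p) = f p := by
    intro p
    refine (Ideal.Quotient.eq.2 (Ideal.mem_span_singleton.2 ?_)).symm
    have := (h (p.1, true)).mul_left (mon (-p.2))
    rw [boundaryTwo_apply_true, mul_sub, ← mul_assoc, mon_mul] at this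
    convert this using 4
    · simp only [rB_inv_apply]
      abel
    · rfl
  have hB : ∀ p, f (G.rB p) = f p := fun p ↦ by
    rw [← hB' (G.rB p)]; simp
  have hW : ∀ p, f (G.rW p) = f p := by
    intro p
    refine (Ideal.Quotient.eq.2 (Ideal.mem_span_singleton.2 ?_)).symm
    have := (h (p.1, false)).mul_left (mon (-p.2))
    rwa [boundaryTwo_apply_false, mul_sub] at this
  have key : ∀ t, c ∣ (mon t - 1) * D e := by
    intro t
    have := Ideal.mem_span_singleton.1
      (Ideal.Quotient.eq.1 (G.eq_of_invariant hB hW (e, -t) (e, 0)))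
    simp only [neg_neg, neg_zero] at this
    rwa [mon_zero, one_mul, ← sub_one_mul] at this
  exact dvd_of_dvd_mul (key _) (key _)

/-- Any two cells of the cover are joined by a chain of corners. -/
lemma cellF_sub_cellF_mem_range (p q : E × (ℤ × ℤ)) :
    G.cellF p - G.cellF q ∈ LinearMap.range G.boundaryOne := by
  have h1 : ∀ p, Submodule.Quotient.mk (p := LinearMap.range G.boundaryOne) (G.cellF p) =
      Submodule.Quotient.mk (G.cellB p) := fun p ↦
    (Submodule.Quotient.eq _).2 ⟨corner (p, true), by simp [boundaryOne_corner, cornerBoundary]⟩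
  have h2 : ∀ p, Submodule.Quotient.mk (p := LinearMap.range G.boundaryOne) (G.cellW p) =
      Submodule.Quotient.mk (G.cellF p) := fun p ↦
    (Submodule.Quotient.eq _).2 ⟨corner (p, false), by simp [boundaryOne_corner, cornerBoundary]⟩
  refine (Submodule.Quotient.eq _).1 (G.eq_of_invariant
    (f := fun p ↦ Submodule.Quotient.mk (p := LinearMap.range G.boundaryOne) (G.cellF p))
    (fun p ↦ ?_) (fun p ↦ ?_) p q)
  · simp only [h1, cellB_rB]
  · simp only [← h2, cellW_rW]

lemma mon_sub_one_smul_single_mem_range (r : B ⊕ W ⊕ G.Face) :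
    ∃ c, G.boundaryOne c = (mon (1, 0) - 1) • Pi.single r 1 := by
  change _ ∈ LinearMap.range G.boundaryOne
  have key : ∀ (e : E), G.cellF (e, (1, 0)) - G.cellF (e, 0) ∈ LinearMap.range G.boundaryOne :=
    fun e ↦ G.cellF_sub_cellF_mem_range _ _
  have hB : ∀ p, G.cellF p - G.cellB p ∈ LinearMap.range G.boundaryOne :=
    fun p ↦ ⟨corner (p, true), by simp [boundaryOne_corner, cornerBoundary]⟩
  have hW : ∀ p, G.cellW p - G.cellF p ∈ LinearMap.range G.boundaryOne :=
    fun p ↦ ⟨corner (p, false), by simp [boundaryOne_corner, cornerBoundary]⟩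
  have fin : ∀ (x : ℤ × ℤ) (v : B ⊕ W ⊕ G.Face → Laurent), v = Pi.single r (mon x) →
      (mon (1, 0) - 1) • v ∈ LinearMap.range G.boundaryOne →
      (mon (1, 0) - 1) • Pi.single r (1 : Laurent) ∈ LinearMap.range G.boundaryOne := by
    rintro x _ rfl h
    have := Submodule.smul_mem _ (mon (-x)) h
    rw [smul_comm, ← Pi.single_smul, smul_eq_mul, mon_mul, neg_add_cancel] at this
    exact this
  rcases r with b | w | f
  · obtain ⟨e, rfl⟩ := G.black_surjective b
    refine fin _ (G.cellB (e, 0)) rfl ?_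
    rw [sub_smul, one_smul, mon_smul_cellB, zero_add]
    have := Submodule.sub_mem _ (Submodule.add_mem _ (key e) (hB (e, 0))) (hB (e, (1, 0)))
    convert this using 1
    abel
  · obtain ⟨e, rfl⟩ := G.white_surjective w
    refine fin _ (G.cellW (e, 0)) rfl ?_
    rw [sub_smul, one_smul, mon_smul_cellW, zero_add]
    have := Submodule.add_mem _ (Submodule.sub_mem _ (key e) (hW (e, 0))) (hW (e, (1, 0)))
    convert this using 1
    abel
  · obtain ⟨e, rfl⟩ := G.face_surjective f
    refine fin _ (G.cellF (e, 0)) rfl ?_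
    rw [sub_smul, one_smul, mon_smul_cellF, zero_add]
    exact key e

/-- The vanishing of the first homology of the cover: a closed chain of corners is a boundary. By
Euler's formula, the number of quadrangles, nodes and faces is the number of corners on the torus.
Hence over the group ring, a closed chain becomes a boundary after a multiplication by some nonzero
element, and one can divide by this element. -/
theorem mem_range_boundaryTwo {γ : E × Bool → Laurent} (hγ : G.boundaryOne γ = 0) :
    ∃ D, G.boundaryTwo D = γ := by
  classical
  have := G.finite_black
  have := G.finite_white
  have := G.finite_face
  have := Fintype.ofFinite B
  have := Fintype.ofFinite W
  have := Fintype.ofFinite G.Face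
  choose q hq using G.mon_sub_one_smul_single_mem_range
  let Φ : ((E ⊕ (B ⊕ W ⊕ G.Face)) ⊕ Unit → Laurent) →ₗ[Laurent] (E × Bool → Laurent) :=
    Fintype.linearCombination Laurent
      (Sum.elim (Sum.elim (fun e ↦ G.quad (e, 0)) q) (fun _ ↦ -γ))
  have hΦ : ∀ f, Φ f = G.boundaryTwo (fun e ↦ f (Sum.inl (Sum.inl e))) +
      ∑ r, f (Sum.inl (Sum.inr r)) • q r - f (Sum.inr ()) • γ := by
    intro f
    simp only [Φ, boundaryTwo, Fintype.linearCombination_apply, Fintype.sum_sum_type,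
      Sum.elim_inl, Sum.elim_inr, Finset.univ_unique, Finset.sum_singleton, smul_neg]
    exact (sub_eq_add_neg _ _).symm
  -- by Euler's formula, the source of `Φ` has one more generator than its target
  have hninj : ¬ Function.Injective Φ := by
    intro hinj
    have hcard := card_le_of_injective Laurent Φ hinj
    have heuler := G.euler_characteristic
    change _ + Nat.card G.Face = _ at heuler
    simp only [Nat.card_eq_fintype_card] at heuler
    simp only [Fintype.card_sum, Fintype.card_prod, Fintype.card_unit, Fintype.card_bool] at hcard
    omega
  rw [← LinearMap.ker_eq_bot, Submodule.eq_bot_iff] at hninj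
  push Not at hninj
  obtain ⟨f, hf, hf0⟩ := hninj
  rw [LinearMap.mem_ker, hΦ] at hf
  have hX0 : mon (1, 0) - 1 ≠ 0 := sub_ne_zero.2 (mon_ne_one (by simp))
  -- the boundaries of the chains `q r` are independent, so they do not occur in the relation
  have hfr : ∀ r, f (Sum.inl (Sum.inr r)) = 0 := by
    intro r
    have h := congrArg G.boundaryOne hf
    rw [map_sub, map_add, boundaryOne_boundaryTwo, map_smul, hγ, smul_zero, sub_zero, zero_add,
      map_sum, map_zero] at h
    have h' := congrFun h r
    simp only [map_smul, hq, Finset.sum_apply, Pi.smul_apply, Pi.single_apply, smul_eq_mul,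
      mul_ite, mul_one, mul_zero, Finset.sum_ite_eq, Finset.mem_univ, if_true, Pi.zero_apply] at h'
    exact (mul_eq_zero.1 h').resolve_right hX0
  simp only [hfr, zero_smul, Finset.sum_const_zero, add_zero, sub_eq_zero] at hf
  have hdvd : ∀ e, f (Sum.inr ()) ∣ f (Sum.inl (Sum.inl e)) :=
    G.dvd_of_dvd_boundaryTwo (D := fun e ↦ f (Sum.inl (Sum.inl e))) fun i ↦ ⟨γ i, congrFun hf i⟩
  choose D hD using hdvd
  have hc0 : f (Sum.inr ()) ≠ 0 := by
    intro h0
    apply hf0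
    funext i
    rcases i with (e | r) | u
    · simp [hD e, h0]
    · exact hfr r
    · exact h0
  refine ⟨D, ?_⟩
  have : (fun e ↦ f (Sum.inl (Sum.inl e))) = f (Sum.inr ()) • D := funext hD
  rw [this, map_smul] at hf
  exact smul_right_injective _ hc0 hf

end Exactness

end DimerModel

/-! ### Cochains and potentials -/

namespace DimerModel

variable {B W E : Type*} (G : DimerModel B W E)

/-- A lifted edge with one of its two directions, where `true` means from white to black. The states
are the steps of the zig-zag paths, and they also label the corners between the nodes and the faces
of the cover: `(p, true)` is the corner that leads from the black end of `p` to the face on the left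
of `p`, and `(p, false)` is the corner that leads from this face to the white end of `p`. After its
step `s`, a zig-zag path crosses the corner `s`. -/
abbrev State (E : Type*) : Type _ := (E × (ℤ × ℤ)) × Bool

/-- An integral cochain on the corners of the cover is closed if its sum around each quadrangle,
i.e. around the midpoint of each lifted edge, vanishes. -/
def IsCocycle (Q : State E → ℤ) : Prop :=
  ∀ p, Q (p, true) + Q (p, false) = Q (G.rB p, true) + Q (G.rW⁻¹ p, false)

/-- `σ` is a potential of the cochain `Q` on the faces of the cover, where `σ p` is the value on the
face on the left of `p`. The two conditions say that `σ p - Q (p, true)` depends only on the black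
end of `p`, and that `σ p + Q (p, false)` depends only on the white end of `p`. -/
structure IsPotential (Q : State E → ℤ) (σ : E × (ℤ × ℤ) → ℤ) : Prop where
  black : ∀ p, σ (G.rB p) - Q (G.rB p, true) = σ p - Q (p, true)
  white : ∀ p, σ (G.rW p) + Q (G.rW p, false) = σ p + Q (p, false)

/-- The value of a cochain on a monomial chain, extended linearly. -/
noncomputable def evalLaurent (f : ℤ × ℤ → ℤ) : Laurent →+ ℤ :=
  (Finsupp.liftAddHom fun y ↦ AddMonoidHom.mulRight (f y)).comp
    (coeffAddEquiv (R := ℤ) (M := ℤ × ℤ)).toAddMonoidHom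

lemma evalLaurent_mon (f : ℤ × ℤ → ℤ) (x : ℤ × ℤ) : evalLaurent f (Laurent.mon x) = f x := by
  simp [evalLaurent, Laurent.mon]

section

variable [Fintype E]

/-- The value of a cochain on a chain of corners. -/
noncomputable def evalChain (Q : State E → ℤ) : (E × Bool → Laurent) →+ ℤ :=
  ∑ i : E × Bool, (evalLaurent fun x ↦ Q ((i.1, x), i.2)).comp (Pi.evalAddMonoidHom _ i)

lemma evalChain_corner (Q : State E → ℤ) (s : State E) :
    evalChain Q (corner s) = Q s := by
  classical
  simp only [evalChain, AddMonoidHom.finsetSum_apply, AddMonoidHom.comp_apply,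
    Pi.evalAddMonoidHom_apply, corner]
  rw [Finset.sum_eq_single (s.1.1, s.2)]
  · simp [evalLaurent_mon]
  · intro i _ hi
    rw [Pi.single_eq_of_ne hi, map_zero]
  · simp

variable {G} in
lemma evalChain_boundaryTwo {Q : State E → ℤ} (hQ : G.IsCocycle Q)
    (D : E → Laurent) : evalChain Q (G.boundaryTwo D) = 0 := by
  have key : ∀ (e : E) (c : Laurent), evalChain Q (c • G.quad (e, 0)) = 0 := by
    intro e c
    induction c using AddMonoidAlgebra.induction_linear with
    | zero => simp
    | add x y hx hy => rw [add_smul, map_add, hx, hy, add_zero]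
    | single m r =>
      have : (AddMonoidAlgebra.single m r : Laurent) = r • Laurent.mon m := by
        rw [Laurent.mon, AddMonoidAlgebra.smul_single, smul_eq_mul, mul_one]
      rw [this, smul_assoc, mon_smul_quad, map_zsmul]
      simp only [quad, map_sub, map_add, evalChain_corner]
      rw [hQ]
      simp
  rw [boundaryTwo, Fintype.linearCombination_apply, map_sum]
  exact Finset.sum_eq_zero fun e _ ↦ key e _

end

variable {G}

/-- On the cover, closed cochains are exact. -/
theorem IsCocycle.exists_isPotential {Q : State E → ℤ} (hQ : G.IsCocycle Q) :
    ∃ σ, G.IsPotential Q σ := by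
  have := G.finite_edges
  have := Fintype.ofFinite E
  obtain ⟨e₀⟩ := G.nonempty_edges
  choose γ hγ using fun p ↦ G.cellF_sub_cellF_mem_range p (e₀, 0)
  have key : ∀ c, G.boundaryOne c = 0 → evalChain Q c = 0 := by
    intro c hc
    obtain ⟨D, rfl⟩ := G.mem_range_boundaryTwo hc
    exact evalChain_boundaryTwo hQ D
  refine ⟨fun p ↦ evalChain Q (γ p), fun p ↦ ?_, fun p ↦ ?_⟩
  · have := key (γ (G.rB p) - corner (G.rB p, true) - γ p + corner (p, true)) (by
      simp only [map_sub, map_add, hγ, boundaryOne_corner, cornerBoundary, if_true, cellB_rB]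
      abel)
    simp only [map_sub, map_add, evalChain_corner] at this
    linarith
  · have := key (γ (G.rW p) + corner (G.rW p, false) - γ p - corner (p, false)) (by
      simp only [map_sub, map_add, hγ, boundaryOne_corner, cornerBoundary, Bool.false_eq_true,
        if_false, cellW_rW]
      abel)
    simp only [map_sub, map_add, evalChain_corner] at this
    linarith

namespace IsPotential

variable {Q : State E → ℤ} {σ σ' : E × (ℤ × ℤ) → ℤ}

lemma sub_eq_sub (h : G.IsPotential Q σ) (h' : G.IsPotential Q σ') (p q : E × (ℤ × ℤ)) :
    σ p - σ' p = σ q - σ' q :=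
  G.eq_of_invariant (f := fun p ↦ σ p - σ' p)
    (fun p ↦ by have := h.black p; have := h'.black p; linarith)
    (fun p ↦ by have := h.white p; have := h'.white p; linarith) p q

lemma sum {ι : Type*} (t : Finset ι) {Q : ι → State E → ℤ}
    {σ : ι → E × (ℤ × ℤ) → ℤ} (h : ∀ i, G.IsPotential (Q i) (σ i)) :
    G.IsPotential (fun s ↦ ∑ i ∈ t, Q i s) (fun p ↦ ∑ i ∈ t, σ i p) :=
  ⟨fun p ↦ by simp only [← Finset.sum_sub_distrib, fun i ↦ (h i).black],
    fun p ↦ by simp only [← Finset.sum_add_distrib, fun i ↦ (h i).white]⟩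

/-- `σ` takes only one value on each face. -/
lemma apply_rW_inv_rB_inv (hQ : G.IsCocycle Q) (h : G.IsPotential Q σ) (p : E × (ℤ × ℤ)) :
    σ (G.rW⁻¹ (G.rB⁻¹ p)) = σ p := by
  have h1 := h.black (G.rB⁻¹ p)
  have h2 := h.white (G.rW⁻¹ (G.rB⁻¹ p))
  have h3 := hQ (G.rB⁻¹ p)
  simp only [rB_rB_inv, rW_rW_inv] at h1 h2 h3
  linarith

end IsPotential

end DimerModel

/-! ### Zig-zag paths as orbits -/

namespace DimerModel

variable {B W E : Type*} (G : DimerModel B W E)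

/-- The passage from a step of a zig-zag path to the next one. -/
def step : Equiv.Perm (State E) where
  toFun s := match s.2 with
    | true => (G.rB⁻¹ s.1, false)
    | false => (G.rW s.1, true)
  invFun s := match s.2 with
    | true => (G.rW⁻¹ s.1, false)
    | false => (G.rB s.1, true)
  left_inv := by rintro ⟨p, _ | _⟩ <;> simp
  right_inv := by rintro ⟨p, _ | _⟩ <;> simp

@[simp] lemma step_true (p : E × (ℤ × ℤ)) : G.step (p, true) = (G.rB⁻¹ p, false) := rfl
@[simp] lemma step_false (p : E × (ℤ × ℤ)) : G.step (p, false) = (G.rW p, true) := rfl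
@[simp] lemma step_inv_true (p : E × (ℤ × ℤ)) : G.step⁻¹ (p, true) = (G.rW⁻¹ p, false) := rfl
@[simp] lemma step_inv_false (p : E × (ℤ × ℤ)) : G.step⁻¹ (p, false) = (G.rB p, true) := rfl
@[simp] lemma step_step_inv (s : State E) : G.step (G.step⁻¹ s) = s := Equiv.apply_symm_apply _ _
@[simp] lemma step_inv_step (s : State E) : G.step⁻¹ (G.step s) = s := Equiv.symm_apply_apply _ _

lemma step_snd (s : State E) : (G.step s).2 = !s.2 := by
  obtain ⟨p, _ | _⟩ := s <;> rfl

lemma zpow_step_succ (t : ℤ) (s : State E) : (G.step ^ (t + 1)) s = G.step ((G.step ^ t) s) := by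
  rw [add_comm, zpow_add, zpow_one, Equiv.Perm.mul_apply]

lemma zpow_step_step (t : ℤ) (s : State E) : (G.step ^ t) (G.step s) = (G.step ^ (t + 1)) s := by
  rw [zpow_add, zpow_one, Equiv.Perm.mul_apply]

lemma zpow_step_add (t t' : ℤ) (s : State E) :
    (G.step ^ (t + t')) s = (G.step ^ t) ((G.step ^ t') s) := by
  rw [zpow_add, Equiv.Perm.mul_apply]

lemma zpow_step_pred (t : ℤ) (s : State E) :
    (G.step ^ (t - 1)) s = G.step⁻¹ ((G.step ^ t) s) := by
  rw [sub_eq_neg_add, zpow_add, zpow_neg_one, Equiv.Perm.mul_apply]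

/-- The translates of a state under the deck transformations. -/
def tr (x : ℤ × ℤ) (s : State E) : State E := ((s.1.1, s.1.2 + x), s.2)

@[simp] lemma tr_fst_fst (x : ℤ × ℤ) (s : State E) : (tr x s).1.1 = s.1.1 := rfl
@[simp] lemma tr_fst_snd (x : ℤ × ℤ) (s : State E) : (tr x s).1.2 = s.1.2 + x := rfl
@[simp] lemma tr_snd (x : ℤ × ℤ) (s : State E) : (tr x s).2 = s.2 := rfl

lemma tr_tr (x y : ℤ × ℤ) (s : State E) : tr x (tr y s) = tr (x + y) s := by
  simp [tr, add_assoc, add_comm x y]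

lemma tr_zero (s : State E) : tr 0 s = s := by simp [tr]

lemma tr_injective (x : ℤ × ℤ) : Function.Injective (tr x : State E → State E) := by
  intro s s' h
  have := congrArg (tr (-x)) h
  simpa [tr_tr, tr_zero] using this

lemma tr_left_injective (s : State E) {x y : ℤ × ℤ} (h : tr x s = tr y s) : x = y := by
  simpa [tr] using h

lemma rB_add (p : E × (ℤ × ℤ)) (x : ℤ × ℤ) :
    G.rB (p.1, p.2 + x) = ((G.rB p).1, (G.rB p).2 + x) := by
  simp only [rB_apply, Prod.mk.injEq, true_and]; abel

lemma rB_inv_add (p : E × (ℤ × ℤ)) (x : ℤ × ℤ) :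
    G.rB⁻¹ (p.1, p.2 + x) = ((G.rB⁻¹ p).1, (G.rB⁻¹ p).2 + x) := by
  simp only [rB_inv_apply, Prod.mk.injEq, true_and]; abel

lemma rW_add (p : E × (ℤ × ℤ)) (x : ℤ × ℤ) :
    G.rW (p.1, p.2 + x) = ((G.rW p).1, (G.rW p).2 + x) := rfl

lemma step_tr (x : ℤ × ℤ) (s : State E) : G.step (tr x s) = tr x (G.step s) := by
  obtain ⟨p, _ | _⟩ := s
  · rfl
  · simp only [tr, step_true, rB_inv_add]

lemma zpow_step_tr (t : ℤ) (x : ℤ × ℤ) (s : State E) :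
    (G.step ^ t) (tr x s) = tr x ((G.step ^ t) s) := by
  induction t with
  | zero => simp
  | succ n ih => rw [zpow_step_succ, ih, step_tr, zpow_step_succ]
  | pred n ih =>
    apply G.step.injective
    rw [step_tr, ← zpow_step_succ, ← zpow_step_succ, sub_add_cancel, ih]

/-- The zig-zag path on the cover that starts with a given step. -/
def pathOf (s : State E) : G.ZigzagPath where
  edge i := ((G.step ^ i) s).1
  toBlack i := ((G.step ^ i) s).2
  toBlack_succ i := by rw [zpow_step_succ, step_snd]
  turn_black i h := by
    rw [zpow_step_succ]
    generalize (G.step ^ i) s = s' at h ⊢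
    obtain ⟨p, δ⟩ := s'
    subst h
    rfl
  turn_white i h := by
    rw [zpow_step_succ]
    generalize (G.step ^ i) s = s' at h ⊢
    obtain ⟨p, δ⟩ := s'
    subst h
    rfl

/-- The zig-zag paths on the torus. -/
def torusStep : Equiv.Perm (E × Bool) where
  toFun s := match s.2 with
    | true => (G.rotB⁻¹ s.1, false)
    | false => (G.rotW s.1, true)
  invFun s := match s.2 with
    | true => (G.rotW⁻¹ s.1, false)
    | false => (G.rotB s.1, true)
  left_inv := by rintro ⟨p, _ | _⟩ <;> simp
  right_inv := by rintro ⟨p, _ | _⟩ <;> simp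

lemma zpow_step_proj (t : ℤ) (s : State E) :
    (((G.step ^ t) s).1.1, ((G.step ^ t) s).2) = (G.torusStep ^ t) (s.1.1, s.2) := by
  have key : ∀ s : State E, ((G.step s).1.1, (G.step s).2) = G.torusStep (s.1.1, s.2) := by
    rintro ⟨p, _ | _⟩ <;> rfl
  induction t with
  | zero => simp
  | succ n ih =>
    rw [zpow_step_succ, key, ih, add_comm, zpow_add, zpow_one, Equiv.Perm.mul_apply]
  | pred n ih =>
    apply G.torusStep.injective
    rw [← key, ← zpow_step_succ, sub_add_cancel, ih, ← Equiv.Perm.mul_apply, ← zpow_one_add,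
      add_sub_cancel]

/-- A common period of all zig-zag paths on the torus. -/
noncomputable def period : ℕ := orderOf G.torusStep

lemma period_pos : 0 < G.period := by
  have := G.finite_edges
  exact orderOf_pos _

/-- The deck transformation by which a zig-zag path is translated after `period` steps. -/
noncomputable def dir (s : State E) : ℤ × ℤ := ((G.step ^ (G.period : ℤ)) s).1.2 - s.1.2

lemma zpow_step_period (s : State E) : (G.step ^ (G.period : ℤ)) s = tr (G.dir s) s := by
  have h := G.zpow_step_proj G.period s
  rw [period, zpow_natCast, zpow_natCast, pow_orderOf_eq_one] at h
  simp only [Equiv.Perm.coe_one, id_eq, Prod.mk.injEq] at h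
  refine Prod.ext (Prod.ext ?_ ?_) ?_
  · simpa [period] using h.1
  · simp [dir]
  · simpa [period] using h.2

lemma dir_tr (x : ℤ × ℤ) (s : State E) : G.dir (tr x s) = G.dir s := by
  rw [dir, zpow_step_tr]
  simp [dir]

lemma dir_step (s : State E) : G.dir (G.step s) = G.dir s := by
  apply tr_left_injective (G.step s)
  rw [← zpow_step_period, ← step_tr, ← zpow_step_period, ← zpow_step_succ, zpow_step_add, zpow_one]

lemma dir_eq (s : State E) : G.dir s = G.dir ((s.1.1, 0), s.2) := by
  rw [← G.dir_tr s.1.2 ((s.1.1, 0), s.2)]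
  simp [tr]

lemma finite_range_dir : (Set.range G.dir).Finite := by
  have := G.finite_edges
  refine (Set.finite_range fun i : E × Bool ↦ G.dir ((i.1, 0), i.2)).subset ?_
  rintro _ ⟨s, rfl⟩
  exact ⟨(s.1.1, s.2), (G.dir_eq s).symm⟩

lemma zpow_step_period_mul (k : ℤ) (s : State E) :
    (G.step ^ (G.period * k : ℤ)) s = tr (k • G.dir s) s := by
  induction k with
  | zero => simp [tr_zero]
  | succ n ih =>
    rw [mul_add, mul_one, add_comm, zpow_step_add, ih, zpow_step_period, dir_tr, tr_tr, add_smul,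
      one_smul, add_comm]
  | pred n ih =>
    apply (G.step ^ (G.period : ℤ)).injective
    rw [← zpow_step_add, mul_sub, mul_one, add_sub_cancel, ih, zpow_step_tr, zpow_step_period,
      tr_tr, sub_smul, one_smul, sub_add_cancel]

variable {G} in
/-- As no zig-zag path is homologically trivial, no zig-zag path is closed on the cover. -/
lemma Consistent.zpow_step_ne (hG : G.Consistent) {t : ℤ} (ht : t ≠ 0) (s : State E) :
    (G.step ^ t) s ≠ s := by
  intro h
  refine hG.not_homologicallyTrivial (G.pathOf s) ⟨t, ht, fun i ↦ ?_⟩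
  change ((G.step ^ (i + t)) s).1 = _
  rw [zpow_step_add, h]
  rfl

variable {G} in
lemma Consistent.zpow_step_inj (hG : G.Consistent) {t t' : ℤ} {s : State E}
    (h : (G.step ^ t) s = (G.step ^ t') s) : t = t' := by
  by_contra hne
  refine hG.zpow_step_ne (t := t - t') (sub_ne_zero.2 hne) ((G.step ^ t') s) ?_
  rw [← zpow_step_add, sub_add_cancel, h]

variable {G} in
lemma Consistent.dir_ne_zero (hG : G.Consistent) (s : State E) : G.dir s ≠ 0 := by
  intro h
  apply hG.zpow_step_ne (t := G.period) (by exact_mod_cast G.period_pos.ne') s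
  rw [zpow_step_period, h, tr_zero]

/-! ### Rays and lines -/

open scoped Classical in
/-- The indicator function of the forward half of the zig-zag path through `s₀`. -/
noncomputable def ray (s₀ s : State E) : ℤ := if ∃ t : ℕ, (G.step ^ (t : ℤ)) s₀ = s then 1 else 0

open scoped Classical in
/-- The indicator function of the zig-zag path through `s₀`. -/
noncomputable def line (s₀ s : State E) : ℤ := if ∃ t : ℤ, (G.step ^ t) s₀ = s then 1 else 0

lemma line_step (s₀ s : State E) : G.line s₀ (G.step s) = G.line s₀ s := by
  have : (∃ t : ℤ, (G.step ^ t) s₀ = G.step s) ↔ ∃ t : ℤ, (G.step ^ t) s₀ = s := by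
    constructor
    · rintro ⟨t, ht⟩
      exact ⟨t - 1, by rw [zpow_step_pred, ht, step_inv_step]⟩
    · rintro ⟨t, ht⟩
      exact ⟨t + 1, by rw [zpow_step_succ, ht]⟩
  classical exact if_congr this rfl rfl

lemma step_line (s₀ s : State E) : G.line (G.step s₀) s = G.line s₀ s := by
  have : (∃ t : ℤ, (G.step ^ t) (G.step s₀) = s) ↔ ∃ t : ℤ, (G.step ^ t) s₀ = s := by
    constructor
    · rintro ⟨t, ht⟩
      exact ⟨t + 1, by rw [← ht, zpow_step_step]⟩
    · rintro ⟨t, ht⟩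
      exact ⟨t - 1, by rw [← ht, zpow_step_step, sub_add_cancel]⟩
  classical exact if_congr this rfl rfl

lemma isCocycle_line (s₀ : State E) : G.IsCocycle (G.line s₀) := by
  intro p
  have h1 := G.line_step s₀ (G.rB p, true)
  have h2 := G.line_step s₀ (G.rW⁻¹ p, false)
  simp only [step_true, step_false, rB_inv_rB, rW_rW_inv] at h1 h2
  linarith

lemma line_tr_dir (s₀ s : State E) (k : ℤ) : G.line s₀ (tr (k • G.dir s₀) s) = G.line s₀ s := by
  have h : ∀ t : ℤ, (G.step ^ (t + G.period * k)) s₀ = tr (k • G.dir s₀) ((G.step ^ t) s₀) := by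
    intro t
    rw [zpow_step_add, zpow_step_period_mul, zpow_step_tr]
  have : (∃ t : ℤ, (G.step ^ t) s₀ = tr (k • G.dir s₀) s) ↔ ∃ t : ℤ, (G.step ^ t) s₀ = s := by
    constructor
    · rintro ⟨t, ht⟩
      refine ⟨t - G.period * k, tr_injective (k • G.dir s₀) ?_⟩
      rw [← h, sub_add_cancel, ht]
    · rintro ⟨t, ht⟩
      exact ⟨t + G.period * k, by rw [h, ht]⟩
  classical exact if_congr this rfl rfl

lemma ray_tr (x : ℤ × ℤ) (s₀ s : State E) : G.ray (tr x s₀) (tr x s) = G.ray s₀ s := by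
  classical
  exact if_congr (by simp only [zpow_step_tr, (tr_injective x).eq_iff]) rfl rfl

lemma ray_eq_zero_of_line {s₀ s : State E} (h : ∀ t : ℤ, (G.step ^ t) s₀ ≠ s) :
    G.ray s₀ s = 0 := by
  rw [ray, if_neg]
  rintro ⟨t, ht⟩
  exact h t ht

variable {G} in
open scoped Classical in
lemma Consistent.ray_step (hG : G.Consistent) (s₀ s : State E) :
    G.ray s₀ (G.step s) = G.ray s₀ s + if G.step s = s₀ then 1 else 0 := by
  by_cases h : G.step s = s₀
  · have h1 : ∃ t : ℕ, (G.step ^ (t : ℤ)) s₀ = G.step s := ⟨0, by simp [h]⟩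
    have h2 : ¬ ∃ t : ℕ, (G.step ^ (t : ℤ)) s₀ = s := by
      rintro ⟨t, ht⟩
      refine hG.zpow_step_ne (t := t + 1) (by omega) s₀ ?_
      rw [zpow_step_succ, ht, h]
    simp only [ray, if_pos h1, if_neg h2, if_pos h, zero_add]
  · have : (∃ t : ℕ, (G.step ^ (t : ℤ)) s₀ = G.step s) ↔ ∃ t : ℕ, (G.step ^ (t : ℤ)) s₀ = s := by
      constructor
      · rintro ⟨_ | t, ht⟩
        · exact absurd ht.symm (by simpa using h)
        · refine ⟨t, G.step.injective ?_⟩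
          rw [← ht, ← zpow_step_succ]
          simp
      · rintro ⟨t, ht⟩
        exact ⟨t + 1, by rw [Nat.cast_add, Nat.cast_one, zpow_step_succ, ht]⟩
    rw [if_neg h, add_zero]
    classical exact if_congr this rfl rfl

variable {G} in
open scoped Classical in
lemma Consistent.step_ray (hG : G.Consistent) (s₀ s : State E) :
    G.ray (G.step s₀) s = G.ray s₀ s - if s = s₀ then 1 else 0 := by
  have h1 : G.ray (G.step s₀) (G.step s) = G.ray s₀ s := by
    exact if_congr (by simp only [zpow_step_step, zpow_step_succ, G.step.injective.eq_iff]) rfl rfl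
  have h2 := hG.ray_step (G.step s₀) s
  rw [h1] at h2
  simp only [G.step.injective.eq_iff] at h2
  linarith

end DimerModel

/-! ### Sectors -/

namespace DimerModel

variable {B W E : Type*} (G : DimerModel B W E)

/-- The sum of the forward half of the zig-zag path that walks along `e` from white to black and of
the reversed forward half of the one that walks along `e` from black to white. -/
noncomputable def sectorCochain (e : E × (ℤ × ℤ)) (s : State E) : ℤ :=
  G.ray (e, true) s - G.ray (e, false) s

variable {G} in
lemma Consistent.isCocycle_sectorCochain (hG : G.Consistent) (e : E × (ℤ × ℤ)) :
    G.IsCocycle (G.sectorCochain e) := by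
  classical
  intro p
  have h1 := fun s₀ ↦ hG.ray_step s₀ (G.rB p, true)
  have h2 := fun s₀ ↦ hG.ray_step s₀ (G.rW⁻¹ p, false)
  simp only [step_true, step_false, rB_inv_rB, rW_rW_inv] at h1 h2
  simp only [sectorCochain, h1, h2, Prod.mk.injEq, and_true, Bool.false_eq_true, and_false,
    Bool.true_eq_false, if_false, add_zero]
  ring

open scoped Classical in
/-- A potential of `sectorCochain`. Up to normalization, it is the indicator function of the region
between the two zig-zag rays which start at `e`, provided that these do not cross again. -/
noncomputable def sectorPotential (e : E × (ℤ × ℤ)) : E × (ℤ × ℤ) → ℤ :=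
  if h : ∃ σ, G.IsPotential (G.sectorCochain e) σ then h.choose else 0

variable {G} in
lemma Consistent.isPotential_sectorPotential (hG : G.Consistent) (e : E × (ℤ × ℤ)) :
    G.IsPotential (G.sectorCochain e) (G.sectorPotential e) := by
  have h := (hG.isCocycle_sectorCochain e).exists_isPotential
  rw [sectorPotential, dif_pos h]
  exact h.choose_spec

/-- The potential of a sector, normalized to vanish on the black end of `e`. -/
noncomputable def sectorB (e x : E × (ℤ × ℤ)) : ℤ :=
  G.sectorPotential e x - (G.sectorPotential e e - G.sectorCochain e (e, true))

/-- The potential of a sector, normalized to vanish on the white end of `e`. -/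
noncomputable def sectorW (e x : E × (ℤ × ℤ)) : ℤ :=
  G.sectorPotential e x - (G.sectorPotential e e + G.sectorCochain e (e, false))

/-- The difference between the two normalizations of the potential of a sector. It vanishes unless
the same zig-zag path walks along `e` in both directions. -/
noncomputable def sectorDefect (e : E × (ℤ × ℤ)) : ℤ :=
  G.ray (e, false) (e, true) - G.ray (e, true) (e, false)

lemma ray_self (s : State E) : G.ray s s = 1 := by
  rw [ray, if_pos ⟨0, by simp⟩]

lemma sectorW_eq (e x : E × (ℤ × ℤ)) : G.sectorW e x = G.sectorB e x + G.sectorDefect e := by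
  simp only [sectorW, sectorB, sectorDefect, sectorCochain, ray_self]
  ring

lemma sectorCochain_tr (t : ℤ × ℤ) (e : E × (ℤ × ℤ)) (s : State E) :
    G.sectorCochain (e.1, e.2 + t) (tr t s) = G.sectorCochain e s := by
  simp only [sectorCochain]
  rw [← G.ray_tr t (e, true), ← G.ray_tr t (e, false)]
  rfl

variable {G} in
/-- The normalized potentials are equivariant under the deck transformations. -/
lemma Consistent.sectorB_add (hG : G.Consistent) (t : ℤ × ℤ) (e x : E × (ℤ × ℤ)) :
    G.sectorB (e.1, e.2 + t) (x.1, x.2 + t) = G.sectorB e x := by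
  have h1 : G.IsPotential (G.sectorCochain e)
      (fun x ↦ G.sectorPotential (e.1, e.2 + t) (x.1, x.2 + t)) := by
    have h := hG.isPotential_sectorPotential (e.1, e.2 + t)
    refine ⟨fun p ↦ ?_, fun p ↦ ?_⟩
    · have := h.black (p.1, p.2 + t)
      rw [rB_add] at this
      rw [← G.sectorCochain_tr t e, ← G.sectorCochain_tr t e (p, _)]
      exact this
    · have := h.white (p.1, p.2 + t)
      rw [rW_add] at this
      rw [← G.sectorCochain_tr t e, ← G.sectorCochain_tr t e (p, _)]
      exact this
  have h2 := h1.sub_eq_sub (hG.isPotential_sectorPotential e) x e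
  have h3 := G.sectorCochain_tr t e (e, true)
  simp only [tr] at h3
  simp only [sectorB, h3]
  linarith

variable [Fintype E]

variable {G} in
open scoped Classical in
/-- The rays that leave a black node `b` cut the plane into sectors, so the normalized potentials of
the edges at `b` add up to one. The reason is that the cochains of these edges add up to a small
circle around `b`. -/
theorem Consistent.sum_sectorB (hG : G.Consistent) (b : B) (x : E × (ℤ × ℤ)) :
    ∑ e with G.black e = b, G.sectorB (e, -G.shift e) x = 1 := by
  set t : Finset E := Finset.univ.filter fun e ↦ G.black e = b with ht
  have hrot : ∀ e, G.rotB e ∈ t ↔ e ∈ t := by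
    intro e
    have h : G.black e = G.black (G.rotB e) :=
      (G.rotB_sameCycle_iff _ _).1 (Equiv.Perm.sameCycle_apply_right.2 (.refl _ _))
    simp [ht, h]
  have hrB : ∀ e, G.rB (e, -G.shift e) = (G.rotB e, -G.shift (G.rotB e)) := by
    intro e
    simp [rB_apply]
  have hsum : ∀ s : State E, ∑ e ∈ t, G.sectorCochain (e, -G.shift e) s =
      ∑ e ∈ t, if s = ((e, -G.shift e), true) then 1 else 0 := by
    intro s
    have h1 : ∑ e ∈ t, G.ray ((e, -G.shift e), false) s =
        ∑ e ∈ t, G.ray ((G.rotB e, -G.shift (G.rotB e)), true) s -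
        ∑ e ∈ t, if s = ((G.rotB e, -G.shift (G.rotB e)), true) then 1 else 0 := by
      rw [← Finset.sum_sub_distrib]
      refine Finset.sum_congr rfl fun e _ ↦ ?_
      rw [← hrB, ← hG.step_ray, step_true, rB_inv_rB]
    have h2 : ∀ f : E → ℤ, ∑ e ∈ t, f (G.rotB e) = ∑ e ∈ t, f e := fun f ↦
      Finset.sum_equiv G.rotB (fun e ↦ (hrot e).symm) fun _ _ ↦ rfl
    rw [h2 fun e ↦ G.ray ((e, -G.shift e), true) s,
      h2 fun e ↦ if s = ((e, -G.shift e), true) then 1 else 0] at h1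
    simp only [sectorCochain, Finset.sum_sub_distrib, h1]
    ring
  have hpot := IsPotential.sum t fun e ↦ hG.isPotential_sectorPotential (e, -G.shift e)
  simp only [hsum] at hpot
  have hzero : G.IsPotential
      (fun s ↦ ∑ e ∈ t, if s = ((e, -G.shift e), true) then 1 else 0) (fun _ ↦ 0) := by
    refine ⟨fun p ↦ ?_, fun p ↦ by simp⟩
    rw [zero_sub, zero_sub, neg_inj]
    refine (Finset.sum_equiv G.rotB (fun e ↦ (hrot e).symm) fun e _ ↦ ?_).symm
    simp only [← hrB, Prod.mk.injEq, and_true, (G.rB).injective.eq_iff]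
  obtain ⟨e₀, rfl⟩ := G.black_surjective b
  have h1 : ∀ e ∈ t, G.sectorPotential (e, -G.shift e) (e, -G.shift e) -
      G.sectorCochain (e, -G.shift e) ((e, -G.shift e), true) =
      G.sectorPotential (e, -G.shift e) (e₀, -G.shift e₀) -
      G.sectorCochain (e, -G.shift e) ((e₀, -G.shift e₀), true) := by
    intro e he
    obtain ⟨k, hk⟩ := (G.rotB_sameCycle_iff e₀ e).2 (Finset.mem_filter.1 he).2.symm
    have : (e, -G.shift e) = (G.rB ^ k) (e₀, -G.shift e₀) := by
      rw [rB_zpow_apply]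
      simp [hk]
    have h2 := apply_zpow_eq_of_invariant (σ := G.rB)
      (f := fun p ↦ G.sectorPotential (e, -G.shift e) p - G.sectorCochain (e, -G.shift e) (p, true))
      (hG.isPotential_sectorPotential (e, -G.shift e)).black k (e₀, -G.shift e₀)
    rwa [← this] at h2
  simp only [sectorB]
  rw [Finset.sum_sub_distrib, Finset.sum_congr rfl h1, Finset.sum_sub_distrib, hsum]
  have h2 := hpot.sub_eq_sub hzero x (e₀, -G.shift e₀)
  have h3 : ∑ e ∈ t, (if ((e₀, -G.shift e₀), true) = ((e, -G.shift e), true) then 1 else 0) =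
      (1 : ℤ) := by
    rw [Finset.sum_eq_single e₀]
    · simp
    · intro e _ he
      rw [if_neg]
      simp [he.symm]
    · intro h
      exact absurd (by simp [ht]) h
  rw [h3]
  linarith

variable {G} in
open scoped Classical in
/-- The normalized potentials of the edges at a white node add up to one. -/
theorem Consistent.sum_sectorW (hG : G.Consistent) (w : W) (x : E × (ℤ × ℤ)) :
    ∑ e with G.white e = w, G.sectorW (e, 0) x = 1 := by
  set t : Finset E := Finset.univ.filter fun e ↦ G.white e = w with ht
  have hrot : ∀ e, G.rotW e ∈ t ↔ e ∈ t := by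
    intro e
    have h : G.white e = G.white (G.rotW e) :=
      (G.rotW_sameCycle_iff _ _).1 (Equiv.Perm.sameCycle_apply_right.2 (.refl _ _))
    simp [ht, h]
  have hrW : ∀ e, G.rW (e, 0) = (G.rotW e, 0) := fun e ↦ rfl
  have hsum : ∀ s : State E, ∑ e ∈ t, G.sectorCochain (e, 0) s =
      -∑ e ∈ t, if s = ((e, 0), false) then 1 else 0 := by
    intro s
    have h1 : ∑ e ∈ t, G.ray ((G.rotW e, 0), true) s = ∑ e ∈ t, G.ray ((e, 0), false) s -
        ∑ e ∈ t, if s = ((e, 0), false) then 1 else 0 := by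
      rw [← Finset.sum_sub_distrib]
      refine Finset.sum_congr rfl fun e _ ↦ ?_
      rw [← hrW, ← hG.step_ray, step_false]
    have h2 : ∀ f : E → ℤ, ∑ e ∈ t, f (G.rotW e) = ∑ e ∈ t, f e := fun f ↦
      Finset.sum_equiv G.rotW (fun e ↦ (hrot e).symm) fun _ _ ↦ rfl
    rw [h2 fun e ↦ G.ray ((e, 0), true) s] at h1
    simp only [sectorCochain, Finset.sum_sub_distrib, h1]
    ring
  have hpot := IsPotential.sum t fun e ↦ hG.isPotential_sectorPotential (e, 0)
  simp only [hsum] at hpot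
  have hzero : G.IsPotential
      (fun s ↦ -∑ e ∈ t, if s = ((e, 0), false) then 1 else 0) (fun _ ↦ 0) := by
    refine ⟨fun p ↦ by simp, fun p ↦ ?_⟩
    rw [zero_add, zero_add, neg_inj]
    refine (Finset.sum_equiv G.rotW (fun e ↦ (hrot e).symm) fun e _ ↦ ?_).symm
    simp only [← hrW, Prod.mk.injEq, and_true, (G.rW).injective.eq_iff]
  obtain ⟨e₀, rfl⟩ := G.white_surjective w
  have h1 : ∀ e ∈ t, G.sectorPotential (e, 0) (e, 0) +
      G.sectorCochain (e, 0) ((e, 0), false) =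
      G.sectorPotential (e, 0) (e₀, 0) + G.sectorCochain (e, 0) ((e₀, 0), false) := by
    intro e he
    obtain ⟨k, hk⟩ := (G.rotW_sameCycle_iff e₀ e).2 (Finset.mem_filter.1 he).2.symm
    have : (e, 0) = (G.rW ^ k) (e₀, 0) := by
      rw [rW_zpow_apply]
      simp [hk]
    have h2 := apply_zpow_eq_of_invariant (σ := G.rW)
      (f := fun p ↦ G.sectorPotential (e, 0) p + G.sectorCochain (e, 0) (p, false))
      (hG.isPotential_sectorPotential (e, 0)).white k (e₀, 0)
    rwa [← this] at h2
  simp only [sectorW]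
  rw [Finset.sum_sub_distrib, Finset.sum_congr rfl h1, Finset.sum_add_distrib, hsum]
  have h2 := hpot.sub_eq_sub hzero x (e₀, 0)
  have h3 : ∑ e ∈ t, (if (((e₀, 0), false) : State E) = ((e, 0), false) then 1 else 0) =
      (1 : ℤ) := by
    rw [Finset.sum_eq_single e₀]
    · simp
    · intro e _ he
      rw [if_neg]
      simp [he.symm]
    · intro h
      exact absurd (by simp [ht]) h
  rw [h3]
  linarith

end DimerModel

/-! ### Limits of potentials -/

namespace DimerModel

/-- The determinant of two vectors of the lattice. -/
def det (a b : ℤ × ℤ) : ℤ := a.1 * b.2 - a.2 * b.1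

lemma det_add_right (a b c : ℤ × ℤ) : det a (b + c) = det a b + det a c := by
  simp [det]; ring

lemma det_add_left (a b c : ℤ × ℤ) : det (a + b) c = det a c + det b c := by
  simp [det]; ring

lemma det_smul_right (k : ℤ) (a b : ℤ × ℤ) : det a (k • b) = k * det a b := by
  simp [det]; ring

lemma det_smul_left (k : ℤ) (a b : ℤ × ℤ) : det (k • a) b = k * det a b := by
  simp [det]; ring

lemma det_self (a : ℤ × ℤ) : det a a = 0 := by
  simp [det]; ring

lemma det_comm (a b : ℤ × ℤ) : det a b = -det b a := by
  simp [det]; ring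

lemma det_neg_right (a b : ℤ × ℤ) : det a (-b) = -det a b := by
  simp [det]; ring

lemma det_neg_left (a b : ℤ × ℤ) : det (-a) b = -det a b := by
  simp [det]; ring

/-- The cone spanned by `u` and `u'` contains only finitely many points of a half-line whose
direction does not lie in this cone. -/
lemma finite_cone_inter_halfline {u u' v : ℤ × ℤ} (hD : 0 < det u u')
    (h : det u v < 0 ∨ det v u' < 0) (x : ℤ × ℤ) :
    {ij : ℕ × ℕ | ∃ k : ℕ, (ij.1 : ℤ) • u + (ij.2 : ℤ) • u' = (k : ℤ) • v + x}.Finite := by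
  have h1 : ∀ (i j k : ℤ), i • u + j • u' = k • v + x → j * det u u' = k * det u v + det u x := by
    intro i j k hk
    have := congrArg (det u) hk
    simpa only [det_add_right, det_smul_right, det_self, mul_zero, zero_add] using this
  have h2 : ∀ (i j k : ℤ), i • u + j • u' = k • v + x →
      i * det u u' = k * det v u' + det x u' := by
    intro i j k hk
    have := congrArg (fun y ↦ det y u') hk
    simpa only [det_add_left, det_smul_left, det_self, mul_zero, add_zero] using this
  refine ((Set.finite_Iic ((det u x).natAbs + (det x u').natAbs)).biUnion
    (t := fun k : ℕ ↦ {ij : ℕ × ℕ | (ij.1 : ℤ) • u + (ij.2 : ℤ) • u' = (k : ℤ) • v + x})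
    fun k _ ↦ Set.Subsingleton.finite ?_).subset ?_
  · rintro ⟨i, j⟩ hij ⟨i', j'⟩ hij'
    have a1 := (h1 _ _ _ hij).trans (h1 _ _ _ hij').symm
    have a2 := (h2 _ _ _ hij).trans (h2 _ _ _ hij').symm
    have b1 := mul_right_cancel₀ hD.ne' a1
    have b2 := mul_right_cancel₀ hD.ne' a2
    simp only at b1 b2
    exact Prod.ext (by exact_mod_cast b2) (by exact_mod_cast b1)
  · rintro ⟨i, j⟩ ⟨k, hk⟩
    refine Set.mem_biUnion (x := k) ?_ hk
    have a1 := h1 _ _ _ hk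
    have a2 := h2 _ _ _ hk
    simp only at a1 a2
    have hi : (0 : ℤ) ≤ i * det u u' := by positivity
    have hj : (0 : ℤ) ≤ j * det u u' := by positivity
    have hk0 : (0 : ℤ) ≤ k := by positivity
    rw [Set.mem_Iic]
    rcases h with h | h
    · have : (k : ℤ) ≤ det u x := by nlinarith
      omega
    · have : (k : ℤ) ≤ det x u' := by nlinarith
      omega

/-- A half-line in the direction of `u` meets a line in the direction of `v` at most once if `u` and
`v` are independent. -/
lemma subsingleton_halfline_inter_line {u v : ℤ × ℤ} (h : det u v ≠ 0) (x : ℤ × ℤ) :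
    {m : ℕ | ∃ k : ℤ, (m : ℤ) • u = k • v + x}.Subsingleton := by
  rintro m ⟨k, hk⟩ m' ⟨k', hk'⟩
  have h1 := congrArg (fun y ↦ det y v) hk
  have h2 := congrArg (fun y ↦ det y v) hk'
  simp only [det_add_left, det_smul_left, det_self, mul_zero, zero_add] at h1 h2
  exact_mod_cast mul_right_cancel₀ h (h1.trans h2.symm)

variable {B W E : Type*} (G : DimerModel B W E)

open Filter

variable {G} in
/-- If a cochain vanishes near infinity along a family of deck transformations, then so do the
differences of the values of its potential. -/
lemma IsPotential.eventually_eq {Q : State E → ℤ} {σ : E × (ℤ × ℤ) → ℤ} (h : G.IsPotential Q σ)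
    {ι : Type*} {l : Filter ι} {g : ι → ℤ × ℤ} (hQ : ∀ s, ∀ᶠ i in l, Q (tr (g i) s) = 0)
    (x y : E × (ℤ × ℤ)) : ∀ᶠ i in l, σ (x.1, x.2 + g i) = σ (y.1, y.2 + g i) := by
  refine Filter.Germ.coe_eq.1 (G.eq_of_invariant (f := fun x ↦
    ((fun i ↦ σ (x.1, x.2 + g i) : ι → ℤ) : Filter.Germ l ℤ)) (fun p ↦ ?_) (fun p ↦ ?_) x y)
  · refine Filter.Germ.coe_eq.2 ?_
    filter_upwards [hQ (p, true), hQ (G.rB p, true)] with i h1 h2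
    have := h.black (p.1, p.2 + g i)
    rw [rB_add] at this
    simp only [tr] at h1 h2
    rwa [h1, h2, sub_zero, sub_zero] at this
  · refine Filter.Germ.coe_eq.2 ?_
    filter_upwards [hQ (p, false), hQ (G.rW p, false)] with i h1 h2
    have := h.white (p.1, p.2 + g i)
    rw [rW_add] at this
    simp only [tr] at h1 h2
    rwa [h1, h2, add_zero, add_zero] at this

/-- `σ` has the limit `l` in the direction of `u`. -/
def HasLimit (σ : E × (ℤ × ℤ) → ℤ) (u : ℤ × ℤ) (l : ℤ) : Prop :=
  ∀ x : E × (ℤ × ℤ), ∀ᶠ m : ℕ in atTop, σ (x.1, x.2 + (m : ℤ) • u) = l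

namespace HasLimit

variable {σ σ' : E × (ℤ × ℤ) → ℤ} {u u' : ℤ × ℤ} {l l' : ℤ}

variable {G} in
lemma unique (G : DimerModel B W E) (h : HasLimit σ u l) (h' : HasLimit σ u l') : l = l' := by
  obtain ⟨e⟩ := G.nonempty_edges
  obtain ⟨m, h1, h2⟩ := ((h (e, 0)).and (h' (e, 0))).exists
  exact h1.symm.trans h2

lemma add (h : HasLimit σ u l) (h' : HasLimit σ' u l') :
    HasLimit (fun x ↦ σ x + σ' x) u (l + l') := fun x ↦ by
  filter_upwards [h x, h' x] with m h1 h2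
  rw [h1, h2]

lemma const_mul (c : ℤ) (h : HasLimit σ u l) : HasLimit (fun x ↦ c * σ x) u (c * l) := fun x ↦ by
  filter_upwards [h x] with m h1
  rw [h1]

lemma sub_const (c : ℤ) (h : HasLimit σ u l) : HasLimit (fun x ↦ σ x - c) u (l - c) := fun x ↦ by
  filter_upwards [h x] with m h1
  rw [h1]

end HasLimit

variable {G} in
lemma IsPotential.exists_hasLimit {Q : State E → ℤ} {σ : E × (ℤ × ℤ) → ℤ}
    (h : G.IsPotential Q σ) {u : ℤ × ℤ}
    (hQ : ∀ s, ∀ᶠ m : ℕ in atTop, Q (tr ((m : ℤ) • u) s) = 0) : ∃ l, HasLimit σ u l := by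
  obtain ⟨e⟩ := G.nonempty_edges
  have h1 := h.eventually_eq hQ (e, 0) (e, u)
  obtain ⟨N, hN⟩ := eventually_atTop.1 h1
  refine ⟨σ (e, (N : ℤ) • u), fun x ↦ ?_⟩
  have h2 : ∀ m ≥ N, σ (e, (m : ℤ) • u) = σ (e, (N : ℤ) • u) := by
    intro m hm
    induction m, hm using Nat.le_induction with
    | base => rfl
    | succ m hm ih =>
      rw [← ih]
      have := hN m hm
      simp only [zero_add] at this
      rw [this]
      congr 2
      push_cast
      rw [add_smul, one_smul, add_comm]
  filter_upwards [h.eventually_eq hQ x (e, 0), eventually_ge_atTop N] with m h3 h4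
  rw [h3]
  simp only [zero_add, h2 m h4]

variable {G} in
/-- Two directions have the same limit if the cochain vanishes near infinity in the cone between
them. -/
lemma IsPotential.limit_eq_of_cone {Q : State E → ℤ} {σ : E × (ℤ × ℤ) → ℤ}
    (h : G.IsPotential Q σ) {u u' : ℤ × ℤ} {l l' : ℤ} (hl : HasLimit σ u l)
    (hl' : HasLimit σ u' l')
    (hQ : ∀ s, ∀ᶠ ij : ℕ × ℕ in cofinite, Q (tr ((ij.1 : ℤ) • u + (ij.2 : ℤ) • u') s) = 0) :
    l = l' := by
  obtain ⟨e⟩ := G.nonempty_edges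
  have h1 := (h.eventually_eq hQ (e, 0) (e, u)).and (h.eventually_eq hQ (e, 0) (e, u'))
  rw [eventually_cofinite] at h1
  obtain ⟨⟨N, N'⟩, hN⟩ := h1.bddAbove
  let f : ℕ → ℕ → ℤ := fun i j ↦ σ (e, (i : ℤ) • u + (j : ℤ) • u')
  have h2 : ∀ i j : ℕ, N < i ∨ N' < j → f i j = f (i + 1) j ∧ f i j = f i (j + 1) := by
    intro i j hij
    have h3 : (i, j) ∉ {x : ℕ × ℕ | ¬ _} := fun hmem ↦ by
      have := hN hmem
      simp only [Prod.mk_le_mk] at this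
      omega
    simp only [Set.mem_ofPred_eq, not_not, zero_add] at h3
    refine ⟨h3.1.trans ?_, h3.2.trans ?_⟩
    · simp only [f]
      congr 2
      push_cast
      rw [add_smul, one_smul]
      abel
    · simp only [f]
      congr 2
      push_cast
      rw [add_smul, one_smul]
      abel
  have h3 : ∀ i, N < i → ∀ j, f i j = f i 0 := by
    intro i hi j
    induction j with
    | zero => rfl
    | succ j ih => rw [← ih, ← (h2 i j (Or.inl hi)).2]
  have h4 : ∀ j, N' < j → ∀ i, f i j = f 0 j := by
    intro j hj i
    induction i with
    | zero => rfl
    | succ i ih => rw [← ih, ← (h2 i j (Or.inr hj)).1]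
  obtain ⟨m, ⟨h5, h6⟩, h7, h8⟩ := (((hl (e, 0)).and (hl' (e, 0))).and
    ((eventually_gt_atTop N).and (eventually_gt_atTop N'))).exists
  have h9 := h3 m h7 m
  have h10 := h4 m h8 m
  simp only [zero_add] at h5 h6
  simp only [f, Nat.cast_zero, zero_smul, zero_add, add_zero, h5, h6] at h9 h10
  exact h9.symm.trans h10

/-! ### Asymptotics of rays and lines -/

lemma exists_of_line_ne_zero {s₀ s : State E} (h : G.line s₀ s ≠ 0) :
    ∃ r < G.period, ∃ k : ℤ, s = tr (k • G.dir s₀) ((G.step ^ (r : ℤ)) s₀) := by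
  classical
  rw [line, ite_ne_right_iff] at h
  obtain ⟨⟨t, rfl⟩, -⟩ := h
  have hM : (0 : ℤ) < G.period := by exact_mod_cast G.period_pos
  refine ⟨(t % G.period).toNat, ?_, t / G.period, ?_⟩
  · have := Int.emod_lt_of_pos t hM
    omega
  · rw [Int.toNat_of_nonneg (Int.emod_nonneg _ hM.ne'), ← zpow_step_tr, ← zpow_step_period_mul,
      ← zpow_step_add, Int.emod_add_mul_ediv]

lemma exists_of_ray_ne_zero {s₀ s : State E} (h : G.ray s₀ s ≠ 0) :
    ∃ r < G.period, ∃ k : ℕ, s = tr ((k : ℤ) • G.dir s₀) ((G.step ^ (r : ℤ)) s₀) := by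
  classical
  rw [ray, ite_ne_right_iff] at h
  obtain ⟨⟨t, rfl⟩, -⟩ := h
  refine ⟨t % G.period, Nat.mod_lt _ G.period_pos, t / G.period, ?_⟩
  rw [← zpow_step_tr, ← zpow_step_period_mul, ← zpow_step_add]
  norm_cast
  rw [Nat.mod_add_div]

lemma exists_of_ray_ne_line {s₀ s : State E} (h : G.ray s₀ s ≠ G.line s₀ s) :
    ∃ r < G.period, ∃ k : ℕ, s = tr ((k : ℤ) • -G.dir s₀) ((G.step ^ (r : ℤ)) s₀) := by
  have h1 : ∃ t : ℤ, (G.step ^ t) s₀ = s := by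
    by_contra h1
    apply h
    rw [line, if_neg h1, ray, if_neg]
    rintro ⟨t, ht⟩
    exact h1 ⟨t, ht⟩
  have h2 : ¬ ∃ t : ℕ, (G.step ^ (t : ℤ)) s₀ = s := fun h2 ↦ h (by
    rw [line, if_pos h1, ray, if_pos h2])
  obtain ⟨t, rfl⟩ := h1
  have ht : t < 0 := by
    by_contra ht
    exact h2 ⟨t.toNat, by rw [Int.toNat_of_nonneg (not_lt.1 ht)]⟩
  have hM : (0 : ℤ) < G.period := by exact_mod_cast G.period_pos
  have hk : t / G.period < 0 := Int.ediv_neg_of_neg_of_pos ht hM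
  refine ⟨(t % G.period).toNat, ?_, (-(t / G.period)).toNat, ?_⟩
  · have := Int.emod_lt_of_pos t hM
    omega
  · rw [Int.toNat_of_nonneg (Int.emod_nonneg _ hM.ne'), Int.toNat_of_nonneg (by omega), neg_smul,
      smul_neg, neg_neg, ← zpow_step_tr, ← zpow_step_period_mul, ← zpow_step_add,
      Int.emod_add_mul_ediv]

lemma eventually_line_eq_zero {s₀ : State E} {u : ℤ × ℤ} (hu : det u (G.dir s₀) ≠ 0)
    (s : State E) : ∀ᶠ m : ℕ in atTop, G.line s₀ (tr ((m : ℤ) • u) s) = 0 := by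
  rw [← Nat.cofinite_eq_atTop, eventually_cofinite]
  refine ((Set.finite_Iio G.period).biUnion (t := fun r : ℕ ↦ {m : ℕ | ∃ k : ℤ, (m : ℤ) • u =
    k • G.dir s₀ + (((G.step ^ (r : ℤ)) s₀).1.2 - s.1.2)}) fun r _ ↦
    (subsingleton_halfline_inter_line hu _).finite).subset ?_
  intro m hm
  obtain ⟨r, hr, k, hk⟩ := G.exists_of_line_ne_zero hm
  refine Set.mem_biUnion (x := r) hr ⟨k, ?_⟩
  have := congrArg (fun s ↦ s.1.2) hk
  simp only [tr_fst_snd] at this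
  rw [eq_sub_iff_add_eq'.2 this]
  abel

lemma eventually_ray_eq_zero {s₀ : State E} {u : ℤ × ℤ} (hu : det u (G.dir s₀) ≠ 0)
    (s : State E) : ∀ᶠ m : ℕ in atTop, G.ray s₀ (tr ((m : ℤ) • u) s) = 0 := by
  classical
  filter_upwards [G.eventually_line_eq_zero hu s] with m hm
  rw [line, ite_eq_right_iff] at hm
  apply G.ray_eq_zero_of_line
  intro t ht
  simpa using hm ⟨t, ht⟩

lemma eventually_cofinite_eq_zero {Q : State E → ℤ} {s₀ : State E} {v : ℤ × ℤ}
    (hQ : ∀ s, Q s ≠ 0 →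
      ∃ r < G.period, ∃ k : ℕ, s = tr ((k : ℤ) • v) ((G.step ^ (r : ℤ)) s₀))
    {u u' : ℤ × ℤ} (hD : 0 < det u u') (h : det u v < 0 ∨ det v u' < 0) (s : State E) :
    ∀ᶠ ij : ℕ × ℕ in cofinite, Q (tr ((ij.1 : ℤ) • u + (ij.2 : ℤ) • u') s) = 0 := by
  rw [eventually_cofinite]
  refine ((Set.finite_Iio G.period).biUnion (t := fun r : ℕ ↦ {ij : ℕ × ℕ | ∃ k : ℕ,
    (ij.1 : ℤ) • u + (ij.2 : ℤ) • u' = (k : ℤ) • v +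
      (((G.step ^ (r : ℤ)) s₀).1.2 - s.1.2)}) fun r _ ↦ finite_cone_inter_halfline hD h _).subset ?_
  intro ij hij
  obtain ⟨r, hr, k, hk⟩ := hQ _ hij
  refine Set.mem_biUnion (x := r) hr ⟨k, ?_⟩
  have := congrArg (fun s ↦ s.1.2) hk
  simp only [tr_fst_snd] at this
  rw [eq_sub_iff_add_eq'.2 this]
  abel

/-- A potential of the indicator function of a zig-zag path. -/
noncomputable def linePotential (s₀ : State E) : E × (ℤ × ℤ) → ℤ :=
  (G.isCocycle_line s₀).exists_isPotential.choose

lemma isPotential_linePotential (s₀ : State E) :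
    G.IsPotential (G.line s₀) (G.linePotential s₀) :=
  (G.isCocycle_line s₀).exists_isPotential.choose_spec

open scoped Classical in
/-- The limit of `σ` in the direction of `u`. It is zero by convention if the limit does not exist.
-/
noncomputable def limit (σ : E × (ℤ × ℤ) → ℤ) (u : ℤ × ℤ) : ℤ :=
  if h : ∃ l, HasLimit σ u l then h.choose else 0

lemma hasLimit_limit {σ : E × (ℤ × ℤ) → ℤ} {u : ℤ × ℤ} (h : ∃ l, HasLimit σ u l) :
    HasLimit σ u (limit σ u) := by
  rw [limit, dif_pos h]
  exact h.choose_spec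

lemma hasLimit_linePotential {s₀ : State E} {u : ℤ × ℤ} (hu : det u (G.dir s₀) ≠ 0) :
    HasLimit (G.linePotential s₀) u (limit (G.linePotential s₀) u) :=
  hasLimit_limit ((G.isPotential_linePotential s₀).exists_hasLimit (G.eventually_line_eq_zero hu))

lemma exists_det_ne_zero {v : ℤ × ℤ} (hv : v ≠ 0) : 0 < det v (-v.2, v.1) := by
  have : v.1 ≠ 0 ∨ v.2 ≠ 0 := by
    by_contra! h
    exact hv (Prod.ext h.1 h.2)
  simp only [det]
  rcases this with h | h <;> nlinarith [sq_nonneg v.1, sq_nonneg v.2, sq_pos_of_ne_zero h]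

variable {G} in
/-- The potential of a zig-zag path is invariant under the translation along this path. -/
lemma Consistent.linePotential_add (hG : G.Consistent) (s₀ : State E) (k : ℤ)
    (x : E × (ℤ × ℤ)) :
    G.linePotential s₀ (x.1, x.2 + k • G.dir s₀) = G.linePotential s₀ x := by
  have h := G.isPotential_linePotential s₀
  have h1 : G.IsPotential (G.line s₀)
      (fun x ↦ G.linePotential s₀ (x.1, x.2 + k • G.dir s₀)) := by
    refine ⟨fun p ↦ ?_, fun p ↦ ?_⟩
    · have := h.black (p.1, p.2 + k • G.dir s₀)
      rw [rB_add] at this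
      rw [← G.line_tr_dir s₀ _ k, ← G.line_tr_dir s₀ (p, _) k]
      exact this
    · have := h.white (p.1, p.2 + k • G.dir s₀)
      rw [rW_add] at this
      rw [← G.line_tr_dir s₀ _ k, ← G.line_tr_dir s₀ (p, _) k]
      exact this
  set u : ℤ × ℤ := (-(G.dir s₀).2, (G.dir s₀).1) with hu
  have hdet : det u (G.dir s₀) ≠ 0 := by
    rw [det_comm]
    exact (neg_neg_of_pos (exists_det_ne_zero (hG.dir_ne_zero s₀))).ne
  have hl := G.hasLimit_linePotential hdet
  obtain ⟨m, h2, h3⟩ := ((hl x).and (hl (x.1, x.2 + k • G.dir s₀))).exists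
  have h4 := h1.sub_eq_sub h x (x.1, x.2 + (m : ℤ) • u)
  simp only at h3 h4
  rw [add_right_comm, h3, h2] at h4
  linarith

variable {G} in
/-- The limits of the potential of a zig-zag path depend only on the side of the path. -/
lemma Consistent.limit_linePotential_eq (hG : G.Consistent) {s₀ : State E} {u u' : ℤ × ℤ}
    (h : 0 < det (G.dir s₀) u * det (G.dir s₀) u') :
    limit (G.linePotential s₀) u = limit (G.linePotential s₀) u' := by
  set v := G.dir s₀ with hv
  have hu : det u v ≠ 0 := by
    rw [det_comm]; rintro h0; simp [neg_eq_zero.1 h0] at h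
  have hu' : det u' v ≠ 0 := by
    rw [det_comm]; rintro h0; simp [neg_eq_zero.1 h0] at h
  have hl := G.hasLimit_linePotential hu
  have hl' := G.hasLimit_linePotential hu'
  -- the multiples `a • u` and `b • u'` differ by a multiple of `v`
  set N : ℤ := v.1 * v.1 + v.2 * v.2 with hN
  have hN0 : 0 < N := by
    have := exists_det_ne_zero (hG.dir_ne_zero s₀)
    simp only [det] at this
    linarith
  set a : ℕ := (det v u').natAbs * N.natAbs with ha
  set b : ℕ := (det v u).natAbs * N.natAbs with hb
  have hv0 : det v u ≠ 0 ∧ det v u' ≠ 0 := by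
    constructor <;> (rintro h0; simp [h0] at h)
  have ha0 : 0 < a := Nat.mul_pos (Int.natAbs_pos.2 hv0.2) (Int.natAbs_pos.2 hN0.ne')
  have hb0 : 0 < b := Nat.mul_pos (Int.natAbs_pos.2 hv0.1) (Int.natAbs_pos.2 hN0.ne')
  have hk : ∃ k : ℤ, (a : ℤ) • u = (b : ℤ) • u' + k • v := by
    have key : ∀ α β : ℤ, α * det v u = β * det v u' →
        ∃ k : ℤ, (α * N) • u = (β * N) • u' + k • v := by
      intro α β hαβ
      refine ⟨v.1 * (α * u.1 - β * u'.1) + v.2 * (α * u.2 - β * u'.2), ?_⟩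
      simp only [det] at hαβ
      ext
      · simp only [Prod.smul_fst, Prod.fst_add, smul_eq_mul, hN]
        linear_combination (-v.2) * hαβ
      · simp only [Prod.smul_snd, Prod.snd_add, smul_eq_mul, hN]
        linear_combination v.1 * hαβ
    rw [ha, hb]
    push_cast
    rw [abs_of_pos hN0]
    apply key
    rcases pos_and_pos_or_neg_and_neg_of_mul_pos h with h | h
    · rw [abs_of_pos h.1, abs_of_pos h.2, mul_comm]
    · rw [abs_of_neg h.1, abs_of_neg h.2]; ring
  obtain ⟨k, hk⟩ := hk
  obtain ⟨e⟩ := G.nonempty_edges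
  have ta : Tendsto (fun n : ℕ ↦ a * n) atTop atTop := tendsto_id.const_mul_atTop' ha0
  have tb : Tendsto (fun n : ℕ ↦ b * n) atTop atTop := tendsto_id.const_mul_atTop' hb0
  obtain ⟨n, h1, h2⟩ := ((ta.eventually (hl (e, 0))).and (tb.eventually (hl' (e, 0)))).exists
  rw [← h1, ← h2]
  have h3 : ((a * n : ℕ) : ℤ) • u = ((b * n : ℕ) : ℤ) • u' + (n * k : ℤ) • v := by
    push_cast
    rw [mul_comm (a : ℤ), mul_comm (b : ℤ), mul_smul, hk, smul_add, mul_smul, mul_smul]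
  simp only [zero_add]
  rw [h3]
  exact hG.linePotential_add s₀ (n * k) (e, ((b * n : ℕ) : ℤ) • u')

end DimerModel

/-! ### Limits of sectors -/

namespace DimerModel

variable {B W E : Type*} (G : DimerModel B W E)

open Filter

/-- A vector which is not parallel to any zig-zag path. -/
def Generic (u : ℤ × ℤ) : Prop := ∀ s, det u (G.dir s) ≠ 0

variable {G} in
lemma Consistent.eventually_generic (hG : G.Consistent) {a b : ℤ × ℤ} (h : det a b ≠ 0) :
    ∀ᶠ n : ℕ in atTop, G.Generic ((n : ℤ) • a + b) := by
  have : ∀ᶠ n : ℕ in atTop, ∀ v ∈ Set.range G.dir, det ((n : ℤ) • a + b) v ≠ 0 := by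
    rw [eventually_all_finite G.finite_range_dir]
    rintro _ ⟨s, rfl⟩
    rw [← Nat.cofinite_eq_atTop, eventually_cofinite]
    refine Set.Subsingleton.finite ?_
    intro n hn m hm
    simp only [ne_eq, not_not, det_add_left, det_smul_left, Set.mem_ofPred_eq] at hn hm
    by_contra hnm
    have h1 : ((n : ℤ) - m) * det a (G.dir s) = 0 := by linarith
    have ha : det a (G.dir s) = 0 := by
      rcases mul_eq_zero.1 h1 with h1 | h1
      · omega
      · exact h1
    have hb : det b (G.dir s) = 0 := by rw [ha] at hn; linarith
    apply hG.dir_ne_zero s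
    have e1 : det a b * (G.dir s).1 = 0 := by
      simp only [det] at ha hb ⊢
      linear_combination b.1 * ha - a.1 * hb
    have e2 : det a b * (G.dir s).2 = 0 := by
      simp only [det] at ha hb ⊢
      linear_combination b.2 * ha - a.2 * hb
    exact Prod.ext ((mul_eq_zero.1 e1).resolve_left h) ((mul_eq_zero.1 e2).resolve_left h)
  filter_upwards [this] with n hn s using hn _ ⟨s, rfl⟩

variable {G} in
lemma Consistent.isPotential_sectorB (hG : G.Consistent) (e : E × (ℤ × ℤ)) :
    G.IsPotential (G.sectorCochain e) (G.sectorB e) := by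
  have h := hG.isPotential_sectorPotential e
  refine ⟨fun p ↦ ?_, fun p ↦ ?_⟩
  · have := h.black p
    simp only [sectorB]
    linarith
  · have := h.white p
    simp only [sectorB]
    linarith

/-- The limit in the direction of `u` of the normalized potential of the sector of `e`. -/
noncomputable def edgeLimit (e : E) (u : ℤ × ℤ) : ℤ := limit (G.sectorB (e, 0)) u

variable {G} in
lemma Consistent.hasLimit_sectorB (hG : G.Consistent) {u : ℤ × ℤ} (hu : G.Generic u)
    (e : E × (ℤ × ℤ)) : HasLimit (G.sectorB e) u (G.edgeLimit e.1 u) := by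
  have h : HasLimit (G.sectorB (e.1, 0)) u (G.edgeLimit e.1 u) := by
    refine hasLimit_limit ((hG.isPotential_sectorB (e.1, 0)).exists_hasLimit fun s ↦ ?_)
    filter_upwards [G.eventually_ray_eq_zero (hu ((e.1, 0), true)) s,
      G.eventually_ray_eq_zero (hu ((e.1, 0), false)) s] with m h1 h2
    rw [sectorCochain, h1, h2, sub_zero]
  intro x
  filter_upwards [h (x.1, x.2 - e.2)] with m hm
  rw [← hm, ← hG.sectorB_add e.2 (e.1, 0)]
  simp only [zero_add, Prod.mk.eta]
  congr 2
  abel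

lemma HasLimit.finset_sum {ι : Type*} (s : Finset ι) {σ : ι → E × (ℤ × ℤ) → ℤ} {u : ℤ × ℤ}
    {l : ι → ℤ} (h : ∀ i ∈ s, HasLimit (σ i) u (l i)) :
    HasLimit (fun x ↦ ∑ i ∈ s, σ i x) u (∑ i ∈ s, l i) := by
  intro x
  have := (eventually_all_finset s).2 fun i hi ↦ h i hi x
  filter_upwards [this] with m hm
  exact Finset.sum_congr rfl hm

section

variable [Fintype E]

variable {G} in
open scoped Classical in
lemma Consistent.sum_edgeLimit_black (hG : G.Consistent) {u : ℤ × ℤ} (hu : G.Generic u) (b : B) :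
    ∑ e with G.black e = b, G.edgeLimit e u = 1 := by
  have h := HasLimit.finset_sum {e | G.black e = b}
    fun e _ ↦ hG.hasLimit_sectorB hu (e, -G.shift e)
  refine h.unique G fun x ↦ ?_
  simp only [hG.sum_sectorB b, eventually_true]

variable {G} in
open scoped Classical in
lemma Consistent.sum_edgeLimit_white (hG : G.Consistent) {u : ℤ × ℤ} (hu : G.Generic u) (w : W) :
    ∑ e with G.white e = w, (G.edgeLimit e u + G.sectorDefect (e, 0)) = 1 := by
  have h := HasLimit.finset_sum (σ := fun e x ↦ G.sectorW (e, 0) x) {e | G.white e = w}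
    fun e _ ↦ by
      have := (hG.hasLimit_sectorB hu (e, 0)).sub_const (-G.sectorDefect (e, 0))
      simp only [sub_neg_eq_add, ← sectorW_eq] at this
      exact this
  refine h.unique G fun x ↦ ?_
  simp only [hG.sum_sectorW w, eventually_true]

end

/-- The difference of the values of the potential of a zig-zag path far away on its two sides. -/
noncomputable def jump (s : State E) : ℤ :=
  limit (G.linePotential s) (-(G.dir s).2, (G.dir s).1) -
    limit (G.linePotential s) (-(-(G.dir s).2, (G.dir s).1))

variable {G} in
lemma Consistent.limit_linePotential_sub (hG : G.Consistent) {s : State E} {u u' : ℤ × ℤ}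
    (h : det (G.dir s) u < 0) (h' : 0 < det (G.dir s) u') :
    limit (G.linePotential s) u' - limit (G.linePotential s) u = G.jump s := by
  have h0 := exists_det_ne_zero (hG.dir_ne_zero s)
  rw [jump, hG.limit_linePotential_eq (u := u') (mul_pos h' h0),
    hG.limit_linePotential_eq (u := u) (u' := -(-(G.dir s).2, (G.dir s).1))]
  rw [det_neg_right]
  nlinarith

/-- The vector `v` lies in the open cone spanned by `u` and `u'`. -/
def InCone (u u' v : ℤ × ℤ) : Prop := 0 < det u v ∧ 0 < det v u'

variable {G} in
open scoped Classical in
/-- Turning from the direction of `u` to the direction of `u'`, the limit of the potential of a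
sector changes only at the two rays that bound the sector. -/
theorem Consistent.edgeLimit_sub (hG : G.Consistent) (e : E × (ℤ × ℤ)) {u u' : ℤ × ℤ}
    (hu : G.Generic u) (hu' : G.Generic u') (hD : 0 < det u u') :
    G.edgeLimit e.1 u' - G.edgeLimit e.1 u =
      (if InCone u u' (G.dir (e, true)) then G.jump (e, true) else 0) -
      (if InCone u u' (G.dir (e, false)) then G.jump (e, false) else 0) := by
  set χ : Bool → ℤ := fun d ↦ if InCone u u' (G.dir (e, d)) then 1 else 0 with hχ
  set Q : State E → ℤ := fun s ↦ G.sectorCochain e s - χ true * G.line (e, true) s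
    + χ false * G.line (e, false) s with hQ
  set φ : E × (ℤ × ℤ) → ℤ := fun x ↦ G.sectorB e x - χ true * G.linePotential (e, true) x
    + χ false * G.linePotential (e, false) x with hφ
  have hpot : G.IsPotential Q φ := by
    have h1 := hG.isPotential_sectorB e
    have h2 := G.isPotential_linePotential (e, true)
    have h3 := G.isPotential_linePotential (e, false)
    refine ⟨fun p ↦ ?_, fun p ↦ ?_⟩
    · simp only [hQ, hφ]
      linear_combination h1.black p - χ true * h2.black p + χ false * h3.black p
    · simp only [hQ, hφ]
      linear_combination h1.white p - χ true * h2.white p + χ false * h3.white p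
  have hlim : ∀ u, G.Generic u → HasLimit φ u (G.edgeLimit e.1 u -
      χ true * limit (G.linePotential (e, true)) u +
      χ false * limit (G.linePotential (e, false)) u) := by
    intro u hu
    have h1 := hG.hasLimit_sectorB hu e
    have h2 := (G.hasLimit_linePotential (hu (e, true))).const_mul (-χ true)
    have h3 := (G.hasLimit_linePotential (hu (e, false))).const_mul (χ false)
    have h4 := (h1.add h2).add h3
    simp only [neg_mul, ← sub_eq_add_neg] at h4
    exact h4
  have hzero : ∀ (d : Bool) (s : State E), ∀ᶠ ij : ℕ × ℕ in cofinite,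
      G.ray (e, d) (tr ((ij.1 : ℤ) • u + (ij.2 : ℤ) • u') s) -
        χ d * G.line (e, d) (tr ((ij.1 : ℤ) • u + (ij.2 : ℤ) • u') s) = 0 := by
    intro d s
    by_cases hc : InCone u u' (G.dir (e, d))
    · -- the forward half is removed, and the backward half leaves the cone
      refine G.eventually_cofinite_eq_zero (s₀ := (e, d)) (v := -G.dir (e, d))
        (Q := fun s ↦ G.ray (e, d) s - χ d * G.line (e, d) s) (fun s hs ↦ ?_) hD
        (Or.inl (by rw [det_neg_right]; linarith [hc.1])) s
      simp only [hχ, if_pos hc, one_mul] at hs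
      exact G.exists_of_ray_ne_line (sub_ne_zero.1 hs)
    · refine G.eventually_cofinite_eq_zero (s₀ := (e, d)) (v := G.dir (e, d))
        (Q := fun s ↦ G.ray (e, d) s - χ d * G.line (e, d) s) (fun s hs ↦ ?_) hD ?_ s
      · simp only [hχ, if_neg hc, zero_mul, sub_zero] at hs
        exact G.exists_of_ray_ne_zero hs
      · by_contra! h
        refine hc ⟨lt_of_le_of_ne h.1 (hu _).symm, lt_of_le_of_ne h.2 ?_⟩
        rw [det_comm]
        exact fun h0 ↦ hu' (e, d) (by linarith)
  have h0 := hpot.limit_eq_of_cone (hlim u hu) (hlim u' hu') fun s ↦ by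
    filter_upwards [hzero true s, hzero false s] with ij h1 h2
    simp only [hQ, sectorCochain]
    linear_combination h1 - h2
  have key : ∀ d : Bool, (if InCone u u' (G.dir (e, d)) then G.jump (e, d) else 0) =
      χ d * (limit (G.linePotential (e, d)) u' - limit (G.linePotential (e, d)) u) := by
    intro d
    by_cases hc : InCone u u' (G.dir (e, d))
    · rw [if_pos hc, hG.limit_linePotential_sub _ hc.2]
      · simp only [hχ, if_pos hc, one_mul]
      · rw [det_comm]
        linarith [hc.1]
    · simp only [hχ, if_neg hc, zero_mul]
  rw [key, key]
  linear_combination -h0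

open scoped Classical in
/-- If three vectors positively span the plane, then every direction lies in one of their three
cones. -/
lemma sum_inCone {u v w x : ℤ × ℤ} (h1 : 0 < det u v) (h2 : 0 < det v w) (h3 : 0 < det w u)
    (hu : det u x ≠ 0) (hv : det v x ≠ 0) (hw : det w x ≠ 0) :
    (if InCone u v x then (1 : ℤ) else 0) + (if InCone v w x then (1 : ℤ) else 0) +
      (if InCone w u x then (1 : ℤ) else 0) = 1 := by
  have h : det v w * det u x + det w u * det v x + det u v * det w x = 0 := by
    simp only [det]; ring
  simp only [InCone, det_comm x, Left.neg_pos_iff]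
  rcases lt_or_gt_of_ne hu with a | a <;> rcases lt_or_gt_of_ne hv with b | b <;>
    rcases lt_or_gt_of_ne hw with c | c <;>
    simp only [a, b, c, not_lt_of_gt, and_true, and_false, if_true, if_false,
      add_zero, zero_add]
  · exfalso
    nlinarith [mul_pos_of_neg_of_neg a (neg_neg_of_pos h2), mul_pos h2 (neg_pos.2 a),
      mul_pos h3 (neg_pos.2 b), mul_pos h1 (neg_pos.2 c)]
  · exfalso
    nlinarith [mul_pos h2 a, mul_pos h3 b, mul_pos h1 c]

variable {G} in
/-- Turning once around the plane, the limit of the potential of a sector comes back to itself. -/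
lemma Consistent.jump_true_eq_jump_false (hG : G.Consistent) (e : E × (ℤ × ℤ)) :
    G.jump (e, true) = G.jump (e, false) := by
  classical
  obtain ⟨n, hn, h1, h2, h3⟩ := ((eventually_ge_atTop 2).and
    ((hG.eventually_generic (a := (1, 0)) (b := (0, 1)) (by simp [det])).and
    ((hG.eventually_generic (a := (0, 1)) (b := (-1, -1)) (by simp [det])).and
    (hG.eventually_generic (a := (-1, -1)) (b := (1, 0)) (by simp [det]))))).exists
  have hn' : (2 : ℤ) ≤ n := by exact_mod_cast hn
  -- three generic vectors that positively span the plane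
  set u : ℤ × ℤ := (n : ℤ) • (1, 0) + (0, 1) with hu
  set v : ℤ × ℤ := (n : ℤ) • (0, 1) + (-1, -1) with hv
  set w : ℤ × ℤ := (n : ℤ) • (-1, -1) + (1, 0) with hw
  have d1 : 0 < det u v := by simp [det, hu, hv]; nlinarith
  have d2 : 0 < det v w := by simp [det, hw, hv]; nlinarith
  have d3 : 0 < det w u := by simp [det, hu, hw]; nlinarith
  have e1 := hG.edgeLimit_sub e h1 h2 d1
  have e2 := hG.edgeLimit_sub e h2 h3 d2
  have e3 := hG.edgeLimit_sub e h3 h1 d3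
  have key : ∀ d : Bool, (if InCone u v (G.dir (e, d)) then G.jump (e, d) else 0) +
      (if InCone v w (G.dir (e, d)) then G.jump (e, d) else 0) +
      (if InCone w u (G.dir (e, d)) then G.jump (e, d) else 0) = G.jump (e, d) := by
    intro d
    have := congrArg (G.jump (e, d) * ·) (sum_inCone (x := G.dir (e, d)) d1 d2 d3
      (h1 _) (h2 _) (h3 _))
    simpa only [mul_add, mul_ite, mul_one, mul_zero] using this
  linear_combination -e1 - e2 - e3 - key true + key false

lemma jump_step (s : State E) : G.jump (G.step s) = G.jump s := by
  have : G.line (G.step s) = G.line s := funext fun s' ↦ G.step_line s s'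
  simp only [jump, linePotential, dir_step, this]

variable {G} in
lemma Consistent.jump_eq (hG : G.Consistent) (s s' : State E) : G.jump s = G.jump s' := by
  have h1 : ∀ p q, G.jump (p, true) = G.jump (q, true) := by
    refine G.eq_of_invariant (fun p ↦ ?_) (fun p ↦ ?_)
    · rw [hG.jump_true_eq_jump_false p, ← jump_step, step_true, rB_inv_rB]
    · rw [hG.jump_true_eq_jump_false p, ← jump_step _ (p, false), step_false]
  have h2 : ∀ s : State E, G.jump s = G.jump (s.1, true) := by
    rintro ⟨p, _ | _⟩
    · exact (hG.jump_true_eq_jump_false p).symm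
    · rfl
  rw [h2, h1 s.1 s'.1, ← h2]

end DimerModel

/-! ### The two sides of a zig-zag path -/

namespace DimerModel

/-- On a cylinder, `ℤ²` has finitely many rows modulo the circumference `v` and the height `t`. -/
lemma exists_finite_reps {v t : ℤ × ℤ} (h : 0 < det v t) :
    ∃ R : Set (ℤ × ℤ), R.Finite ∧ ∀ x, ∃ r ∈ R, ∃ k m : ℤ, x = r + m • t + k • v := by
  set N := det v t with hN
  refine ⟨(fun c : ℤ × ℤ ↦ ((c.1 * v.1 + c.2 * t.1) / N, (c.1 * v.2 + c.2 * t.2) / N)) ''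
    (Set.Ico 0 N ×ˢ Set.Ico 0 N), ((Set.finite_Ico _ _).prod (Set.finite_Ico _ _)).image _,
    fun x ↦ ?_⟩
  refine ⟨_, ⟨(det x t % N, det v x % N), ⟨⟨Int.emod_nonneg _ h.ne', Int.emod_lt_of_pos _ h⟩,
    ⟨Int.emod_nonneg _ h.ne', Int.emod_lt_of_pos _ h⟩⟩, rfl⟩, det x t / N, det v x / N, ?_⟩
  have h1 := Int.emod_add_mul_ediv (det x t) N
  have h2 := Int.emod_add_mul_ediv (det v x) N
  generalize det x t % N = a at *
  generalize det v x % N = b at *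
  generalize det x t / N = k at *
  generalize det v x / N = m at *
  have e1 : a * v.1 + b * t.1 = N * (x.1 - k * v.1 - m * t.1) := by
    have : N * x.1 = det x t * v.1 + det v x * t.1 := by simp only [hN, det]; ring
    linear_combination v.1 * h1 + t.1 * h2 - this
  have e2 : a * v.2 + b * t.2 = N * (x.2 - k * v.2 - m * t.2) := by
    have : N * x.2 = det x t * v.2 + det v x * t.2 := by simp only [hN, det]; ring
    linear_combination v.2 * h1 + t.2 * h2 - this
  simp only [e1, e2, Int.mul_ediv_cancel_left _ h.ne']
  ext
  · simp
  · simp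

/-- Summation by parts. -/
lemma finsum_smul_sub_eq_zero {E A M : Type*} [AddGroup A] [AddCommGroup M] {g : E × A → ℤ}
    (hg : g.support.Finite) (f : Equiv.Perm E) (c : E → A) (d : E → M)
    (hinv : ∀ e a, g (f e, a + c e) = g (e, a)) :
    ∑ᶠ y : E × A, g y • (d (f y.1) - d y.1) = 0 := by
  have hfin : ∀ d : E × A → M, (fun y ↦ g y • d y).support.Finite := fun d ↦
    hg.subset (Function.support_smul_subset_left g d)
  simp only [smul_sub]
  rw [finsum_sub_distrib (hfin _) (hfin _), sub_eq_zero]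
  rw [← finsum_comp_equiv (Equiv.prodShear f fun e ↦ Equiv.addRight (c e))
    (f := fun y : E × A ↦ g y • d y.1)]
  exact finsum_congr fun y ↦ by simp [hinv]

variable {B W E : Type*} (G : DimerModel B W E)

open Filter

/-- The displacement of a zig-zag path at a black node. -/
def disp (e : E) : ℤ × ℤ := G.shift e - G.shift (G.rotB⁻¹ e)

lemma zpow_step_fst_snd (s : State E) (n : ℕ) : ((G.step ^ (n : ℤ)) s).1.2 = s.1.2 +
    ∑ t ∈ Finset.range n, if ((G.step ^ (t : ℤ)) s).2 = true
      then G.disp ((G.step ^ (t : ℤ)) s).1.1 else 0 := by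
  induction n with
  | zero => simp
  | succ n ih =>
    rw [Finset.sum_range_succ, ← add_assoc, ← ih, Nat.cast_succ, zpow_step_succ]
    obtain ⟨p, _ | _⟩ := (G.step ^ (n : ℤ)) s
    · rw [step_false, rW_apply]
      simp
    · rw [step_true, rB_inv_apply]
      simp [disp, add_sub_assoc]

variable {G} in
/-- If the potential of a zig-zag path had the same value on both sides of the path, then it would
have finite support on the cylinder on which this path closes up, and Stokes' theorem would show
that the path is homologically trivial. -/
theorem Consistent.jump_ne_zero (hG : G.Consistent) (s₀ : State E) : G.jump s₀ ≠ 0 := by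
  classical
  intro hjump
  have := G.finite_edges
  set v := G.dir s₀ with hv
  set t : ℤ × ℤ := (-v.2, v.1) with ht
  have hdet : 0 < det v t := exists_det_ne_zero (hG.dir_ne_zero s₀)
  set l := limit (G.linePotential s₀) t with hl
  set σ : E × (ℤ × ℤ) → ℤ := fun x ↦ G.linePotential s₀ x - l with hσ
  have hpot : G.IsPotential (G.line s₀) σ := by
    have h := G.isPotential_linePotential s₀
    refine ⟨fun p ↦ ?_, fun p ↦ ?_⟩
    · simp only [hσ]
      linarith [h.black p]
    · simp only [hσ]
      linarith [h.white p]
  have hσv : ∀ e x (k : ℤ), σ (e, x + k • v) = σ (e, x) := fun e x k ↦ by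
    simp only [hσ]
    rw [← hG.linePotential_add s₀ k (e, x)]
  have hlim1 : HasLimit σ t 0 := by
    have := (G.hasLimit_linePotential (s₀ := s₀) (u := t)
      (by rw [det_comm]; exact (neg_neg_of_pos hdet).ne)).sub_const l
    rwa [sub_self] at this
  have hlim2 : HasLimit σ (-t) 0 := by
    have := (G.hasLimit_linePotential (s₀ := s₀) (u := -t)
      (by rw [det_comm, det_neg_right, neg_neg]; exact hdet.ne')).sub_const l
    have h0 : limit (G.linePotential s₀) (-t) - l = 0 := by
      rw [jump, ← hv, ← ht, ← hl] at hjump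
      linarith
    rwa [h0] at this
  -- everything descends to the cylinder
  let A := (ℤ × ℤ) ⧸ AddSubgroup.zmultiples v
  let π : ℤ × ℤ → A := fun x ↦ (x : A)
  let desc : (E × (ℤ × ℤ) → ℤ) → E × A → ℤ := fun f y ↦ f (y.1, y.2.out)
  have hdesc : ∀ f : E × (ℤ × ℤ) → ℤ, (∀ e x (k : ℤ), f (e, x + k • v) = f (e, x)) → ∀ e x,
      desc f (e, π x) = f (e, x) := by
    intro f hf e x
    obtain ⟨⟨_, k, rfl⟩, hk⟩ := QuotientAddGroup.mk_out_eq_add (AddSubgroup.zmultiples v) x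
    simp only at hk
    simp only [desc, π, hk]
    exact hf e x k
  have hline : ∀ b e x (k : ℤ), G.line s₀ ((e, x + k • v), b) = G.line s₀ ((e, x), b) :=
    fun b e x k ↦ G.line_tr_dir s₀ ((e, x), b) k
  set ν : E × (ℤ × ℤ) → ℤ := fun x ↦ σ x - G.line s₀ (x, true) with hν
  have hνv : ∀ e x (k : ℤ), ν (e, x + k • v) = ν (e, x) := fun e x k ↦ by
    simp only [hν, hσv, hline]
  have hσfin : (desc σ).support.Finite := by
    obtain ⟨R, hR, hR'⟩ := exists_finite_reps hdet
    have hfin : ∀ e r, {m : ℤ | σ (e, r + m • t) ≠ 0}.Finite := by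
      intro e r
      obtain ⟨n1, h1⟩ := eventually_atTop.1 (hlim1 (e, r))
      obtain ⟨n2, h2⟩ := eventually_atTop.1 (hlim2 (e, r))
      refine (Set.finite_Icc (-(n2 : ℤ)) n1).subset fun m hm ↦ ?_
      by_contra hc
      rw [Set.mem_Icc, not_and_or, not_le, not_le] at hc
      apply hm
      rcases hc with hc | hc
      · have := h2 (-m).toNat (by omega)
        rw [Int.toNat_of_nonneg (by omega)] at this
        simpa using this
      · have := h1 m.toNat (by omega)
        rw [Int.toNat_of_nonneg (by omega)] at this
        simpa using this
    refine (Set.finite_univ.biUnion (t := fun e ↦ ⋃ r ∈ R,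
      (fun m : ℤ ↦ ((e, π (r + m • t)) : E × A)) '' {m : ℤ | σ (e, r + m • t) ≠ 0}) fun e _ ↦
        hR.biUnion fun r _ ↦ (hfin e r).image _).subset ?_
    rintro ⟨e, a⟩ ha
    obtain ⟨x, rfl⟩ := QuotientAddGroup.mk_surjective a
    obtain ⟨r, hr, k, m, rfl⟩ := hR' x
    rw [Function.mem_support, hdesc σ hσv, hσv] at ha
    refine Set.mem_biUnion (Set.mem_univ e) (Set.mem_biUnion hr ⟨m, ha, ?_⟩)
    simp only [π, Prod.mk.injEq, true_and]
    rw [eq_comm, QuotientAddGroup.eq]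
    exact ⟨-k, by simp; abel⟩
  -- the zig-zag path passes exactly once through each of its states on the cylinder
  set P : Finset ℕ := {n ∈ Finset.range G.period | ((G.step ^ (n : ℤ)) s₀).2 = true} with hP
  set g : ℕ → E × A := fun n ↦ (((G.step ^ (n : ℤ)) s₀).1.1, π ((G.step ^ (n : ℤ)) s₀).1.2) with hg
  set γ : E × (ℤ × ℤ) → ℤ := fun x ↦ G.line s₀ (x, true) with hγ
  have hγv : ∀ e x (k : ℤ), γ (e, x + k • v) = γ (e, x) := hline true
  have hγsupp : (desc γ).support ⊆ P.image g := by
    rintro ⟨e, a⟩ ha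
    obtain ⟨x, rfl⟩ := QuotientAddGroup.mk_surjective a
    rw [Function.mem_support, hdesc γ hγv] at ha
    obtain ⟨r, hr, k, hk⟩ := G.exists_of_line_ne_zero ha
    have h1 := congrArg (fun s ↦ s.1.1) hk
    have h2 := congrArg (fun s ↦ s.1.2) hk
    have h3 := congrArg (fun s ↦ s.2) hk
    simp only [tr_fst_fst, tr_fst_snd, tr_snd] at h1 h2 h3
    refine Finset.mem_coe.2 (Finset.mem_image.2 ⟨r, Finset.mem_filter.2
      ⟨Finset.mem_range.2 hr, h3.symm⟩, ?_⟩)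
    simp only [hg, π, h1, Prod.mk.injEq, true_and]
    rw [QuotientAddGroup.eq]
    exact ⟨k, by simp [h2, hv]⟩
  have hginj : Set.InjOn g P := by
    intro n hn n' hn' h
    simp only [hP, Finset.coe_filter, Finset.mem_range, Set.mem_ofPred_eq] at hn hn'
    obtain ⟨h1, h⟩ := Prod.mk.inj h
    obtain ⟨k, hk⟩ := QuotientAddGroup.eq.1 h
    have h2 : (G.step ^ (n' : ℤ)) s₀ = (G.step ^ (n + G.period * k : ℤ)) s₀ := by
      rw [zpow_step_add, zpow_step_period_mul, zpow_step_tr]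
      refine Prod.ext (Prod.ext ?_ ?_) ?_
      · rw [tr_fst_fst, h1]
      · rw [tr_fst_snd, ← hv]
        simp only at hk
        rw [hk]
        abel
      · rw [tr_snd, hn.2, hn'.2]
    have h3 := hG.zpow_step_inj h2
    have hM : (0 : ℤ) < G.period := by exact_mod_cast G.period_pos
    have hk0 : k = 0 := by
      by_contra hk0
      rcases lt_or_gt_of_ne hk0 with hk0 | hk0
      · nlinarith
      · nlinarith
    rw [hk0] at h3
    omega
  have hγfin : (desc γ).support.Finite := (Finset.finite_toSet _).subset hγsupp
  have hνfin : (desc ν).support.Finite := by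
    refine (hσfin.union hγfin).subset fun y hy ↦ ?_
    by_contra hc
    simp only [Set.mem_union, Function.mem_support, not_or, not_not] at hc
    apply hy
    change desc σ y - desc γ y = 0
    rw [hc.1, hc.2, sub_zero]
  have hsupp : ∀ f : E × A → ℤ, (fun y : E × A ↦ f y • G.disp y.1).support ⊆ f.support :=
    fun f ↦ Function.support_smul_subset_left f fun y : E × A ↦ G.disp y.1
  have e1 : ∑ᶠ y : E × A, desc γ y • G.disp y.1 = v := by
    rw [finsum_eq_sum_of_support_subset (s := P.image g) _
      ((hsupp _).trans hγsupp),
      Finset.sum_image hginj]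
    have h1 := G.zpow_step_fst_snd s₀ G.period
    rw [zpow_step_period, tr_fst_snd, add_left_cancel_iff, ← Finset.sum_filter] at h1
    rw [hv, h1]
    refine Finset.sum_congr rfl fun n hn ↦ ?_
    have hn2 := (Finset.mem_filter.1 hn).2
    have : γ ((G.step ^ (n : ℤ)) s₀).1 = 1 := by
      simp only [hγ, line]
      rw [if_pos ⟨n, by rw [← hn2]⟩]
    simp only [hg]
    rw [hdesc γ hγv, this, one_smul]
  have e2 : ∑ᶠ y : E × A, desc σ y • G.disp y.1 = 0 := by
    rw [← finsum_smul_sub_eq_zero hσfin G.facePerm (fun e ↦ π (G.disp e)) G.faceOffset]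
    · simp only [faceOffset_facePerm, add_sub_cancel_left, disp]
    · intro e a
      obtain ⟨x, rfl⟩ := QuotientAddGroup.mk_surjective a
      change desc σ (_, π (x + G.disp e)) = desc σ (e, π x)
      rw [hdesc σ hσv, hdesc σ hσv, ← hpot.apply_rW_inv_rB_inv (G.isCocycle_line s₀) (e, x)]
      rw [rB_inv_apply, rW_inv_apply]
      simp only [disp, BicoloredRibbonGraph.facePerm, Equiv.Perm.mul_apply, add_sub_assoc]
  have e3 : ∑ᶠ y : E × A, desc ν y • G.disp y.1 = 0 := by
    rw [← finsum_smul_sub_eq_zero hνfin G.rotB⁻¹ (fun e ↦ π (G.disp e)) (fun e ↦ -G.shift e)]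
    · simp only [disp, neg_sub_neg]
    · intro e a
      obtain ⟨x, rfl⟩ := QuotientAddGroup.mk_surjective a
      change desc ν (_, π (x + G.disp e)) = desc ν (e, π x)
      rw [hdesc ν hνv, hdesc ν hνv]
      have := hpot.black (G.rB⁻¹ (e, x))
      rw [rB_rB_inv] at this
      simp only [hν]
      rw [this, rB_inv_apply]
      simp only [disp, add_sub_assoc]
  have e4 : ∑ᶠ y : E × A, desc γ y • G.disp y.1 =
      ∑ᶠ y : E × A, desc σ y • G.disp y.1 - ∑ᶠ y : E × A, desc ν y • G.disp y.1 := by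
    rw [← finsum_sub_distrib (hσfin.subset (hsupp _)) (hνfin.subset (hsupp _))]
    refine finsum_congr fun y ↦ ?_
    rw [← sub_smul]
    simp [desc, hν, hγ]
  rw [e1, e2, e3, sub_zero] at e4
  exact hG.dir_ne_zero s₀ e4

end DimerModel

/-! ### Bivalent nodes -/

lemma Equiv.Perm.sum_eq_of_apply_apply_eq {E N M : Type*} [Fintype E] [AddCommMonoid M]
    [DecidableEq N] {σ : Equiv.Perm E} {π : E → N} (h : ∀ e f, σ.SameCycle e f ↔ π e = π f)
    {e : E} (h2 : σ (σ e) = e) (h1 : σ e ≠ e) (g : E → M) :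
    ∑ f with π f = π e, g f = g e + g (σ e) := by
  classical
  rw [← Finset.sum_pair (f := g) h1.symm]
  refine Finset.sum_congr ?_ fun _ _ ↦ rfl
  ext f
  simp only [Finset.mem_filter, Finset.mem_univ, true_and, Finset.mem_insert,
    Finset.mem_singleton]
  rw [eq_comm, ← h]
  constructor
  · rintro ⟨i, rfl⟩
    exact Equiv.Perm.zpow_apply_eq_of_apply_apply_eq_self h2 i
  · rintro (rfl | rfl)
    · exact ⟨0, rfl⟩
    · exact ⟨1, rfl⟩

lemma Equiv.Perm.apply_ne_of_exists {E N : Type*} {σ : Equiv.Perm E} {π : E → N}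
    (h : ∀ e f, σ.SameCycle e f ↔ π e = π f) {e : E} (he : ∃ f, f ≠ e ∧ π f = π e) :
    σ e ≠ e := by
  intro h1
  obtain ⟨f, hne, hf⟩ := he
  obtain ⟨i, rfl⟩ := (h e f).2 hf.symm
  exact hne (Equiv.Perm.zpow_apply_eq_self_of_apply_eq_self h1 i)

namespace DimerModel

variable {B W E : Type*} (G : DimerModel B W E)

variable {G} in
lemma NoUnivalentNode.rotB_ne (hval : G.NoUnivalentNode) (e : E) : G.rotB e ≠ e :=
  Equiv.Perm.apply_ne_of_exists G.rotB_sameCycle_iff (hval.1 e)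

variable {G} in
lemma NoUnivalentNode.rotW_ne (hval : G.NoUnivalentNode) (e : E) : G.rotW e ≠ e :=
  Equiv.Perm.apply_ne_of_exists G.rotW_sameCycle_iff (hval.2 e)

variable {G} in
/-- If all nodes were bivalent, there would be as many nodes as edges, and no face. -/
lemma NoUnivalentNode.not_bivalent (hval : G.NoUnivalentNode)
    (h : ∀ e, G.rotB (G.rotB e) = e ∧ G.rotW (G.rotW e) = e) : False := by
  classical
  have := G.finite_edges
  have := G.finite_black
  have := G.finite_white
  have := Fintype.ofFinite E
  have := Fintype.ofFinite B
  have := Fintype.ofFinite W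
  have h1 : ∑ b : B, ∑ e with G.black e = b, 1 = ∑ b : B, 2 := Finset.sum_congr rfl fun b _ ↦ by
    obtain ⟨e, rfl⟩ := G.black_surjective b
    exact Equiv.Perm.sum_eq_of_apply_apply_eq G.rotB_sameCycle_iff (h e).1 (hval.rotB_ne e)
      fun _ ↦ 1
  have h2 : ∑ w : W, ∑ e with G.white e = w, 1 = ∑ w : W, 2 := Finset.sum_congr rfl fun w _ ↦ by
    obtain ⟨e, rfl⟩ := G.white_surjective w
    exact Equiv.Perm.sum_eq_of_apply_apply_eq G.rotW_sameCycle_iff (h e).2 (hval.rotW_ne e)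
      fun _ ↦ 1
  replace h1 := (Finset.sum_fiberwise Finset.univ G.black fun _ ↦ 1).symm.trans h1
  replace h2 := (Finset.sum_fiberwise Finset.univ G.white fun _ ↦ 1).symm.trans h2
  simp only [Finset.sum_const, Finset.card_univ, smul_eq_mul, mul_one] at h1 h2
  have h3 := G.card_nodes_lt
  simp only [Nat.card_eq_fintype_card] at h3
  omega

/-! ### Turns at bivalent nodes -/

/-- The same lifted edge with the opposite direction. -/
def flip (s : State E) : State E := (s.1, !s.2)

@[simp] lemma flip_flip (s : State E) : flip (flip s) = s := by simp [flip]

@[simp] lemma flip_fst (s : State E) : (flip s).1 = s.1 := rfl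

@[simp] lemma flip_snd (s : State E) : (flip s).2 = !s.2 := rfl

lemma flip_tr (x : ℤ × ℤ) (s : State E) : flip (tr x s) = tr x (flip s) := rfl

lemma eq_flip_iff (s s' : State E) : flip s = s' ↔ s = flip s' := by
  constructor
  · rintro rfl
    rw [flip_flip]
  · rintro rfl
    rw [flip_flip]

/-- After its step `s`, a zig-zag path turns at a node which is not bivalent: the zig-zag path that
walks along the next edge in the opposite direction does not follow it back. -/
def IsClean (s : State E) : Prop := G.step (flip (G.step s)) ≠ flip s

lemma isClean_flip_step (s : State E) : G.IsClean (flip (G.step s)) ↔ G.IsClean s := by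
  rw [IsClean, IsClean, not_iff_not, flip_flip]
  constructor
  · intro h
    have := G.step.injective h
    rwa [eq_flip_iff] at this
  · intro h
    rw [h, flip_flip]

lemma isClean_tr (x : ℤ × ℤ) (s : State E) : G.IsClean (tr x s) ↔ G.IsClean s := by
  simp only [IsClean, step_tr, flip_tr, ne_eq, (tr_injective x).eq_iff]

variable {G}

lemma rotB_rotB_eq {s : State E} (h : ¬ G.IsClean s) (hs : s.2 = true) :
    G.rotB (G.rotB s.1.1) = s.1.1 := by
  obtain ⟨⟨e, x⟩, δ⟩ := s
  subst hs
  have h1 := congrArg (fun s ↦ s.1.1) (not_not.1 h)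
  simp only [flip, step_true, Bool.not_false, rB_inv_apply] at h1
  exact ((Equiv.eq_symm_apply _).1 ((Equiv.eq_symm_apply _).1 h1.symm))

lemma rotW_rotW_eq {s : State E} (h : ¬ G.IsClean s) (hs : s.2 = false) :
    G.rotW (G.rotW s.1.1) = s.1.1 := by
  obtain ⟨⟨e, x⟩, δ⟩ := s
  subst hs
  have h1 := congrArg (fun s ↦ s.1.1) (not_not.1 h)
  simpa only [flip, step_false, Bool.not_true, rW_apply] using h1

/-- A zig-zag path cannot turn only at bivalent nodes: the graph would be a circle. -/
lemma NoUnivalentNode.exists_isClean (hval : G.NoUnivalentNode) (s : State E) :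
    ∃ n : ℕ, G.IsClean ((G.step ^ (n : ℤ)) s) := by
  by_contra! h
  have hM : (0 : ℤ) < G.period := by exact_mod_cast G.period_pos
  have h' : ∀ t : ℤ, ¬ G.IsClean ((G.step ^ t) s) := by
    intro t
    have h1 := h (t % G.period).toNat
    rw [Int.toNat_of_nonneg (Int.emod_nonneg _ hM.ne')] at h1
    rwa [← Int.emod_add_mul_ediv t G.period, zpow_step_add, zpow_step_period_mul, zpow_step_tr,
      isClean_tr]
  let X : E → Prop := fun e ↦ ∃ t : ℤ, ((G.step ^ t) s).1.1 = e
  have hB : ∀ e, X e → X (G.rotB e) ∧ G.rotB (G.rotB e) = e := by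
    rintro _ ⟨t, rfl⟩
    cases hb : ((G.step ^ t) s).2
    · have h1 : ((G.step ^ (t - 1)) s) = (G.rB ((G.step ^ t) s).1, true) := by
        rw [zpow_step_pred, ← step_inv_false, ← hb]
      have h2 := rotB_rotB_eq (h' (t - 1)) (by rw [h1])
      rw [h1, rB_apply] at h2
      exact ⟨⟨t - 1, by rw [h1, rB_apply]⟩, G.rotB.injective h2⟩
    · have h1 : ((G.step ^ (t + 1)) s) = (G.rB⁻¹ ((G.step ^ t) s).1, false) := by
        rw [zpow_step_succ, ← step_true, ← hb]
      have h2 := rotB_rotB_eq (h' t) hb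
      refine ⟨⟨t + 1, ?_⟩, h2⟩
      rw [h1, rB_inv_apply]
      exact (Equiv.symm_apply_eq _).2 h2.symm
  have hW : ∀ e, X e → X (G.rotW e) ∧ G.rotW (G.rotW e) = e := by
    rintro _ ⟨t, rfl⟩
    cases hb : ((G.step ^ t) s).2
    · have h1 : ((G.step ^ (t + 1)) s) = (G.rW ((G.step ^ t) s).1, true) := by
        rw [zpow_step_succ, ← step_false, ← hb]
      exact ⟨⟨t + 1, by rw [h1, rW_apply]⟩, rotW_rotW_eq (h' t) hb⟩
    · have h1 : ((G.step ^ (t - 1)) s) = (G.rW⁻¹ ((G.step ^ t) s).1, false) := by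
        rw [zpow_step_pred, ← step_inv_true, ← hb]
      have h2 := rotW_rotW_eq (h' (t - 1)) (by rw [h1])
      rw [h1, rW_inv_apply] at h2
      simp only [Equiv.Perm.inv_def, Equiv.apply_symm_apply] at h2
      have h3 := congrArg G.rotW h2
      rw [Equiv.apply_symm_apply] at h3
      refine ⟨⟨t - 1, ?_⟩, h3⟩
      rw [h1, rW_inv_apply]
      exact h2.symm
  have hall : ∀ e, X e := by
    have h1 := G.eq_of_invariant_edge (f := X)
      (fun e ↦ propext ⟨fun h ↦ by
        have := (hB _ h).2
        rw [← G.rotB.injective this]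
        exact (hB _ h).1, fun h ↦ (hB _ h).1⟩)
      (fun e ↦ propext ⟨fun h ↦ by
        have := (hW _ h).2
        rw [← G.rotW.injective this]
        exact (hW _ h).1, fun h ↦ (hW _ h).1⟩)
    intro e
    rw [h1 e s.1.1]
    exact ⟨0, by simp⟩
  exact hval.not_bivalent fun e ↦ ⟨(hB e (hall e)).2, (hW e (hall e)).2⟩

variable (G) in
/-- The number of consecutive bivalent nodes at which a zig-zag path turns after its step `s`. -/
noncomputable def len (s : State E) : ℕ := sInf {n | G.IsClean ((G.step ^ (n : ℤ)) s)}

lemma NoUnivalentNode.isClean_len (hval : G.NoUnivalentNode) (s : State E) :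
    G.IsClean ((G.step ^ (G.len s : ℤ)) s) := Nat.sInf_mem (hval.exists_isClean s)

lemma not_isClean_of_lt_len {s : State E} {n : ℕ} (h : n < G.len s) :
    ¬ G.IsClean ((G.step ^ (n : ℤ)) s) := Nat.notMem_of_lt_sInf h

lemma NoUnivalentNode.len_eq (hval : G.NoUnivalentNode) {s : State E} (h : ¬ G.IsClean s) :
    G.len s = G.len (G.step s) + 1 := by
  refine le_antisymm (Nat.sInf_le ?_) ?_
  · have := hval.isClean_len (G.step s)
    rw [zpow_step_step] at this
    exact this
  · by_contra hc
    have h1 := hval.isClean_len s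
    rcases hn : G.len s with _ | n
    · rw [hn] at h1
      exact h (by simpa using h1)
    · rw [hn, Nat.cast_succ, ← zpow_step_step] at h1
      exact not_isClean_of_lt_len (by omega) h1

lemma len_tr (x : ℤ × ℤ) (s : State E) : G.len (tr x s) = G.len s := by
  simp only [len, zpow_step_tr, isClean_tr]

lemma NoUnivalentNode.len_flip_step (hval : G.NoUnivalentNode) {s : State E}
    (h : ¬ G.IsClean s) : G.len (flip (G.step s)) = G.len (flip s) + 1 := by
  rw [hval.len_eq (mt (G.isClean_flip_step s).1 h), not_not.1 h]

/-- Along bivalent nodes, the zig-zag path in the opposite direction goes back. -/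
lemma zpow_neg_flip {s : State E} {n : ℕ} (h : ∀ i < n, ¬ G.IsClean ((G.step ^ (i : ℤ)) s)) :
    (G.step ^ (-n : ℤ)) (flip s) = flip ((G.step ^ (n : ℤ)) s) := by
  induction n with
  | zero => simp
  | succ n ih =>
    have h1 := not_not.1 (h n (Nat.lt_succ_self n))
    apply G.step.injective
    rw [← zpow_step_succ, Nat.cast_succ, zpow_step_succ _ _ s, h1,
      ← ih fun i hi ↦ h i (by omega)]
    congr 2
    ring

/-! ### Intersections -/

/-- A maximal sequence of an odd number of common edges is an intersection. -/
lemma intersectAt_pathOf {a c : State E} {i j : ℤ} {n : ℕ}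
    (h : (G.step ^ j) c = flip ((G.step ^ i) a)) (hn : Even n)
    (h1 : G.IsClean ((G.step ^ (i - 1)) a))
    (h2 : ∀ t < n, ¬ G.IsClean ((G.step ^ (i + t : ℤ)) a))
    (h3 : G.IsClean ((G.step ^ (i + n : ℤ)) a)) :
    (G.pathOf a).IntersectAt (G.pathOf c) i j n := by
  have key : ∀ t ≤ n, (G.step ^ (j - t : ℤ)) c = flip ((G.step ^ (i + t : ℤ)) a) := by
    intro t ht
    have := zpow_neg_flip (s := (G.step ^ i) a) (n := t) fun k hk ↦ by
      rw [← zpow_step_add, add_comm]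
      exact h2 k (by omega)
    rw [sub_eq_neg_add, zpow_step_add, h, this, ← zpow_step_add, add_comm]
  refine ⟨fun t ht ↦ ?_, fun h4 ↦ ?_, fun h4 ↦ ?_, hn⟩
  · change ((G.step ^ (i + t : ℤ)) a).1 = ((G.step ^ (j - t : ℤ)) c).1
    rw [key t ht, flip_fst]
  · change ((G.step ^ (i - 1)) a).1 = ((G.step ^ (j + 1)) c).1 at h4
    apply h1
    rw [← zpow_step_succ, sub_add_cancel, ← h, ← zpow_step_succ]
    refine Prod.ext h4.symm ?_
    rw [zpow_step_succ, h, step_snd, flip_snd, flip_snd, zpow_step_pred]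
    generalize (G.step ^ i) a = s
    have := G.step_snd (G.step⁻¹ s)
    rw [step_step_inv] at this
    rw [this, Bool.not_not]
  · change ((G.step ^ (i + n + 1)) a).1 = ((G.step ^ (j - n - 1)) c).1 at h4
    apply h3
    have h5 := key n le_rfl
    rw [← zpow_step_succ, ← h5]
    apply G.step⁻¹.injective
    rw [step_inv_step, ← zpow_step_pred]
    refine Prod.ext h4 ?_
    have h6 := G.step_snd ((G.step ^ (j - n - 1 : ℤ)) c)
    rw [← zpow_step_succ, sub_add_cancel, h5] at h6
    rw [flip_snd, zpow_step_succ, step_snd, ← flip_snd, h6, Bool.not_not]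

variable (G) in
/-- The zig-zag paths that walk along the edge of `s` in its two directions intersect at this edge.
-/
def IsCrossing (s : State E) : Prop := Even (G.len s + G.len (flip s))

lemma IsCrossing.flip {s : State E} (h : G.IsCrossing s) : G.IsCrossing (flip s) := by
  rwa [IsCrossing, flip_flip, add_comm]

lemma zpow_len_flip (s : State E) (k : ℕ) (hk : k ≤ G.len (flip s)) :
    (G.step ^ (-k : ℤ)) s = flip ((G.step ^ (k : ℤ)) (flip s)) := by
  have := zpow_neg_flip (G := G) (s := flip s) (n := k) fun i hi ↦ not_isClean_of_lt_len (by omega)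
  rwa [flip_flip] at this

lemma IsCrossing.intersectAt (hval : G.NoUnivalentNode) {s : State E} (h : G.IsCrossing s) :
    (G.pathOf s).IntersectAt (G.pathOf (DimerModel.flip s)) (-G.len (DimerModel.flip s))
      (G.len (DimerModel.flip s)) (G.len s + G.len (DimerModel.flip s)) := by
  set w := G.len (DimerModel.flip s) with hw
  have h0 : ∀ k ≤ w, _ := zpow_len_flip s
  refine intersectAt_pathOf ?_ h ?_ (fun t ht ↦ ?_) ?_
  · rw [h0 w le_rfl, flip_flip]
  · rw [← isClean_flip_step, ← zpow_step_succ, sub_add_cancel, h0 w le_rfl, flip_flip]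
    exact hval.isClean_len _
  · by_cases htw : t < w
    · obtain ⟨k, hk⟩ : ∃ k, w = t + 1 + k := ⟨w - (t + 1), by omega⟩
      have h1 : (-w + t : ℤ) = -(k + 1 : ℕ) := by rw [hk]; push_cast; ring
      rw [← isClean_flip_step, ← zpow_step_succ, h1]
      have h2 : (-(k + 1 : ℕ) + 1 : ℤ) = -k := by push_cast; ring
      rw [h2, h0 k (by omega), flip_flip]
      exact not_isClean_of_lt_len (by omega)
    · have h1 : (-w + t : ℤ) = (t - w : ℕ) := by omega
      rw [h1]
      exact not_isClean_of_lt_len (by omega)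
  · have h1 : (-w + (G.len s + w : ℕ) : ℤ) = G.len s := by push_cast; ring
    rw [h1]
    exact hval.isClean_len s

end DimerModel

/-! ### Rays that cross at their common start -/

namespace DimerModel

variable {B W E : Type*} {G : DimerModel B W E}

lemma zpow_step_pathOf_edge (s : State E) (k i : ℤ) :
    (G.pathOf ((G.step ^ k) s)).edge i = (G.pathOf s).edge (i + k) := by
  change ((G.step ^ i) ((G.step ^ k) s)).1 = ((G.step ^ (i + k)) s).1
  rw [zpow_step_add]

/-- The zig-zag path that walks along a crossing edge does not walk back along it. -/
lemma Consistent.zpow_ne_flip (hG : G.Consistent) (hval : G.NoUnivalentNode) {s : State E}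
    (h : G.IsCrossing s) (t : ℤ) : (G.step ^ t) s ≠ flip s := by
  intro ht
  set w := G.len (flip s) with hw
  have h1 : ((G.step ^ (-w : ℤ)) s).2 ≠ ((G.step ^ (w + t : ℤ)) s).2 := by
    rw [zpow_len_flip s w le_rfl, zpow_step_add, ht, flip_snd]
    simp
  refine hG.not_hasSelfIntersection (G.pathOf s) ⟨-w, w + t, G.len s + w, fun h2 ↦ ?_, h1, ?_⟩
  · rw [h2] at h1
    exact h1 rfl
  · have h2 := h.intersectAt hval
    rw [← ht] at h2
    simp only [ZigzagPath.IntersectAt, zpow_step_pathOf_edge] at h2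
    obtain ⟨a1, a2, a3, a4⟩ := h2
    rw [ht, ← hw] at a1 a2 a3 a4
    refine ⟨fun k hk ↦ ?_, fun h3 ↦ a2 ?_, fun h3 ↦ a3 ?_, a4⟩
    · rw [a1 k hk]
      congr 1
      ring
    · rw [h3]
      congr 1
      ring
    · rw [h3]
      congr 1
      ring

lemma Consistent.not_same (hG : G.Consistent) (hval : G.NoUnivalentNode) {s : State E}
    (h : G.IsCrossing s) : ¬ (G.pathOf s).Same (G.pathOf (flip s)) := by
  rintro ⟨k, hk⟩
  obtain ⟨h1, h2⟩ := hk 0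
  apply hG.zpow_ne_flip hval h k
  rw [zero_add] at h1 h2
  exact (Prod.ext h1 h2).symm

lemma intersectAt_add {s c : State E} {i j P P' : ℤ} {n : ℕ} {V : ℤ × ℤ}
    (hP : (G.step ^ P) s = tr V s) (hP' : (G.step ^ P') c = tr V c)
    (h : (G.pathOf s).IntersectAt (G.pathOf c) i j n) :
    (G.pathOf s).IntersectAt (G.pathOf c) (i + P) (j + P') n := by
  have e1 : ∀ t, (G.pathOf s).edge (t + P) = (tr V ((G.step ^ t) s)).1 := fun t ↦ by
    rw [← zpow_step_tr, ← hP, ← zpow_step_add]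
    rfl
  have e2 : ∀ t, (G.pathOf c).edge (t + P') = (tr V ((G.step ^ t) c)).1 := fun t ↦ by
    rw [← zpow_step_tr, ← hP', ← zpow_step_add]
    rfl
  have key : ∀ t t', (G.pathOf s).edge (t + P) = (G.pathOf c).edge (t' + P') ↔
      (G.pathOf s).edge t = (G.pathOf c).edge t' := fun t t' ↦ by
    rw [e1, e2]
    change _ ↔ ((G.step ^ t) s).1 = ((G.step ^ t') c).1
    simp [tr, Prod.ext_iff]
  obtain ⟨a1, a2, a3, a4⟩ := h
  refine ⟨fun t ht ↦ ?_, ?_, ?_, a4⟩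
  · rw [add_right_comm, add_sub_right_comm, key]
    exact a1 t ht
  · rw [add_right_comm j, add_sub_right_comm, ne_eq, key]
    exact a2
  · rw [add_right_comm i, add_right_comm _ P, add_sub_right_comm j, add_sub_right_comm _ P',
      ne_eq, key]
    exact a3

/-- The two zig-zag paths that walk along a crossing edge do not go in the same direction, as they
would cross again at a translate of this edge. -/
lemma Consistent.smul_dir_ne (hG : G.Consistent) (hval : G.NoUnivalentNode) {s : State E}
    (h : G.IsCrossing s) {a b : ℤ} (ha : 0 < a) (hb : 0 < b) :
    a • G.dir s ≠ b • G.dir (flip s) := by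
  intro hab
  have hM : (0 : ℤ) < G.period := by exact_mod_cast G.period_pos
  have h1 := h.intersectAt hval
  have h2 := intersectAt_add (G.zpow_step_period_mul a s)
    ((G.zpow_step_period_mul b (flip s)).trans (by rw [hab])) h1
  exact hG.not_intersectTwice _ _ (hG.not_same hval h)
    ⟨_, _, _, _, _, _, h1, h2, by nlinarith, by nlinarith⟩

/-- The value that the indicator function of a sector takes on the left of the edge of `s`, seen
from white to black, if the path that walks along this edge by the step `s` has the sector on its
left side and the complement on its right side. -/
def side (s : State E) : ℤ := if s.2 then 1 else 0

lemma side_step (s : State E) : side (G.step s) = 1 - side s := by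
  simp only [side, step_snd]
  cases s.2 <;> simp

lemma side_flip (s : State E) : side (flip s) = 1 - side s := by
  rcases s with ⟨p, _ | _⟩ <;> simp [side, flip]

variable (G) in
/-- The ray of `s` minus the ray of `flip s`. -/
noncomputable def pairCochain (s₀ s : State E) : ℤ := G.ray s₀ s - G.ray (flip s₀) s

lemma pairCochain_flip (s₀ s : State E) :
    G.pairCochain (flip s₀) s = -G.pairCochain s₀ s := by
  simp [pairCochain]

section

variable {s₀ : State E}

lemma Consistent.zpow_flip_ne (hG : G.Consistent) (hval : G.NoUnivalentNode)
    (hc : G.IsCrossing s₀) (t t' : ℤ) :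
    (G.step ^ t) (flip s₀) ≠ (G.step ^ t') s₀ := by
  intro h
  apply hG.zpow_ne_flip hval hc (-t + t')
  rw [zpow_step_add, ← h, ← zpow_step_add]
  simp

lemma Consistent.pairCochain_zpow (hG : G.Consistent) (hval : G.NoUnivalentNode)
    (hc : G.IsCrossing s₀) (k : ℕ) : G.pairCochain s₀ ((G.step ^ (k : ℤ)) s₀) = 1 := by
  rw [pairCochain, G.ray_eq_zero_of_line fun t ↦ hG.zpow_flip_ne hval hc t k, sub_zero, ray,
    if_pos ⟨k, rfl⟩]

/-- The interval of bivalent nodes between two clean turns of a ray is not an intersection with one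
of the two rays. -/
lemma Consistent.pairCochain_eq_zero (hG : G.Consistent) (hval : G.NoUnivalentNode)
    (hc : G.IsCrossing s₀) {r k : ℕ} (hrk : r < k) (hr : G.IsClean ((G.step ^ (r : ℤ)) s₀))
    (h : ∀ i, r < i → i < k → ¬ G.IsClean ((G.step ^ (i : ℤ)) s₀))
    (hk : G.IsClean ((G.step ^ (k : ℤ)) s₀)) (heven : Even (k - (r + 1))) :
    G.pairCochain s₀ (flip ((G.step ^ ((r + 1 : ℕ) : ℤ)) s₀)) = 0 := by
  classical
  have key : ∀ (c : State E) (m : ℤ), (G.step ^ m) c = flip ((G.step ^ ((r + 1 : ℕ) : ℤ)) s₀) →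
      (G.pathOf s₀).IntersectAt (G.pathOf c) (r + 1 : ℕ) m (k - (r + 1)) := by
    intro c m hm
    refine intersectAt_pathOf hm heven ?_ (fun t ht ↦ ?_) ?_
    · push_cast
      rwa [add_sub_cancel_right]
    · exact_mod_cast h (r + 1 + t) (by omega) (by omega)
    · have : ((r + 1 : ℕ) + (k - (r + 1) : ℕ) : ℤ) = k := by omega
      rwa [this]
  have h1 : G.ray s₀ (flip ((G.step ^ ((r + 1 : ℕ) : ℤ)) s₀)) = 0 := by
    rw [ray, if_neg]
    rintro ⟨m, hm⟩
    have h2 : ((G.step ^ ((r + 1 : ℕ) : ℤ)) s₀).2 ≠ ((G.step ^ (m : ℤ)) s₀).2 := by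
      rw [hm, flip_snd]
      simp
    refine hG.not_hasSelfIntersection (G.pathOf s₀) ⟨_, _, _, fun h3 ↦ ?_, h2, key _ _ hm⟩
    rw [h3] at h2
    exact h2 rfl
  have h2 : G.ray (flip s₀) (flip ((G.step ^ ((r + 1 : ℕ) : ℤ)) s₀)) = 0 := by
    rw [ray, if_neg]
    rintro ⟨m, hm⟩
    refine hG.not_intersectTwice _ _ (hG.not_same hval hc)
      ⟨_, _, _, _, _, _, hc.intersectAt hval, key _ _ hm, by omega, ?_⟩
    by_contra hlt
    rw [not_lt, Nat.cast_le] at hlt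
    have h3 := zpow_len_flip s₀ m hlt
    rw [hm, flip_flip] at h3
    have := hG.zpow_step_inj h3
    omega
  rw [pairCochain, h1, h2, sub_zero]

variable {σ : E × (ℤ × ℤ) → ℤ}

/-- The change of the potential along a ray. A turn keeps the face on its inner side, and
the values on the two faces at an edge of the ray differ by one, unless this ray or the
other ray also walks back along this edge. -/
lemma Consistent.apply_zpow_succ (hG : G.Consistent) (hval : G.NoUnivalentNode)
    (hc : G.IsCrossing s₀) (hσ : G.IsPotential (G.pairCochain s₀) σ) (k : ℕ) :
    σ ((G.step ^ ((k + 1 : ℕ) : ℤ)) s₀).1 = σ ((G.step ^ (k : ℤ)) s₀).1 -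
      (2 * side ((G.step ^ (k : ℤ)) s₀) - 1) *
        (1 - G.pairCochain s₀ (flip ((G.step ^ ((k + 1 : ℕ) : ℤ)) s₀))) := by
  have h := hG.pairCochain_zpow hval hc k
  rw [Nat.cast_succ, zpow_step_succ]
  generalize (G.step ^ (k : ℤ)) s₀ = s at h ⊢
  obtain ⟨p, _ | _⟩ := s
  · have h1 := hσ.white p
    simp only [step_false, flip, side, Bool.not_true, if_false, Bool.false_eq_true]
    rw [h] at h1
    linarith
  · have h1 := hσ.black (G.rB⁻¹ p)
    rw [rB_rB_inv, h] at h1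
    simp only [step_true, flip, side, Bool.not_false, if_true]
    linarith

lemma Consistent.pairCochain_step (hG : G.Consistent) {k : ℕ} (hval : G.NoUnivalentNode)
    (hc : G.IsCrossing s₀) (hk : ¬ G.IsClean ((G.step ^ (k : ℤ)) s₀)) :
    G.pairCochain s₀ (flip ((G.step ^ ((k + 1 : ℕ) : ℤ)) s₀)) =
      if k = 0 then 0 else G.pairCochain s₀ (flip ((G.step ^ (k : ℤ)) s₀)) := by
  classical
  have h1 := hG.ray_step s₀ (flip ((G.step ^ ((k + 1 : ℕ) : ℤ)) s₀))
  have h2 := hG.ray_step (flip s₀) (flip ((G.step ^ ((k + 1 : ℕ) : ℤ)) s₀))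
  rw [Nat.cast_succ, zpow_step_succ] at h1 h2
  rw [not_not.1 hk] at h1 h2
  rw [if_neg] at h1
  swap
  · rw [eq_flip_iff]
    exact hG.zpow_ne_flip hval hc k
  rw [Nat.cast_succ, zpow_step_succ]
  by_cases hk0 : k = 0
  · subst hk0
    have h3 := hG.pairCochain_zpow hval hc.flip 0
    simp only [Nat.cast_zero, zpow_zero, Equiv.Perm.coe_one, id_eq, if_true, pairCochain,
      flip_flip] at h1 h2 h3 ⊢
    linarith
  · rw [if_neg] at h2
    swap
    · rw [eq_flip_iff, flip_flip]
      exact hG.zpow_step_ne (by exact_mod_cast hk0) s₀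
    rw [if_neg hk0]
    simp only [pairCochain]
    linarith

/-- The values of the potential along a ray. Either the ray has turned only at bivalent nodes so
far; or its last clean turn came after step `r`, and then the value depends on how often the two
rays walk back along the bivalent nodes after that turn. -/
lemma Consistent.apply_zpow_cases (hG : G.Consistent) (hval : G.NoUnivalentNode)
    (hc : G.IsCrossing s₀) (hσ : G.IsPotential (G.pairCochain s₀) σ) (h0 : σ s₀.1 = side s₀)
    (k : ℕ) : (σ ((G.step ^ (k : ℤ)) s₀).1 = side ((G.step ^ (k : ℤ)) s₀) ∧
        (k ≠ 0 → G.pairCochain s₀ (flip ((G.step ^ (k : ℤ)) s₀)) = 0)) ∨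
      ∃ r < k, G.IsClean ((G.step ^ (r : ℤ)) s₀) ∧
        σ ((G.step ^ (r : ℤ)) s₀).1 = side ((G.step ^ (r : ℤ)) s₀) ∧
        (∀ i, r < i → i < k → ¬ G.IsClean ((G.step ^ (i : ℤ)) s₀)) ∧
        G.pairCochain s₀ (flip ((G.step ^ (k : ℤ)) s₀)) =
          G.pairCochain s₀ (flip ((G.step ^ ((r + 1 : ℕ) : ℤ)) s₀)) ∧
        ((Even (k - (r + 1)) ∧
            side ((G.step ^ (k : ℤ)) s₀) = 1 - side ((G.step ^ (r : ℤ)) s₀) ∧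
            σ ((G.step ^ (k : ℤ)) s₀).1 = side ((G.step ^ (k : ℤ)) s₀) +
              (2 * side ((G.step ^ (r : ℤ)) s₀) - 1) *
                G.pairCochain s₀ (flip ((G.step ^ ((r + 1 : ℕ) : ℤ)) s₀))) ∨
          (¬ Even (k - (r + 1)) ∧
            side ((G.step ^ (k : ℤ)) s₀) = side ((G.step ^ (r : ℤ)) s₀) ∧
            σ ((G.step ^ (k : ℤ)) s₀).1 = side ((G.step ^ (k : ℤ)) s₀))) := by
  induction k with
  | zero => exact Or.inl ⟨by simpa using h0, fun h ↦ absurd rfl h⟩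
  | succ k ih =>
    have hs := hG.apply_zpow_succ hval hc hσ k
    have hside : side ((G.step ^ ((k + 1 : ℕ) : ℤ)) s₀) = 1 - side ((G.step ^ (k : ℤ)) s₀) := by
      rw [Nat.cast_succ, zpow_step_succ, side_step]
    by_cases hk : G.IsClean ((G.step ^ (k : ℤ)) s₀)
    · have hkept : σ ((G.step ^ (k : ℤ)) s₀).1 = side ((G.step ^ (k : ℤ)) s₀) := by
        rcases ih with ih | ⟨r, hr, h1, -, h2, -, ⟨h3, -, h5⟩ | ⟨-, -, h5⟩⟩
        · exact ih.1
        · rw [h5, hG.pairCochain_eq_zero hval hc hr h1 h2 hk h3, mul_zero, add_zero]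
        · exact h5
      refine Or.inr ⟨k, Nat.lt_succ_self k, hk, hkept, fun i h1 h2 ↦ by omega, rfl,
        Or.inl ⟨by simp, hside, ?_⟩⟩
      rw [hs, hkept, hside]
      ring
    · have hq := hG.pairCochain_step hval hc hk
      rcases ih with ⟨h1, h2⟩ | ⟨r, hr, h1, h0, h2, h3, h4⟩
      · have hq0 : G.pairCochain s₀ (flip ((G.step ^ ((k + 1 : ℕ) : ℤ)) s₀)) = 0 := by
          rw [hq]
          split_ifs with hk0
          · rfl
          · exact h2 hk0
        refine Or.inl ⟨?_, fun _ ↦ hq0⟩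
        rw [hs, h1, hq0, hside]
        ring
      · rw [if_neg (by omega), h3] at hq
        rw [hq] at hs
        refine Or.inr ⟨r, by omega, h1, h0, fun i hi hi' ↦ ?_, hq, ?_⟩
        · rcases Nat.lt_succ_iff_lt_or_eq.1 hi' with hi' | rfl
          · exact h2 i hi hi'
          · exact hk
        · have hpar : k + 1 - (r + 1) = k - (r + 1) + 1 := by omega
          rw [hpar, Nat.even_add_one]
          rcases h4 with ⟨a1, a2, a3⟩ | ⟨a1, a2, a3⟩
          · refine Or.inr ⟨not_not.2 a1, by rw [hside, a2]; ring, ?_⟩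
            rw [hs, a3, hside, a2]
            ring
          · refine Or.inl ⟨a1, by rw [hside, a2], ?_⟩
            rw [hs, a3, hside, a2]
            ring

/-- Before a turn at a node which is not bivalent, the ray has the sector on its left side or the
complement on its right side, as at its start. -/
lemma Consistent.apply_eq_side (hG : G.Consistent) (hval : G.NoUnivalentNode)
    (hc : G.IsCrossing s₀) (hσ : G.IsPotential (G.pairCochain s₀) σ) (h0 : σ s₀.1 = side s₀)
    {k : ℕ} (hk : G.IsClean ((G.step ^ (k : ℤ)) s₀)) :
    σ ((G.step ^ (k : ℤ)) s₀).1 = side ((G.step ^ (k : ℤ)) s₀) := by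
  rcases hG.apply_zpow_cases hval hc hσ h0 k with
    h | ⟨r, hr, h1, -, h2, -, ⟨h3, -, h5⟩ | ⟨-, -, h5⟩⟩
  · exact h.1
  · rw [h5, hG.pairCochain_eq_zero hval hc hr h1 h2 hk h3, mul_zero, add_zero]
  · exact h5

lemma IsPotential.one_sub (hσ : G.IsPotential (G.pairCochain s₀) σ) :
    G.IsPotential (G.pairCochain (flip s₀)) fun x ↦ 1 - σ x := by
  refine ⟨fun p ↦ ?_, fun p ↦ ?_⟩
  · simp only [pairCochain_flip]
    linarith [hσ.black p]
  · simp only [pairCochain_flip]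
    linarith [hσ.white p]

lemma side_eq (s : State E) : side s = 0 ∨ side s = 1 := by
  rcases s with ⟨p, _ | _⟩ <;> simp [side]

lemma ray_eq (s s' : State E) : G.ray s s' = 0 ∨ G.ray s s' = 1 := by
  classical
  rw [ray]
  split_ifs <;> simp

/-- Along its two rays, the potential of a crossing edge takes the values zero and one only. The
value minus one or two could occur only where the two rays meet again with opposite directions, but
there the values prescribed by the two rays contradict each other. -/
lemma Consistent.apply_zpow_eq (hG : G.Consistent) (hval : G.NoUnivalentNode)
    (hc : G.IsCrossing s₀) (hσ : G.IsPotential (G.pairCochain s₀) σ) (h0 : σ s₀.1 = side s₀)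
    (k : ℕ) : σ ((G.step ^ (k : ℤ)) s₀).1 = 0 ∨ σ ((G.step ^ (k : ℤ)) s₀).1 = 1 := by
  rcases hG.apply_zpow_cases hval hc hσ h0 k with
    h | ⟨r, hr, h1, h2, -, -, ⟨-, h4, h5⟩ | ⟨-, -, h5⟩⟩
  · rw [h.1]
    exact side_eq _
  · have h6 := hG.apply_zpow_succ hval hc hσ r
    have h7 : side ((G.step ^ ((r + 1 : ℕ) : ℤ)) s₀) = 1 - side ((G.step ^ (r : ℤ)) s₀) := by
      rw [Nat.cast_succ, zpow_step_succ, side_step]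
    have h8 : G.ray (flip s₀) (flip ((G.step ^ ((r + 1 : ℕ) : ℤ)) s₀)) = 0 := by
      by_contra h9
      -- `apply_eq_side` for the other ray prescribes another value on the same face
      have h10 : ∃ m : ℕ, (G.step ^ (m : ℤ)) (flip s₀) =
          flip ((G.step ^ ((r + 1 : ℕ) : ℤ)) s₀) := by
        by_contra h10
        exact h9 (by rw [ray, if_neg h10])
      obtain ⟨m, hm⟩ := h10
      have h11 := hG.apply_eq_side hval hc.flip hσ.one_sub (by rw [flip_fst, h0, side_flip])
        (k := m) (by
          rw [hm, Nat.cast_succ, zpow_step_succ, isClean_flip_step]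
          exact h1)
      have h12 : G.ray s₀ (flip ((G.step ^ ((r + 1 : ℕ) : ℤ)) s₀)) = 0 := by
        rw [← hm]
        exact G.ray_eq_zero_of_line fun t ↦ (hG.zpow_flip_ne hval hc m t).symm
      have h13 := (G.ray_eq (flip s₀) (flip ((G.step ^ ((r + 1 : ℕ) : ℤ)) s₀))).resolve_left h9
      rw [hm, flip_fst, side_flip, h7, h6, h2, pairCochain, h12, h13] at h11
      rcases side_eq ((G.step ^ (r : ℤ)) s₀) with h14 | h14 <;> rw [h14] at h11 <;> omega
    rw [h5, h4, pairCochain, h8]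
    rcases side_eq ((G.step ^ (r : ℤ)) s₀) with h14 | h14 <;>
      rcases G.ray_eq s₀ (flip ((G.step ^ ((r + 1 : ℕ) : ℤ)) s₀)) with h15 | h15 <;>
      rw [h14, h15] <;> simp
  · rw [h5]
    exact side_eq _

end

lemma Consistent.isCocycle_pairCochain (hG : G.Consistent) (s₀ : State E) :
    G.IsCocycle (G.pairCochain s₀) := by
  intro p
  have h := hG.isCocycle_sectorCochain s₀.1 p
  obtain ⟨q, _ | _⟩ := s₀
  · simp only [pairCochain, sectorCochain, flip, Bool.not_false] at h ⊢
    linarith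
  · exact h

lemma IsPotential.apply_rB_step {Q : State E → ℤ} {σ : E × (ℤ × ℤ) → ℤ}
    (hσ : G.IsPotential Q σ) (hQ : G.IsCocycle Q) (s : State E) :
    σ (G.rB (G.step s).1) = σ s.1 := by
  obtain ⟨p, _ | _⟩ := s
  · rw [← hσ.apply_rW_inv_rB_inv hQ (G.rB _), rB_inv_rB, step_false, rW_inv_rW]
  · rw [step_true, rB_rB_inv]

/-- On both sides of a ray, the potential of a crossing edge is zero or one. -/
lemma Consistent.apply_rB_zpow_eq (hG : G.Consistent) (hval : G.NoUnivalentNode) {s₀ : State E}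
    (hc : G.IsCrossing s₀) {σ : E × (ℤ × ℤ) → ℤ} (hσ : G.IsPotential (G.pairCochain s₀) σ)
    (h0 : σ s₀.1 = side s₀) (k : ℕ) :
    σ (G.rB ((G.step ^ (k : ℤ)) s₀).1) = 0 ∨ σ (G.rB ((G.step ^ (k : ℤ)) s₀).1) = 1 := by
  classical
  rcases k with _ | k
  · have h1 := hσ.black s₀.1
    have h2 := hG.ray_step s₀ (G.rB s₀.1, true)
    have h3 := hG.ray_step (flip s₀) (G.rB s₀.1, true)
    have h4 := hG.pairCochain_zpow hval hc 0
    have h5 := hG.pairCochain_zpow hval hc.flip 0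
    rw [step_true, rB_inv_rB] at h2 h3
    obtain ⟨p, _ | _⟩ := s₀
    · simp only [pairCochain, flip, side, Nat.cast_zero, zpow_zero, Equiv.Perm.coe_one, id_eq,
        Bool.not_false, Bool.not_true, if_true, Bool.false_eq_true, if_false, Prod.mk.injEq,
        and_false] at *
      omega
    · simp only [pairCochain, flip, side, Nat.cast_zero, zpow_zero, Equiv.Perm.coe_one, id_eq,
        Bool.not_false, Bool.not_true, if_true, Bool.false_eq_true, if_false, Prod.mk.injEq,
        and_false] at *
      omega
  · rw [Nat.cast_succ, zpow_step_succ, hσ.apply_rB_step (hG.isCocycle_pairCochain s₀)]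
    exact hG.apply_zpow_eq hval hc hσ h0 k

/-- The potential of a crossing edge is the indicator function of its sector. -/
theorem Consistent.sectorB_eq (hG : G.Consistent) (hval : G.NoUnivalentNode)
    {e : E × (ℤ × ℤ)} (hc : G.IsCrossing (e, true)) (x : E × (ℤ × ℤ)) :
    G.sectorB e x = 0 ∨ G.sectorB e x = 1 := by
  have hσ : G.IsPotential (G.pairCochain (e, true)) (G.sectorB e) := hG.isPotential_sectorB e
  have hQ := hG.isCocycle_pairCochain (e, true)
  have h0 : G.sectorB e e = side (e, true) := by
    have := hG.pairCochain_zpow hval hc 0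
    simp only [Nat.cast_zero, zpow_zero, Equiv.Perm.coe_one, id_eq] at this
    simp only [sectorB, sub_sub_cancel]
    exact this
  set σ := G.sectorB e with hσdef
  have key : ∀ s, G.pairCochain (e, true) s ≠ 0 → (σ s.1 = 0 ∨ σ s.1 = 1) ∧
      (σ (G.rB s.1) = 0 ∨ σ (G.rB s.1) = 1) ∧
      (σ (G.step s).1 = 0 ∨ σ (G.step s).1 = 1) := by
    intro s hs
    have h1 : G.ray (e, true) s ≠ 0 ∨ G.ray (flip (e, true)) s ≠ 0 := by
      by_contra! h
      exact hs (by rw [pairCochain, h.1, h.2, sub_zero])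
    rcases h1 with h1 | h1
    · have h2 : ∃ m : ℕ, (G.step ^ (m : ℤ)) (e, true) = s := by
        by_contra h2
        exact h1 (by rw [ray, if_neg h2])
      obtain ⟨m, rfl⟩ := h2
      rw [← zpow_step_succ]
      exact ⟨hG.apply_zpow_eq hval hc hσ h0 m, hG.apply_rB_zpow_eq hval hc hσ h0 m,
        hG.apply_zpow_eq hval hc hσ h0 (m + 1)⟩
    · have h2 : ∃ m : ℕ, (G.step ^ (m : ℤ)) (flip (e, true)) = s := by
        by_contra h2
        exact h1 (by rw [ray, if_neg h2])
      obtain ⟨m, rfl⟩ := h2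
      rw [← zpow_step_succ]
      have h0' : 1 - σ (flip (e, true)).1 = side (flip (e, true)) := by
        rw [flip_fst, h0, side_flip]
      have e1 := hG.apply_zpow_eq hval hc.flip hσ.one_sub h0' m
      have e2 := hG.apply_rB_zpow_eq hval hc.flip hσ.one_sub h0' m
      have e3 := hG.apply_zpow_eq hval hc.flip hσ.one_sub h0' (m + 1)
      push_cast at e1 e2 e3
      refine ⟨?_, ?_, ?_⟩ <;> omega
  have hinv := G.eq_of_invariant (f := fun p ↦ σ p = 0 ∨ σ p = 1) (fun p ↦ propext ?_)
    (fun p ↦ propext ?_) x e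
  · rw [hinv, h0]
    exact side_eq _
  · by_cases h1 : G.pairCochain (e, true) (p, true) = 0
    · by_cases h2 : G.pairCochain (e, true) (G.rB p, true) = 0
      · have := hσ.black p
        rw [h1, h2, sub_zero, sub_zero] at this
        rw [this]
      · have := key _ h2
        rw [step_true, rB_inv_rB] at this
        exact iff_of_true this.1 this.2.2
    · have := key _ h1
      exact iff_of_true this.2.1 this.1
  · by_cases h1 : G.pairCochain (e, true) (p, false) = 0
    · by_cases h2 : G.pairCochain (e, true) (G.rW p, false) = 0
      · have := hσ.white p
        rw [h1, h2, add_zero, add_zero] at this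
        rw [this]
      · have h3 := key _ h2
        have h4 := hσ.apply_rB_step hQ (p, false)
        rw [step_false] at h4
        rw [h4] at h3
        exact iff_of_true h3.1 h3.2.1
    · have := key _ h1
      rw [step_false] at this
      exact iff_of_true this.2.2 this.1

end DimerModel

/-! ### The partner of an edge -/

namespace DimerModel

variable {B W E : Type*} {G : DimerModel B W E}

variable (G) in
/-- The zig-zag path turns at an odd number of consecutive bivalent nodes after its step `s`, and
the zig-zag path in the opposite direction turns at an even number of them. Then the edge of `s`
lies in a chain of an even number of edges, so this chain is not an intersection. -/
def IsOdd (s : State E) : Prop := Odd (G.len s) ∧ Even (G.len (flip s))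

lemma isOdd_tr (x : ℤ × ℤ) (s : State E) : G.IsOdd (tr x s) ↔ G.IsOdd s := by
  rw [IsOdd, flip_tr, len_tr, len_tr]
  rfl

lemma IsOdd.not_isClean {s : State E} (h : G.IsOdd s) : ¬ G.IsClean s := by
  have h1 := not_isClean_of_lt_len (G := G) (s := s) (n := 0) h.1.pos
  simpa using h1

lemma IsOdd.flip_step (hval : G.NoUnivalentNode) {s : State E} (h : G.IsOdd s) :
    G.IsOdd (flip (G.step s)) := by
  have h1 := hval.len_eq h.not_isClean
  have h2 := hval.len_flip_step h.not_isClean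
  obtain ⟨h3, h4⟩ := h
  rw [IsOdd, flip_flip, h2]
  rw [h1, Nat.odd_add_one, Nat.not_odd_iff_even] at h3
  exact ⟨h4.add_one, h3⟩

lemma IsOdd.rotB_rotB {e : E} (h : G.IsOdd ((e, 0), true)) : G.rotB (G.rotB e) = e :=
  rotB_rotB_eq h.not_isClean rfl

lemma IsOdd.rotW_rotW {e : E} (h : G.IsOdd ((e, 0), false)) : G.rotW (G.rotW e) = e :=
  rotW_rotW_eq h.not_isClean rfl

lemma flip_step_true {e : E} (h : G.rotB (G.rotB e) = e) :
    ∃ x, flip (G.step ((e, 0), true)) = tr x ((G.rotB e, 0), true) := by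
  refine ⟨G.shift e - G.shift (G.rotB⁻¹ e), ?_⟩
  have : G.rotB⁻¹ e = G.rotB e := (Equiv.symm_apply_eq _).2 h.symm
  simp [flip, tr, rB_inv_apply, this]

lemma flip_step_false (e : E) :
    flip (G.step ((e, 0), false)) = ((G.rotW e, 0), false) := rfl

lemma IsOdd.rotB (hval : G.NoUnivalentNode) {e : E} (h : G.IsOdd ((e, 0), true)) :
    G.IsOdd ((G.rotB e, 0), true) := by
  obtain ⟨x, hx⟩ := flip_step_true h.rotB_rotB
  rw [← isOdd_tr x, ← hx]
  exact h.flip_step hval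

lemma IsOdd.rotW (hval : G.NoUnivalentNode) {e : E} (h : G.IsOdd ((e, 0), false)) :
    G.IsOdd ((G.rotW e, 0), false) := h.flip_step hval

lemma isOdd_of_not_isCrossing {e : E} (h : ¬ G.IsCrossing ((e, 0), true))
    (h' : ¬ G.IsOdd ((e, 0), true)) : G.IsOdd ((e, 0), false) := by
  simp only [IsCrossing, IsOdd, flip, Bool.not_true, Bool.not_false] at *
  grind

open scoped Classical in
variable (G) in
/-- The partner of an edge: itself if it is crossing, and otherwise its neighbour in the chain of
edges through bivalent nodes. -/
noncomputable def partner (e : E) : E :=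
  if G.IsOdd ((e, 0), true) then G.rotB e else if G.IsOdd ((e, 0), false) then G.rotW e else e

lemma partner_of_isOdd_true {e : E} (h : G.IsOdd ((e, 0), true)) : G.partner e = G.rotB e :=
  if_pos h

lemma IsOdd.not_flip {s : State E} (h : G.IsOdd s) : ¬ G.IsOdd (DimerModel.flip s) := fun h' ↦
  Nat.not_odd_iff_even.2 h.2 h'.1

lemma partner_of_isOdd_false {e : E} (h : G.IsOdd ((e, 0), false)) : G.partner e = G.rotW e := by
  rw [partner, if_neg (show ¬ G.IsOdd ((e, 0), true) from h.not_flip), if_pos h]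

lemma partner_of_isCrossing {e : E} (h : G.IsCrossing ((e, 0), true)) : G.partner e = e := by
  have h1 : ¬ G.IsOdd ((e, 0), true) := fun h1 ↦ by
    have := h1.1
    have := h1.2
    simp only [IsCrossing] at h
    grind
  have h2 : ¬ G.IsOdd ((e, 0), false) := fun h1 ↦ by
    have := h1.1
    have := h1.2
    simp only [IsCrossing, flip, Bool.not_true, Bool.not_false] at h this
    grind
  rw [partner, if_neg h1, if_neg h2]

lemma edge_cases (e : E) : G.IsCrossing ((e, 0), true) ∨ G.IsOdd ((e, 0), true) ∨
    G.IsOdd ((e, 0), false) := by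
  by_contra! h
  exact h.2.2 (isOdd_of_not_isCrossing h.1 h.2.1)

lemma NoUnivalentNode.partner_partner (hval : G.NoUnivalentNode) :
    Function.Involutive G.partner := by
  intro e
  rcases edge_cases (G := G) e with h | h | h
  · rw [partner_of_isCrossing h, partner_of_isCrossing h]
  · rw [partner_of_isOdd_true h, partner_of_isOdd_true (h.rotB hval), h.rotB_rotB]
  · rw [partner_of_isOdd_false h, partner_of_isOdd_false (h.rotW hval), h.rotW_rotW]

lemma NoUnivalentNode.sum_partner [Fintype E] (hval : G.NoUnivalentNode) (f : E → ℤ) :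
    ∑ e, f (G.partner e) = ∑ e, f e :=
  Equiv.sum_comp hval.partner_partner.toPerm f

/-- At a bivalent node, a zig-zag path that walks along one of the edges in both directions also
walks along the other one in both directions, but in the opposite order. -/
lemma Consistent.ray_flip_sub (hG : G.Consistent) {s : State E} (h : ¬ G.IsClean s)
    (hne : flip (G.step s) ≠ s) :
    G.ray (G.step s) (flip (G.step s)) - G.ray (flip (G.step s)) (G.step s) =
      -(G.ray (flip s) s - G.ray s (flip s)) := by
  classical
  have h1 := hG.step_ray s (flip (G.step s))
  have h2 := hG.ray_step s (flip (G.step s))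
  have h3 := hG.ray_step (flip (G.step s)) s
  have h4 := hG.step_ray (flip (G.step s)) s
  rw [if_neg hne] at h1
  have e1 : flip s ≠ s := fun h ↦ by simpa [flip] using congrArg Prod.snd h
  have e2 : G.step s ≠ flip (G.step s) := fun h ↦ by
    have := congrArg Prod.snd h
    rw [flip_snd] at this
    cases h : (G.step s).2 <;> simp [h] at this
  rw [not_not.1 h] at h2 h4
  rw [if_neg e1] at h2
  rw [if_neg e2] at h3
  rw [if_neg hne.symm] at h4
  linarith

lemma Consistent.sectorDefect_partner (hG : G.Consistent) (hval : G.NoUnivalentNode) (e : E) :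
    G.sectorDefect (G.partner e, 0) = -G.sectorDefect (e, 0) := by
  rcases edge_cases (G := G) e with h | h | h
  · have h1 : G.sectorDefect (e, 0) = 0 := by
      rw [sectorDefect, G.ray_eq_zero_of_line, G.ray_eq_zero_of_line, sub_zero]
      · exact hG.zpow_ne_flip hval h
      · exact hG.zpow_ne_flip hval h.flip
    rw [partner_of_isCrossing h, h1, neg_zero]
  · obtain ⟨x, hx⟩ := flip_step_true h.rotB_rotB
    have hx' := (eq_flip_iff _ _).1 hx
    have h1 := hG.ray_flip_sub h.not_isClean fun h1 ↦ by
      rw [hx] at h1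
      exact hval.rotB_ne e (congrArg (fun s ↦ s.1.1) h1)
    rw [hx, hx', flip_tr, ray_tr, ray_tr] at h1
    rw [partner_of_isOdd_true h]
    exact h1
  · have h1 := hG.ray_flip_sub h.not_isClean fun h1 ↦
      hval.rotW_ne e (congrArg (fun s ↦ s.1.1) h1)
    rw [flip_step_false, step_false] at h1
    rw [partner_of_isOdd_false h]
    simp only [sectorDefect]
    simp only [flip, Bool.not_false] at h1
    have e1 : G.rW (e, 0) = (G.rotW e, 0) := rfl
    rw [e1] at h1
    linarith

lemma Consistent.exists_generic (hG : G.Consistent) : ∃ u, G.Generic u :=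
  let ⟨_, h⟩ := (hG.eventually_generic (a := (1, 0)) (b := (0, 1)) (by simp [det])).exists
  ⟨_, h⟩

variable [Fintype E]

lemma Consistent.sum_sectorDefect (hG : G.Consistent) (hval : G.NoUnivalentNode) :
    ∑ e, G.sectorDefect (e, 0) = 0 := by
  have h := hval.sum_partner fun e ↦ G.sectorDefect (e, 0)
  simp only [hG.sectorDefect_partner hval, Finset.sum_neg_distrib] at h
  linarith

lemma Consistent.edgeLimit_partner (hG : G.Consistent) (hval : G.NoUnivalentNode) {e : E}
    (h : ¬ G.IsCrossing ((e, 0), true)) {u : ℤ × ℤ} (hu : G.Generic u) :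
    G.edgeLimit e u + G.edgeLimit (G.partner e) u = 1 := by
  classical
  have hd := hG.sectorDefect_partner hval e
  rcases (edge_cases (G := G) e).resolve_left h with h | h
  · rw [partner_of_isOdd_true h, ← hG.sum_edgeLimit_black hu (G.black e)]
    exact (Equiv.Perm.sum_eq_of_apply_apply_eq G.rotB_sameCycle_iff h.rotB_rotB
      (hval.rotB_ne e) fun f ↦ G.edgeLimit f u).symm
  · rw [partner_of_isOdd_false h] at hd ⊢
    have h1 := (Equiv.Perm.sum_eq_of_apply_apply_eq G.rotW_sameCycle_iff h.rotW_rotW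
      (hval.rotW_ne e) fun f ↦ G.edgeLimit f u + G.sectorDefect (f, 0)).symm.trans
      (hG.sum_edgeLimit_white hu (G.white e))
    linarith

/-- Without a crossing edge, the sums of the limits over the black and the white nodes would show
that there are as many nodes as edges. -/
lemma Consistent.exists_isCrossing (hG : G.Consistent) (hval : G.NoUnivalentNode) :
    ∃ e : E, G.IsCrossing ((e, 0), true) := by
  classical
  by_contra! h
  obtain ⟨u, hu⟩ := hG.exists_generic
  have := G.finite_black
  have := G.finite_white
  have := Fintype.ofFinite B
  have := Fintype.ofFinite W
  have h1 : ∑ e, G.edgeLimit e u = Fintype.card B := by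
    rw [← Finset.sum_fiberwise Finset.univ G.black]
    simp [hG.sum_edgeLimit_black hu]
  have h2 : ∑ e, (G.edgeLimit e u + G.sectorDefect (e, 0)) = Fintype.card W := by
    rw [← Finset.sum_fiberwise Finset.univ G.white]
    simp [hG.sum_edgeLimit_white hu]
  have h3 : ∑ e, (G.edgeLimit e u + G.edgeLimit (G.partner e) u) = Fintype.card E := by
    simp [hG.edgeLimit_partner hval (h _) hu]
  rw [Finset.sum_add_distrib, hG.sum_sectorDefect hval, h1] at h2
  rw [Finset.sum_add_distrib, hval.sum_partner fun e ↦ G.edgeLimit e u, h1] at h3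
  have h4 := G.card_nodes_lt
  simp only [Nat.card_eq_fintype_card] at h4
  omega

end DimerModel

/-! ### The range of the limits -/

namespace DimerModel

lemma det_plucker (u u' w x : ℤ × ℤ) :
    det u w * det u' x = det u' w * det u x + det u u' * det w x := by
  simp only [det]
  ring

variable {B W E : Type*} {G : DimerModel B W E}

open Filter

lemma Consistent.edgeLimit_eq (hG : G.Consistent) (hval : G.NoUnivalentNode) {e : E}
    (hc : G.IsCrossing ((e, 0), true)) {u : ℤ × ℤ} (hu : G.Generic u) :
    G.edgeLimit e u = 0 ∨ G.edgeLimit e u = 1 := by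
  obtain ⟨m, hm⟩ := (hG.hasLimit_sectorB hu (e, 0) (e, 0)).exists
  simp only at hm
  rw [← hm]
  exact hG.sectorB_eq hval hc _

/-- The limit of the sector of a crossing edge changes at its first ray, since the second ray goes
in another direction. -/
lemma Consistent.exists_edgeLimit_sub (hG : G.Consistent) (hval : G.NoUnivalentNode) {e : E}
    (hc : G.IsCrossing ((e, 0), true)) : ∃ u u', G.Generic u ∧ G.Generic u' ∧
      G.edgeLimit e u' - G.edgeLimit e u = G.jump ((e, 0), true) := by
  classical
  set v := G.dir ((e, 0), true) with hv
  set w := G.dir ((e, 0), false) with hw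
  set t : ℤ × ℤ := (-v.2, v.1) with ht
  have hvt : 0 < det v t := exists_det_ne_zero (hG.dir_ne_zero _)
  -- for large `n`, the cone between `n • v - t` and `n • v + t` is a thin neighbourhood of `v`
  obtain ⟨n, ⟨hn1, hn2⟩, h1, h2⟩ := (((eventually_ge_atTop 1).and
    (eventually_ge_atTop (det w t).natAbs)).and ((hG.eventually_generic (a := v) (b := -t)
      (by rw [det_neg_right]; exact neg_ne_zero.2 hvt.ne')).and
    (hG.eventually_generic (a := v) (b := t) hvt.ne'))).exists
  have hn1' : (1 : ℤ) ≤ n := by exact_mod_cast hn1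
  have htv : det t v = -det v t := det_comm _ _
  have hD : 0 < det ((n : ℤ) • v + -t) ((n : ℤ) • v + t) := by
    simp only [det_add_left, det_add_right, det_smul_left, det_smul_right, det_neg_left, det_self,
      htv]
    nlinarith
  refine ⟨_, _, h1, h2, ?_⟩
  rw [hG.edgeLimit_sub (e, 0) h1 h2 hD, if_pos, if_neg, sub_zero]
  · rintro ⟨h3, h4⟩
    rw [← hw] at h3 h4
    have hwv : det w v = -det v w := det_comm _ _
    have htw : det t w = -det w t := det_comm _ _
    simp only [det_add_left, det_add_right, det_smul_left, det_smul_right, det_neg_left, hwv,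
      htw] at h3 h4
    have hwt : 0 < det w t := by linarith
    rcases lt_trichotomy (det v w) 0 with h5 | h5 | h5
    · nlinarith [show det w t ≤ n by omega]
    · refine hG.smul_dir_ne hval hc (a := det w t) (b := det v t) hwt hvt ?_
      have e1 : det v t * w.1 = det w t * v.1 + det v w * t.1 := by simp only [det]; ring
      have e2 : det v t * w.2 = det w t * v.2 + det v w * t.2 := by simp only [det]; ring
      rw [h5, zero_mul, add_zero] at e1 e2
      exact Prod.ext e1.symm e2.symm
    · nlinarith [show det w t ≤ n by omega]
  · rw [InCone, ← hv]
    simp only [det_add_left, det_add_right, det_smul_left, det_smul_right, det_neg_left, det_self,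
      htv]
    constructor <;> linarith

lemma Consistent.abs_jump_le (hG : G.Consistent) (hval : G.NoUnivalentNode) (s : State E) :
    |G.jump s| ≤ 1 := by
  have := G.finite_edges
  have := Fintype.ofFinite E
  obtain ⟨e, hc⟩ := hG.exists_isCrossing hval
  obtain ⟨u, u', hu, hu', h⟩ := hG.exists_edgeLimit_sub hval hc
  rw [hG.jump_eq s ((e, 0), true), ← h, abs_le]
  have h1 := hG.edgeLimit_eq hval hc hu
  have h2 := hG.edgeLimit_eq hval hc hu'
  omega

/-- The limits of the potential of a sector differ by at most one, because the two rays contribute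
jumps of opposite signs. -/
lemma Consistent.abs_edgeLimit_sub_le (hG : G.Consistent) (hval : G.NoUnivalentNode) (e : E)
    {u u' : ℤ × ℤ} (hu : G.Generic u) (hu' : G.Generic u') :
    |G.edgeLimit e u' - G.edgeLimit e u| ≤ 1 := by
  classical
  set c := G.jump ((e, 0), true) with hcdef
  have hc : |c| ≤ 1 := hG.abs_jump_le hval _
  set v := G.dir ((e, 0), true) with hv
  set w := G.dir ((e, 0), false) with hw
  have key : ∀ {u u' : ℤ × ℤ}, G.Generic u → G.Generic u' → 0 < det u u' →
      G.edgeLimit e u' - G.edgeLimit e u =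
        (if InCone u u' v then c else 0) - (if InCone u u' w then c else 0) := by
    intro u u' hu hu' hD
    rw [hG.edgeLimit_sub (e, 0) hu hu' hD, hG.jump_eq ((e, 0), false) ((e, 0), true)]
  rw [abs_le] at hc
  rw [abs_le]
  rcases lt_trichotomy (det u u') 0 with h | h | h
  · have := key hu' hu (by rw [det_comm]; omega)
    split_ifs at this <;> omega
  · -- `u` and `u'` are parallel: compare both of them with a third direction `x`
    obtain ⟨e₀⟩ := G.nonempty_edges
    have hu0 : u ≠ 0 := fun h0 ↦ hu ((e₀, 0), true) (by simp [h0, det])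
    have hpos := exists_det_ne_zero hu0
    obtain ⟨n, hx⟩ := (hG.eventually_generic hpos.ne').exists
    set x := (n : ℤ) • u + (-u.2, u.1) with hxdef
    have hux : 0 < det u x := by
      rw [hxdef, det_add_right, det_smul_right, det_self, mul_zero, zero_add]
      exact hpos
    have hpl : ∀ y, det u x * det u' y = det u' x * det u y := fun y ↦ by
      rw [det_plucker, h, zero_mul, add_zero]
    have h1 := key hu hx hux
    rcases lt_trichotomy (det u' x) 0 with h2 | h2 | h2
    · have h3 := key hx hu' (by rw [det_comm]; omega)
      have hdisj : ∀ y, InCone u x y → ¬ InCone x u' y := fun y h4 h5 ↦ by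
        have a1 := h4.2
        have a2 := h5.1
        rw [det_comm] at a2
        omega
      have d1 := hdisj v
      have d2 := hdisj w
      split_ifs at h1 h3 <;> first | omega | (exfalso; tauto)
    · exfalso
      have h3 := hpl (G.dir ((e₀, 0), true))
      rw [h2, zero_mul] at h3
      exact hu' _ ((mul_eq_zero.1 h3).resolve_left hux.ne')
    · have h3 := key hu' hx h2
      have hsame : ∀ y, InCone u x y ↔ InCone u' x y := fun y ↦ by
        have h4 := hpl y
        refine and_congr_left fun _ ↦ ⟨fun h5 ↦ ?_, fun h5 ↦ ?_⟩
        · exact pos_of_mul_pos_right (h4 ▸ mul_pos h2 h5) hux.le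
        · exact pos_of_mul_pos_right (h4 ▸ mul_pos hux h5) h2.le
      simp only [hsame] at h1
      omega
  · have := key hu hu' h
    split_ifs at this <;> omega

/-- The minimum of the limits of the potential of a sector. -/
lemma Consistent.exists_minLimit (hG : G.Consistent) (hval : G.NoUnivalentNode) (e : E) :
    ∃ k, (∀ u, G.Generic u → G.edgeLimit e u = k ∨ G.edgeLimit e u = k + 1) ∧
      ∃ u, G.Generic u ∧ G.edgeLimit e u = k := by
  obtain ⟨u, hu⟩ := hG.exists_generic
  by_cases h : ∃ u', G.Generic u' ∧ G.edgeLimit e u' < G.edgeLimit e u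
  · obtain ⟨u', hu', h⟩ := h
    refine ⟨_, fun u'' hu'' ↦ ?_, u', hu', rfl⟩
    have h1 := abs_le.1 (hG.abs_edgeLimit_sub_le hval e hu hu'')
    have h2 := abs_le.1 (hG.abs_edgeLimit_sub_le hval e hu' hu'')
    omega
  · push Not at h
    refine ⟨_, fun u'' hu'' ↦ ?_, u, hu, rfl⟩
    have h1 := abs_le.1 (hG.abs_edgeLimit_sub_le hval e hu hu'')
    have h2 := h u'' hu''
    omega

open scoped Classical in
variable (G) in
/-- The minimum of the limits of the potential of the sector of `e`. -/
noncomputable def minLimit (e : E) : ℤ :=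
  if h : ∃ k, (∀ u, G.Generic u → G.edgeLimit e u = k ∨ G.edgeLimit e u = k + 1) ∧
      ∃ u, G.Generic u ∧ G.edgeLimit e u = k then h.choose else 0

lemma Consistent.minLimit_spec (hG : G.Consistent) (hval : G.NoUnivalentNode) (e : E) :
    (∀ u, G.Generic u → G.edgeLimit e u = G.minLimit e ∨ G.edgeLimit e u = G.minLimit e + 1) ∧
      ∃ u, G.Generic u ∧ G.edgeLimit e u = G.minLimit e := by
  rw [minLimit, dif_pos (hG.exists_minLimit hval e)]
  exact (hG.exists_minLimit hval e).choose_spec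

variable (G) in
/-- The potential of the sector of `e` has the same limit in all directions. -/
def HasConstantLimit (e : E) : Prop := ∀ u, G.Generic u → G.edgeLimit e u = G.minLimit e

lemma Consistent.minLimit_of_isCrossing (hG : G.Consistent) (hval : G.NoUnivalentNode) {e : E}
    (hc : G.IsCrossing ((e, 0), true)) : G.minLimit e = 0 ∧ ¬ G.HasConstantLimit e := by
  obtain ⟨u, u', hu, hu', h⟩ := hG.exists_edgeLimit_sub hval hc
  have h0 := hG.jump_ne_zero ((e, 0), true)
  have h1 := hG.edgeLimit_eq hval hc hu
  have h2 := hG.edgeLimit_eq hval hc hu'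
  have h3 := (hG.minLimit_spec hval e).1 u hu
  have h4 := (hG.minLimit_spec hval e).1 u' hu'
  refine ⟨by omega, fun hconst ↦ ?_⟩
  have h5 := hconst u hu
  have h6 := hconst u' hu'
  omega

open scoped Classical in
lemma Consistent.minLimit_add_partner (hG : G.Consistent) (hval : G.NoUnivalentNode) (e : E) :
    G.minLimit e + G.minLimit (G.partner e) = if G.HasConstantLimit e then 1 else 0 := by
  have := G.finite_edges
  have := Fintype.ofFinite E
  by_cases hc : G.IsCrossing ((e, 0), true)
  · have h1 := hG.minLimit_of_isCrossing hval hc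
    rw [partner_of_isCrossing hc, if_neg h1.2, h1.1, add_zero]
  · have h := fun u hu ↦ hG.edgeLimit_partner hval hc (u := u) hu
    obtain ⟨h1, u, hu, h2⟩ := hG.minLimit_spec hval e
    obtain ⟨h3, u', hu', h4⟩ := hG.minLimit_spec hval (G.partner e)
    split_ifs with hconst
    · have := h u' hu'
      have := hconst u' hu'
      omega
    · simp only [HasConstantLimit] at hconst
      push Not at hconst
      obtain ⟨x, hx, hx'⟩ := hconst
      have := h u hu
      have := h x hx
      have := h1 x hx
      have := h3 u hu
      have := h3 x hx
      omega

end DimerModel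

/-! ### The minima of the limits at a node -/

/-- Let `π` send the edges of a graph to their ends of one color, each of valence at least two. For
every `u ∈ U`, let `a u` be nonnegative integral weights of the edges, such that the total weight `1
- ∑ k` at a node does not depend on `u`, and let `β` be the indicator function of a set of edges
that contains all edges whose weights all vanish. Then `∑ (β - 2 * k)` is nonnegative at each node:
if the total weight at a node vanishes, then `β = 1` on the two or more edges there. Hence, if the
sum over all edges vanishes, it vanishes at each node. So a node with an edge outside of the support
of `β` has total weight one, and none of its edges lies in the support of `β`. -/
lemma sum_fiber_eq_zero {E N ι : Type*} [Fintype E] [Fintype N] [DecidableEq N] {π : E → N}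
    (hval : ∀ e, ∃ f, f ≠ e ∧ π f = π e) {U : Set ι} (hU : U.Nonempty) {a : ι → E → ℤ}
    {k β : E → ℤ} (h1 : ∀ u ∈ U, ∀ n, ∑ e with π e = n, a u e = 1 - ∑ e with π e = n, k e)
    (h2 : ∀ u ∈ U, ∀ e, 0 ≤ a u e) (h3 : ∀ e, β e = 0 ∨ β e = 1)
    (h4 : ∀ e, (∀ u ∈ U, a u e = 0) → β e = 1) (h5 : ∑ e, (β e - 2 * k e) = 0)
    {e : E} (he : β e = 0) :
    ∑ f with π f = π e, k f = 0 ∧ ∀ f, π f = π e → β f = 0 := by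
  have hβ : ∀ n, 0 ≤ ∑ e with π e = n, β e := fun n ↦
    Finset.sum_nonneg fun e _ ↦ by rcases h3 e with h | h <;> omega
  have hN : ∀ n, 0 ≤ 1 - ∑ e with π e = n, k e := fun n ↦ by
    obtain ⟨u, hu⟩ := hU
    rw [← h1 u hu]
    exact Finset.sum_nonneg fun e _ ↦ h2 u hu e
  have hzero : ∀ n, 1 - ∑ e with π e = n, k e = 0 → ∀ e, π e = n → β e = 1 := by
    intro n hn e hen
    refine h4 e fun u hu ↦ ?_
    have h := h1 u hu n
    rw [hn, Finset.sum_eq_zero_iff_of_nonneg fun e _ ↦ h2 u hu e] at h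
    exact h e (by simp [hen])
  have hg : ∀ n, 0 ≤ ∑ e with π e = n, (β e - 2 * k e) := by
    intro n
    rw [Finset.sum_sub_distrib, ← Finset.mul_sum]
    by_cases hn : 1 - ∑ e with π e = n, k e = 0
    · by_cases hne : ∃ e, π e = n
      · obtain ⟨e, rfl⟩ := hne
        obtain ⟨f, hf, hfe⟩ := hval e
        have h6 : β f + β e ≤ ∑ g with π g = π e, β g := by
          classical
          rw [← Finset.sum_pair hf]
          refine Finset.sum_le_sum_of_subset_of_nonneg ?_ fun g _ _ ↦ ?_
          · intro g hg
            rcases Finset.mem_insert.1 hg with rfl | hg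
            · simp [hfe]
            · simp [Finset.mem_singleton.1 hg]
          · rcases h3 g with h | h <;> omega
        rw [hzero _ hn f hfe, hzero _ hn e rfl] at h6
        omega
      · push Not at hne
        simp [hne]
    · have := hN n
      have := hβ n
      omega
  have hg0 : ∀ n, ∑ e with π e = n, (β e - 2 * k e) = 0 := by
    rw [← Finset.sum_fiberwise Finset.univ π, Finset.sum_eq_zero_iff_of_nonneg fun n _ ↦ hg n] at h5
    exact fun n ↦ h5 n (Finset.mem_univ n)
  have h6 := hg0 (π e)
  have h7 : 1 - ∑ f with π f = π e, k f ≠ 0 := fun h ↦ by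
    rw [hzero _ h e rfl] at he
    omega
  have h8 := hN (π e)
  have h9 := hβ (π e)
  rw [Finset.sum_sub_distrib, ← Finset.mul_sum] at h6
  have h10 : ∑ f with π f = π e, β f = 0 := by omega
  refine ⟨by omega, fun f hf ↦ ?_⟩
  rw [Finset.sum_eq_zero_iff_of_nonneg fun e _ ↦ by rcases h3 e with h | h <;> omega] at h10
  exact h10 f (by simp [hf])

lemma existsUnique_of_sum_eq_one {E N : Type*} [Fintype E] [DecidableEq N] {π : E → N} {a : E → ℤ}
    (ha : ∀ e, a e = 0 ∨ a e = 1) {n : N} (h : ∑ e with π e = n, a e = 1) :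
    ∃! e, a e = 1 ∧ π e = n := by
  have h1 : ∑ e with π e = n, a e = ∑ e with π e = n, if a e = 1 then 1 else 0 := by
    refine Finset.sum_congr rfl fun e _ ↦ ?_
    rcases ha e with h | h <;> simp [h]
  rw [h1, Finset.sum_boole, Finset.filter_filter] at h
  obtain ⟨e, he⟩ := Finset.card_eq_one.1 (by exact_mod_cast h)
  have h2 : ∀ f, f ∈ ({e} : Finset E) ↔ π f = n ∧ a f = 1 := fun f ↦ by simp [← he]
  simp only [Finset.mem_singleton] at h2
  exact ⟨e, ((h2 e).1 rfl).symm, fun f hf ↦ (h2 f).2 hf.symm⟩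

namespace DimerModel

variable {B W E : Type*} {G : DimerModel B W E}

/-- No sector has the same limit in all directions, and the minima of the limits at each node
cancel. This is the content of `sum_fiber_eq_zero` at both colors: its sum vanishes because of the
partners, so the set of edges with constant limit is closed under passing to other edges at the same
node. As the graph is connected and crossing edges do not belong to this set, it is empty. -/
lemma Consistent.sum_minLimit (hG : G.Consistent) (hval : G.NoUnivalentNode) [Fintype E]
    [DecidableEq B] [DecidableEq W] : (∀ e, ¬ G.HasConstantLimit e) ∧
      (∀ b, ∑ e with G.black e = b, G.minLimit e = 0) ∧
      ∀ w, ∑ e with G.white e = w, (G.minLimit e + G.sectorDefect (e, 0)) = 0 := by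
  classical
  have := G.finite_black
  have := G.finite_white
  have := Fintype.ofFinite B
  have := Fintype.ofFinite W
  set β : E → ℤ := fun e ↦ if G.HasConstantLimit e then 1 else 0 with hβ
  set U : Set (ℤ × ℤ) := {u | G.Generic u} with hUdef
  have hU : U.Nonempty := hG.exists_generic
  have h2 : ∀ u ∈ U, ∀ e, 0 ≤ G.edgeLimit e u - G.minLimit e := fun u hu e ↦ by
    have := (hG.minLimit_spec hval e).1 u hu
    omega
  have h3 : ∀ e, β e = 0 ∨ β e = 1 := fun e ↦ by
    simp only [hβ]
    split_ifs <;> simp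
  have h4 : ∀ e, (∀ u ∈ U, G.edgeLimit e u - G.minLimit e = 0) → β e = 1 := fun e h ↦
    if_pos fun u hu ↦ sub_eq_zero.1 (h u hu)
  have h5 : ∑ e, (β e - 2 * G.minLimit e) = 0 := by
    have h6 := hval.sum_partner G.minLimit
    have h7 : ∑ e, (G.minLimit e + G.minLimit (G.partner e)) = ∑ e, β e :=
      Finset.sum_congr rfl fun e _ ↦ hG.minLimit_add_partner hval e
    rw [Finset.sum_add_distrib] at h7
    rw [Finset.sum_sub_distrib, ← Finset.mul_sum]
    linarith
  have h5' : ∑ e, (β e - 2 * (G.minLimit e + G.sectorDefect (e, 0))) = 0 := by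
    rw [← h5, ← sub_eq_zero, ← Finset.sum_sub_distrib]
    have : ∀ e, β e - 2 * (G.minLimit e + G.sectorDefect (e, 0)) - (β e - 2 * G.minLimit e) =
        -2 * G.sectorDefect (e, 0) := fun e ↦ by ring
    simp only [this]
    rw [← Finset.mul_sum, hG.sum_sectorDefect hval, mul_zero]
  have hB : ∀ {e}, β e = 0 → _ := fun {e} he ↦ sum_fiber_eq_zero (π := G.black) hval.1 hU
    (a := fun u e ↦ G.edgeLimit e u - G.minLimit e) (k := G.minLimit) (fun u hu b ↦ by
      rw [Finset.sum_sub_distrib]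
      congr 1
      convert hG.sum_edgeLimit_black hu b) h2 h3 h4 h5 he
  have hW : ∀ {e}, β e = 0 → _ := fun {e} he ↦ sum_fiber_eq_zero (π := G.white) hval.2 hU
    (a := fun u e ↦ G.edgeLimit e u - G.minLimit e)
    (k := fun e ↦ G.minLimit e + G.sectorDefect (e, 0)) (fun u hu w ↦ by
      rw [Finset.sum_sub_distrib, Finset.sum_add_distrib]
      have h := hG.sum_edgeLimit_white hu w
      rw [Finset.sum_add_distrib] at h
      have h' : ∑ e with G.white e = w, G.edgeLimit e u +
        ∑ e with G.white e = w, G.sectorDefect (e, 0) = 1 := by convert h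
      linarith) h2 h3 h4 h5' he
  have hall : ∀ e, β e = 0 := by
    obtain ⟨e₀, hc⟩ := hG.exists_isCrossing hval
    have hB' : ∀ e f, G.black e = G.black f → β e = 0 → β f = 0 := fun e f h he ↦
      (hB he).2 f h.symm
    have hW' : ∀ e f, G.white e = G.white f → β e = 0 → β f = 0 := fun e f h he ↦
      (hW he).2 f h.symm
    have h6 : ∀ e, G.black (G.rotB e) = G.black e := fun e ↦
      ((G.rotB_sameCycle_iff e (G.rotB e)).1 ⟨1, rfl⟩).symm
    have h7 : ∀ e, G.white (G.rotW e) = G.white e := fun e ↦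
      ((G.rotW_sameCycle_iff e (G.rotW e)).1 ⟨1, rfl⟩).symm
    have hinv := G.eq_of_invariant_edge (f := fun e ↦ β e = 0)
      (fun e ↦ propext ⟨hB' _ _ (h6 e), hB' _ _ (h6 e).symm⟩)
      (fun e ↦ propext ⟨hW' _ _ (h7 e), hW' _ _ (h7 e).symm⟩)
    intro e
    rw [hinv e e₀]
    exact if_neg (hG.minLimit_of_isCrossing hval hc).2
  refine ⟨fun e he ↦ ?_, fun b ↦ ?_, fun w ↦ ?_⟩
  · have h6 := hall e
    simp only [hβ, if_pos he] at h6
    omega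
  · obtain ⟨e, rfl⟩ := G.black_surjective b
    exact (hB (hall e)).1
  · obtain ⟨e, rfl⟩ := G.white_surjective w
    exact (hW (hall e)).1

end DimerModel

theorem mainTheorem5 {B W E : Type*} (G : DimerModel B W E) (hval : G.NoUnivalentNode)
    (hG : G.Consistent) : G.NonDegenerate := by
  classical
  have := G.finite_edges
  have := Fintype.ofFinite E
  obtain ⟨hconst, hB, hW⟩ := hG.sum_minLimit hval
  intro e
  have he := hconst e
  simp only [DimerModel.HasConstantLimit] at he
  push Not at he
  obtain ⟨u, hu, hne⟩ := he
  have h1 : ∀ f, G.edgeLimit f u - G.minLimit f = 0 ∨ G.edgeLimit f u - G.minLimit f = 1 :=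
    fun f ↦ by
      have := (hG.minLimit_spec hval f).1 u hu
      omega
  refine ⟨{f | G.edgeLimit f u - G.minLimit f = 1}, ⟨fun b ↦ ?_, fun w ↦ ?_⟩, ?_⟩
  · refine existsUnique_of_sum_eq_one h1 ?_
    rw [Finset.sum_sub_distrib, hB, sub_zero]
    exact hG.sum_edgeLimit_black hu b
  · refine existsUnique_of_sum_eq_one h1 ?_
    have h2 := hG.sum_edgeLimit_white hu w
    have h3 := hW w
    rw [Finset.sum_add_distrib] at h2 h3
    rw [Finset.sum_sub_distrib]
    linarith
  · exact (h1 e).resolve_left fun h ↦ hne (sub_eq_zero.1 h)
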